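/- Let $k$ be a commutative ring and $A$ an associative unital $k$-algebra. An \emph{oriented quantum algebra} $(A,\rho,D,U)$ consists of an invertible $\rho\in A\otimes A$ with $\rho_{12}\rho_{13}\rho_{23}=\rho_{23}\rho_{13}\rho_{12}$ and commuting algebra automorphisms $D,U$ of $A$ such that $(U\otimes U)\rho=\rho=(D\otimes D)\rho$ and such that $(1\otimes U)\rho$ and $(D\otimes 1)\rho^{-1}$ are mutually inverse in $A\otimes A^{op}$. A \emph{bi-oriented quantum algebra} $(A,\rho,\gamma,D,U)$ consists of two oriented quantum algebras $(A,\rho,D,U)$ and $(A,\gamma,D,U)$ with $$\gamma_{12}\gamma_{21}=1,\quad \gamma_{12}\rho_{13}\gamma_{23}=\gamma_{23}\rho_{13}\gamma_{12},\quad \gamma_{12}\gamma_{13}\rho_{23}=\rho_{23}\gamma_{13}\gamma_{12},\quad \rho_{12}\gamma_{13}\gamma_{23}=\gamma_{23}\gamma_{13}\rho_{12}.$$ \textbf{Diagrams.} An oriented virtual link diagram is a plane diagram with real and virtual crossings in general position with respect to the vertical direction, that is, a stack of slices each containing one maximum, one minimum or one crossing (whose two strands may be directed up or down), and vertical strands.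 Two diagrams are equivalent if they are related by plane isotopies and by classical, virtual and mixed (one real, two virtual crossings) Reidemeister moves of types two and three, for all orientations; neither classical nor virtual moves of type one are used. \textbf{State sum.} Write $\rho=\sum e\otimes e'$, $\rho^{-1}=\sum E\otimes E'$, $\gamma=\sum g\otimes g'$ as finite sums. A state assigns to every crossing one summand of its element: of $\rho$ at a positive, $\rho^{-1}$ at a negative, $\gamma$ at a virtual crossing. At a real crossing the first tensor factor is a bead on the upper strand and the second a bead on the lower strand; at a virtual crossing the first factor is put on the strand which crosses the other from the left to the right of that other strand. If one strand is directed up and the other down, the bead on the strand directed down is changed by $U$ if that strand runs from top right to bottom left, and by $D^{-1}$ if it runs from top left to bottom right. Beads slide along the orientation; sliding across a counterclockwise maximum, counterclockwise minimum, clockwise maximum, clockwise minimum applies $U$, $D$, $D^{-1}$, $U^{-1}$, respectively. Choose on every component $c$ a base point on a strand directed up; sliding all beads of $c$ forward to the end of one tour from the base point and multiplying them in the order in which they are met gives $w_c\in A$. Let $d_c$ be the counterclockwise rotation number of $c$. Given a commutative $k$-algebra $R$ and $k$-linear maps $\tau_d:A\to R$ $(d\in\mathbb Z)$, put $$Z_\tau(K)=\sum_{\text{states}}\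 \prod_{c}\tau_{d_c}(w_c)\in R .$$ Call $\tau$ a \emph{loop trace} if $\tau_d((UD)^d(y)\,x)=\tau_d(xy)$ and $\tau_d(UD(x))=\tau_d(x)$ for all $d\in\mathbb Z$ and $x,y\in A$. The universal loop trace takes values in the symmetric algebra $S_k(L)$ of the $k$-module $L=\bigoplus_{d\in\mathbb Z}A/\langle (UD)^d(y)x-xy,\ UD(x)-x\rangle$. \textbf{Theorem.} Let $(A,\rho,\gamma,D,U)$ be any bi-oriented quantum algebra. Then it gives invariants of oriented virtual links up to classical and virtual type one (framing) moves: the state sum with values in $S_k(L)$ defined by the universal loop trace depends neither on the way in which $\rho,\rho^{-1},\gamma$ are written as sums nor on the base points, and it takes the same value on equivalent diagrams. That is, there is a unique function on equivalence classes of diagrams whose value on the class of every diagram is the state sum for every such choice. The same holds for $Z_\tau$, for every commutative $k$-algebra $R$ and every loop trace $\tau$ with values in $R$. -/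

import Mathlib

open scoped TensorProduct

noncomputable section

namespace BiOriented

/-! ### Oriented and bi-oriented quantum algebras -/

section Algebra

variable {k A : Type*} [CommRing k] [Ring A] [Algebra k A]

/-- The map `f ⊗ g : A ⊗ A → A ⊗ Aᵒᵖ`; only the multiplication of the target sees the `ᵒᵖ`. -/
def mapOp (f g : A ≃ₐ[k] A) : A ⊗[k] A →ₗ[k] A ⊗[k] Aᵐᵒᵖ :=
  TensorProduct.map f.toLinearMap ((MulOpposite.opLinearEquiv k).toLinearMap ∘ₗ g.toLinearMap)

/-- `x ↦ x₁₂ = x ⊗ 1` in `A ⊗ A ⊗ A`. -/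
def leg12 : A ⊗[k] A →ₐ[k] A ⊗[k] (A ⊗[k] A) :=
  Algebra.TensorProduct.map (AlgHom.id k A) Algebra.TensorProduct.includeLeft

/-- `x = ∑ e ⊗ e' ↦ x₁₃ = ∑ e ⊗ 1 ⊗ e'` in `A ⊗ A ⊗ A`. -/
def leg13 : A ⊗[k] A →ₐ[k] A ⊗[k] (A ⊗[k] A) :=
  Algebra.TensorProduct.map (AlgHom.id k A) Algebra.TensorProduct.includeRight

/-- `x ↦ x₂₃ = 1 ⊗ x` in `A ⊗ A ⊗ A`. -/
def leg23 : A ⊗[k] A →ₐ[k] A ⊗[k] (A ⊗[k] A) :=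
  Algebra.TensorProduct.includeRight

/-- `(A, ρ, D, U)` is an oriented quantum algebra over `k`. -/
structure IsOrientedQuantumAlgebra (ρ : (A ⊗[k] A)ˣ) (D U : A ≃ₐ[k] A) : Prop where
  comm : ∀ x, D (U x) = U (D x)
  U_inv : TensorProduct.map U.toLinearMap U.toLinearMap (ρ : A ⊗[k] A) = ρ
  D_inv : TensorProduct.map D.toLinearMap D.toLinearMap (ρ : A ⊗[k] A) = ρ
  mul_op : mapOp AlgEquiv.refl U (ρ : A ⊗[k] A) *
    mapOp D AlgEquiv.refl ((ρ⁻¹ : (A ⊗[k] A)ˣ) : A ⊗[k] A) = 1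
  op_mul : mapOp D AlgEquiv.refl ((ρ⁻¹ : (A ⊗[k] A)ˣ) : A ⊗[k] A) *
    mapOp AlgEquiv.refl U (ρ : A ⊗[k] A) = 1
  yangBaxter : leg12 (ρ : A ⊗[k] A) * leg13 (ρ : A ⊗[k] A) * leg23 (ρ : A ⊗[k] A) =
    leg23 (ρ : A ⊗[k] A) * leg13 (ρ : A ⊗[k] A) * leg12 (ρ : A ⊗[k] A)

/-- `(A, ρ, γ, D, U)` is a bi-oriented quantum algebra over `k`. -/
structure IsBiOrientedQuantumAlgebra (ρ γ : (A ⊗[k] A)ˣ) (D U : A ≃ₐ[k] A) : Prop where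
  real : IsOrientedQuantumAlgebra ρ D U
  virtual : IsOrientedQuantumAlgebra γ D U
  involutive : (γ : A ⊗[k] A) * TensorProduct.comm k A A (γ : A ⊗[k] A) = 1
  mixed₁₃ : leg12 (γ : A ⊗[k] A) * leg13 (ρ : A ⊗[k] A) * leg23 (γ : A ⊗[k] A) =
    leg23 (γ : A ⊗[k] A) * leg13 (ρ : A ⊗[k] A) * leg12 (γ : A ⊗[k] A)
  mixed₂₃ : leg12 (γ : A ⊗[k] A) * leg13 (γ : A ⊗[k] A) * leg23 (ρ : A ⊗[k] A) =
    leg23 (ρ : A ⊗[k] A) * leg13 (γ : A ⊗[k] A) * leg12 (γ : A ⊗[k] A)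
  mixed₁₂ : leg12 (ρ : A ⊗[k] A) * leg13 (γ : A ⊗[k] A) * leg23 (γ : A ⊗[k] A) =
    leg23 (γ : A ⊗[k] A) * leg13 (γ : A ⊗[k] A) * leg12 (ρ : A ⊗[k] A)

/-- A way of writing `x ∈ A ⊗ A` as a finite sum `∑ e ⊗ e'`. -/
structure Presentation (x : A ⊗[k] A) where
  size : ℕ
  fst : Fin size → A
  snd : Fin size → A
  sum_eq : ∑ i, fst i ⊗ₜ[k] snd i = x

end Algebra

/-! ### Oriented virtual link diagrams

Diagrams in the plane, in general position with respect to the vertical direction: a diagram is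
read from bottom to top as a list of horizontal slices, each containing exactly one local minimum
(`cup`), local maximum (`cap`) or crossing, and vertical strands to its left and right. -/

inductive Dir
  | up
  | down
  deriving DecidableEq

def Dir.rev : Dir → Dir
  | .up => .down
  | .down => .up

/-- The three crossings of a line `/` with a line `\`: real with `/` above, real with `\` above,
and virtual. -/
inductive Crossing
  | slashOver
  | backslashOver
  | virt
  deriving DecidableEq

/-- The crossing with the roles of `/` and `\` exchanged. -/
def Crossing.flip : Crossing → Crossing
  | .slashOver => .backslashOver
  | .backslashOver => .slashOver
  | .virt => .virt

/-- The elementary pieces. In `cup o` and `cap o` the left leg is directed `o` and the right leg is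
directed oppositely, so `o = up` is a clockwise turn and `o = down` a counterclockwise turn.
In `cross c a b` the strand `/` (from bottom left to top right) is directed `a` and the strand `\`
(from bottom right to top left) is directed `b`. -/
inductive Gen
  | cup (o : Dir)
  | cap (o : Dir)
  | cross (c : Crossing) (a b : Dir)

/-- Directions of the strands at the bottom of a piece, from left to right. -/
def Gen.dom : Gen → List Dir
  | .cup _ => []
  | .cap o => [o, o.rev]
  | .cross _ a b => [a, b]

/-- Directions of the strands at the top of a piece, from left to right. -/
def Gen.cod : Gen → List Dir
  | .cup o => [o, o.rev]
  | .cap _ => []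
  | .cross _ a b => [b, a]

/-- A slice: one piece, with vertical strands to its left and to its right. -/
structure Slice where
  left : List Dir
  gen : Gen
  right : List Dir

def Slice.src (s : Slice) : List Dir := s.left ++ s.gen.dom ++ s.right

def Slice.tgt (s : Slice) : List Dir := s.left ++ s.gen.cod ++ s.right

/-- Add vertical strands to the left and to the right of a slice. -/
def Slice.whisker (l r : List Dir) (s : Slice) : Slice := ⟨l ++ s.left, s.gen, s.right ++ r⟩

/-- The slices fit together, starting from the word `u` and ending in the word `v`. -/
def Composable : List Dir → List Slice → List Dir → Prop
  | u, [], v => u = v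
  | u, s :: t, v => s.src = u ∧ Composable s.tgt t v

/-- An oriented virtual link diagram. -/
structure Diagram where
  slices : List Slice
  closed : Composable [] slices []

/-- The type three moves that are allowed, for three strands numbered from left to right at the
bottom, where `c i j` is the crossing of strands `i < j` (strand `i` being the `/`): either at
least two of the crossings are virtual, or all three are real and the relation
"passes over" is not cyclic. One virtual and two real crossings are forbidden. -/
def TypeThreeAllowed (c12 c13 c23 : Crossing) : Prop :=
  ((c12 = .virt ∧ c13 = .virt) ∨ (c12 = .virt ∧ c23 = .virt) ∨ (c13 = .virt ∧ c23 = .virt)) ∨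
  ((c12 ≠ .virt ∧ c13 ≠ .virt ∧ c23 ≠ .virt) ∧ ¬ (c12 = c23 ∧ c13 ≠ c12))

/-- The local moves, for all directions of the strands: the plane isotopies (exchange of distant
pieces, cancellation of a maximum with a minimum, sliding a maximum or a minimum across a strand),
and the classical, virtual and mixed moves of types two and three. There are no type one moves. -/
inductive LocalMove : List Slice → List Slice → Prop
  | exchange (m : List Dir) (g h : Gen) :
      LocalMove [⟨[], g, m ++ h.dom⟩, ⟨g.cod ++ m, h, []⟩]
        [⟨g.dom ++ m, h, []⟩, ⟨[], g, m ++ h.cod⟩]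
  | zigzagRight (o : Dir) :
      LocalMove [⟨[o], .cup o.rev, []⟩, ⟨[], .cap o, [o]⟩] []
  | zigzagLeft (o : Dir) :
      LocalMove [⟨[], .cup o, [o]⟩, ⟨[o], .cap o.rev, []⟩] []
  | capSlide (c : Crossing) (x y : Dir) :
      LocalMove [⟨[], .cross c x y, [x.rev]⟩, ⟨[y], .cap x, []⟩]
        [⟨[x], .cross c.flip y x.rev, []⟩, ⟨[], .cap x, [y]⟩]
  | cupSlide (c : Crossing) (x y : Dir) :
      LocalMove [⟨[y], .cup x, []⟩, ⟨[], .cross c y x, [x.rev]⟩]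
        [⟨[], .cup x, [y]⟩, ⟨[x], .cross c.flip x.rev y, []⟩]
  | typeTwo (c : Crossing) (x y : Dir) :
      LocalMove [⟨[], .cross c x y, []⟩, ⟨[], .cross c.flip y x, []⟩] []
  | typeThree (c12 c13 c23 : Crossing) (x y z : Dir) (h : TypeThreeAllowed c12 c13 c23) :
      LocalMove
        [⟨[], .cross c12 x y, [z]⟩, ⟨[y], .cross c13 x z, []⟩, ⟨[], .cross c23 y z, [x]⟩]
        [⟨[x], .cross c23 y z, []⟩, ⟨[], .cross c13 x z, [y]⟩, ⟨[z], .cross c12 x y, []⟩]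

/-- `K'` arises from `K` by one local move, performed anywhere in the diagram. -/
def Move (K K' : Diagram) : Prop :=
  ∃ (l r : List Dir) (pre X Y post : List Slice), LocalMove X Y ∧
    K.slices = pre ++ X.map (Slice.whisker l r) ++ post ∧
    K'.slices = pre ++ Y.map (Slice.whisker l r) ++ post

/-- Oriented virtual links up to (classical and virtual) framing: diagrams modulo the equivalence
relation generated by all generalized Reidemeister moves except those of type one. -/
def FramedVirtualLink : Type := Quot Move

def FramedVirtualLink.mk (K : Diagram) : FramedVirtualLink := Quot.mk Move K

/-! ### Traversing a diagram

The edge `(i, p)` is the piece of strand at the bottom of the `i`-th slice in position `p` (both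
counted from `0`). -/

/-- The position `p` at the bottom (for strands directed up) or at the top (for strands directed
down) of the slice belongs to the piece of that slice. -/
def Slice.Hits (s : Slice) (d : Dir) (p : ℕ) : Prop :=
  s.left.length ≤ p ∧ p < s.left.length +
    (match d with
      | .up => s.gen.dom.length
      | .down => s.gen.cod.length)

instance (s : Slice) (d : Dir) (p : ℕ) : Decidable (s.Hits d p) := by
  unfold Slice.Hits; infer_instance

/-- Where a strand leads that enters the `i`-th slice `s` from below in position `p`: it is turned
back by a maximum, changes sides at a crossing, and goes straight up otherwise. -/
def Slice.ascend (s : Slice) (i p : ℕ) : ℕ × ℕ :=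
  if s.Hits .up p then
    (match s.gen with
      | .cap _ => i
      | _ => i + 1, 2 * s.left.length + 1 - p)
  else (i + 1, if p < s.left.length then p else p - s.gen.dom.length + s.gen.cod.length)

/-- Where a strand leads that enters the `i`-th slice `s` from above in position `p`. -/
def Slice.descend (s : Slice) (i p : ℕ) : ℕ × ℕ :=
  if s.Hits .down p then
    (match s.gen with
      | .cup _ => i + 1
      | _ => i, 2 * s.left.length + 1 - p)
  else (i, if p < s.left.length then p else p - s.gen.cod.length + s.gen.dom.length)

/-- The direction of an edge; `none` if there is no such edge in the diagram. -/
def Diagram.dir (K : Diagram) (e : ℕ × ℕ) : Option Dir :=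
  K.slices[e.1]?.bind fun s => s.src[e.2]?

/-- The index of the slice that is entered at the end of the edge `e`, and the direction of `e`. -/
def Diagram.enters (K : Diagram) (e : ℕ × ℕ) : Option (Fin K.slices.length × Dir) :=
  match K.dir e with
  | none => none
  | some d =>
    let i := match d with
      | .up => e.1
      | .down => e.1 - 1
    if h : i < K.slices.length then some (⟨i, h⟩, d) else none

/-- The edge that follows `e` along the orientation. -/
def Diagram.next (K : Diagram) (e : ℕ × ℕ) : ℕ × ℕ :=
  match K.enters e with
  | some (i, .up) => K.slices[i].ascend i e.2
  | some (i, .down) => K.slices[i].descend i e.2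
  | none => e

/-- The counterclockwise rotation of a strand in a slice, in half turns. -/
def Slice.halfTurns (s : Slice) (d : Dir) (p : ℕ) : ℤ :=
  if s.Hits d p then
    match s.gen with
    | .cup .up | .cap .up => -1
    | .cup .down | .cap .down => 1
    | .cross _ _ _ => 0
  else 0

/-- The edges passed on one tour around the component of the diagram through `e`. -/
def Diagram.tour (K : Diagram) (e : ℕ × ℕ) : List (ℕ × ℕ) :=
  (List.range (Function.minimalPeriod K.next e)).map fun j => K.next^[j] e

/-- The counterclockwise rotation number (Whitney degree) of the component through `e`; the number
of half turns is always even. -/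
def Diagram.rotation (K : Diagram) (e : ℕ × ℕ) : ℤ :=
  ((K.tour e).map fun x =>
    match K.enters x with
    | some (i, d) => K.slices[i].halfTurns d x.2
    | none => 0).sum / 2

/-- Base points for a diagram: a set of edges, all directed up, one on every component. -/
structure BasePoints (K : Diagram) where
  edges : Finset (ℕ × ℕ)
  up : ∀ b ∈ edges, K.dir b = some .up
  existsUnique : ∀ e, (K.dir e).isSome → ∃! b, b ∈ edges ∧ e ∈ K.tour b

/-! ### The state sum -/

/-- The type of a crossing, independent of how it is turned in the plane: positive, negative or
virtual. -/
inductive CrossingType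
  | positive
  | negative
  | virt

def Crossing.type : Crossing → Dir → Dir → CrossingType
  | .slashOver, a, b => if a = b then .positive else .negative
  | .backslashOver, a, b => if a = b then .negative else .positive
  | .virt, _, _ => .virt

/-- Whether the first tensor factor is placed on the strand `/`. At a real crossing it is
placed on the upper strand; at a virtual crossing it is placed on the strand that crosses the other
one from the left to the right of that other strand. -/
def Crossing.FirstOnSlash : Crossing → Dir → Dir → Prop
  | .slashOver, _, _ => True
  | .backslashOver, _, _ => False
  | .virt, a, b => a = b

instance (c : Crossing) (a b : Dir) : Decidable (c.FirstOnSlash a b) := by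
  cases c <;> unfold Crossing.FirstOnSlash <;> infer_instance

section StateSum

variable {k A : Type*} [CommRing k] [Ring A] [Algebra k A]

/-- The element of `A ⊗ A` that decorates a crossing. -/
def vertexElement (ρ γ : (A ⊗[k] A)ˣ) : CrossingType → A ⊗[k] A
  | .positive => ρ
  | .negative => (ρ⁻¹ : (A ⊗[k] A)ˣ)
  | .virt => γ

/-- `ρ`, `ρ⁻¹` and `γ` written as finite sums of elementary tensors. -/
abbrev Presentations (ρ γ : (A ⊗[k] A)ˣ) := ∀ t, Presentation (vertexElement ρ γ t)

variable {ρ γ : (A ⊗[k] A)ˣ} (D U : A ≃ₐ[k] A) (P : Presentations ρ γ)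

/-- The number of labels available for a piece: a crossing is labelled by one of the summands of
its element, other pieces carry no choice. -/
def Gen.count : Gen → ℕ
  | .cross c a b => (P (c.type a b)).size
  | _ => 1

/-- The bead on the strand `/` of a crossing. At a crossing with both strands directed up or both
directed down it is a tensor factor; the sideways crossings arise by turning the crossing, which
carries the bead of the strand that is now directed down across a maximum. -/
def slashBead (c : Crossing) (a b : Dir) (n : Fin (P (c.type a b)).size) : A :=
  let x := if c.FirstOnSlash a b then (P (c.type a b)).fst n else (P (c.type a b)).snd n
  if a = .down ∧ b = .up then U x else x

/-- The bead on the strand `\` of a crossing. -/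
def backslashBead (c : Crossing) (a b : Dir) (n : Fin (P (c.type a b)).size) : A :=
  let x := if c.FirstOnSlash a b then (P (c.type a b)).snd n else (P (c.type a b)).fst n
  if a = .up ∧ b = .down then D.symm x else x

/-- Carry a bead `w` along a strand through a piece, multiplying it with the bead met there.
A bead that slides along the orientation across a counterclockwise maximum or minimum is changed
by `U` or `D`, respectively, and across a clockwise maximum or minimum by `D⁻¹` or `U⁻¹`.
`onSlash` tells which strand of a crossing is followed. -/
def Gen.carry (g : Gen) (n : Fin (g.count P)) (onSlash : Prop) [Decidable onSlash] (w : A) : A :=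
  match g, n with
  | .cap .down, _ => U w
  | .cup .down, _ => D w
  | .cap .up, _ => D.symm w
  | .cup .up, _ => U.symm w
  | .cross c a b, n => w * if onSlash then slashBead U P c a b n else backslashBead D P c a b n

/-- A state labels every crossing by one summand of its element. -/
abbrev State (K : Diagram) := ∀ i : Fin K.slices.length, Fin (K.slices[i].gen.count P)

/-- Carry a bead `w` from the edge `e` to the next edge. -/
def Diagram.carry (K : Diagram) (σ : State P K) (w : A) (e : ℕ × ℕ) : A :=
  match K.enters e with
  | some (i, d) =>
    if K.slices[i].Hits d e.2 then
      K.slices[i].gen.carry D U P (σ i) (d = .up ↔ e.2 = K.slices[i].left.length) w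
    else w
  | none => w

/-- The product of all beads of the component through the base point `b`, after all of them have
been slid along the orientation to the end of one tour starting at `b`. -/
def Diagram.loopBead (K : Diagram) (σ : State P K) (b : ℕ × ℕ) : A :=
  (K.tour b).foldl (K.carry D U P σ) 1

/-- The state sum: the sum over all states of the product over all components of the evaluations
`τ d w` of a closed loop of rotation number `d` carrying the bead `w`. -/
def stateSum {R : Type*} [CommRing R] [Algebra k R] (τ : ℤ → A →ₗ[k] R) (K : Diagram)
    (B : BasePoints K) : R :=
  ∑ σ : State P K, ∏ b ∈ B.edges, τ (K.rotation b) (K.loopBead D U P σ b)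

/-- The evaluations of beads on closed loops that respect sliding a bead around the loop: for
`d`-fold counterclockwise rotation this changes the bead by `(UD) ^ d`, and it does not matter
where on the loop the base point lies. -/
structure IsLoopTrace {R : Type*} [CommRing R] [Algebra k R] (τ : ℤ → A →ₗ[k] R) : Prop where
  cyclic : ∀ (d : ℤ) (x y : A), τ d (((U * D) ^ d) y * x) = τ d (x * y)
  shift : ∀ (d : ℤ) (x : A), τ d (U (D x)) = τ d x

/-- The relations that hold between beads on closed loops; `Finsupp.single d x` stands for a loop
of rotation number `d` carrying the bead `x`. -/
def loopRelations : Submodule k (ℤ →₀ A) :=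
  Submodule.span k
    ({v | ∃ (d : ℤ) (x y : A),
        v = Finsupp.single d (((U * D) ^ d) y * x) - Finsupp.single d (x * y)} ∪
      {v | ∃ (d : ℤ) (x : A), v = Finsupp.single d (U (D x)) - Finsupp.single d x})

/-- The module of beaded closed loops. -/
abbrev LoopModule := (ℤ →₀ A) ⧸ loopRelations D U

/-- The universal evaluation of beaded loops: unordered systems of loops are multiplied in the
symmetric algebra. -/
def universalTrace (d : ℤ) : A →ₗ[k] SymmetricAlgebra k (LoopModule D U) :=
  SymmetricAlgebra.ι k (LoopModule D U) ∘ₗ (loopRelations D U).mkQ ∘ₗ Finsupp.lsingle d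

end StateSum

end BiOriented

end

/-!
The state sum is rewritten until its invariance becomes a list of identities between tensors.

**A frame.** Put `θ = UD`. If every bead on a strand directed down is changed by `D` (`frame`), then
clockwise maxima and counterclockwise minima no longer act, whereas a counterclockwise maximum acts
by `θ` and a clockwise minimum by `θ⁻¹`. These two act like multiplication by a unit `turn` and its
inverse in a ring that contains `A` and satisfies `a * turn = turn * θ a`, the skew Laurent ring of
`θ`. So instead of carrying a bead along a loop, one multiplies the beads met on the loop, where
turns are beads as well (`Gen.bead`), and the exponent of `turn` is the rotation number
(`trace_loopWord`). A loop trace `τ` is exactly what is needed for `turn ^ d * a ↦ τ d a` to be a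
trace on this ring (`exists_traceRing`). Cyclic invariance of this trace makes the value of a loop
independent of its base point (`loopProd_eq_of_isTransversal`).

**Tangles.** The state sum is now a sum, over the labels of the crossings, of a product of traces
over the orbits of the permutation `follow` of the directed edges of the diagram
(`stateSum_eq_labelSum`). Part of the diagram can be replaced if its strands connect the same end
points and the beads on its strands, summed over the labels, form the same tensor
(`TangleEquiv`). Indeed, the product over the orbits does not change under passing to the first
return map to the edges outside that part (`IsFirstReturn.loopProd_image`), where each strand of the
part has become a single bead, and it is linear in each of these beads. This also shows that the
presentations of `ρ`, `ρ⁻¹` and `γ` as sums do not matter (`labelSum_presentation`).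

**Local moves.** In the frame, the tensor at a crossing with strands directed `x` and `y` is
`crossingTensor`: it is obtained from one invertible tensor `N c` for each of the three crossings
of a line `/` with a line `\`, with `N c.flip` the flipped inverse of `N c`, by letting `θ` act on
one factor and by inverting (`sum_frame_bead`). Multiplying beads along strands directed down
reverses the order, so the moves of type two and three become identities in a tensor power of `A` in
which some factors are replaced by `Aᵒᵖ`. For strands directed up these are `N c * (N c)⁻¹ = 1` and
the Yang–Baxter equations for the triples `N c₁₂`, `N c₁₃`, `N c₂₃`, which follow from those of `ρ`
and `γ` and from the three mixed ones by permuting the strands (`YangBaxter.swap_left`,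
`YangBaxter.swap_right`). Sideways crossings of type two are the condition in `A ⊗ Aᵒᵖ`, and the
remaining type three moves follow by inverting and transposing factors (`IsCrossingFamily.typeTwo`,
`IsCrossingFamily.typeThree`). Sliding a turn across a strand uses that `N c` is invariant under
`θ ⊗ θ`, and a zigzag can be straightened because its two turns have inverse beads.
-/

open scoped TensorProduct

noncomputable section

namespace BiOriented

/-! ### Beads on the orbits of a map -/

section Orbits

open Function

variable {α α' B R : Type*}

section Words

variable [Monoid B]

/-- The product of the beads `β` met at the first `t` points of the orbit of `x`. -/
def orbitWord (f : α → α) (β : α → B) (x : α) (t : ℕ) : B :=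
  ((List.range t).map fun j => β (f^[j] x)).prod

@[simp] lemma orbitWord_zero (f : α → α) (β : α → B) (x : α) : orbitWord f β x 0 = 1 := by
  simp [orbitWord]

lemma orbitWord_succ (f : α → α) (β : α → B) (x : α) (t : ℕ) :
    orbitWord f β x (t + 1) = orbitWord f β x t * β (f^[t] x) := by
  simp [orbitWord, List.range_succ]

lemma orbitWord_add (f : α → α) (β : α → B) (x : α) (s t : ℕ) :
    orbitWord f β x (s + t) = orbitWord f β x s * orbitWord f β (f^[s] x) t := by
  induction t with
  | zero => simp
  | succ t ih =>
    rw [← add_assoc, orbitWord_succ, ih, orbitWord_succ, mul_assoc, ← iterate_add_apply,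
      add_comm t s]

lemma orbitWord_succ' (f : α → α) (β : α → B) (x : α) (t : ℕ) :
    orbitWord f β x (t + 1) = β x * orbitWord f β (f x) t := by
  rw [add_comm, orbitWord_add]
  simp [orbitWord]

lemma orbitWord_congr {f : α → α} {β β' : α → B} {x : α} {t : ℕ}
    (h : ∀ j < t, β (f^[j] x) = β' (f^[j] x)) : orbitWord f β x t = orbitWord f β' x t := by
  unfold orbitWord
  congr 1
  exact List.map_congr_left fun j hj => h j (List.mem_range.1 hj)

/-- The product of the beads on the periodic orbit of `x`, starting at `x`. -/
def loopWord (f : α → α) (β : α → B) (x : α) : B := orbitWord f β x (minimalPeriod f x)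

lemma trace_loopWord_apply {T : B → R} (hT : ∀ x y, T (x * y) = T (y * x)) {f : α → α} {x : α}
    (hx : x ∈ periodicPts f) (β : α → B) : T (loopWord f β (f x)) = T (loopWord f β x) := by
  obtain ⟨p, hp⟩ := Nat.exists_eq_succ_of_ne_zero (minimalPeriod_pos_of_mem_periodicPts hx).ne'
  have hx' : f^[p] (f x) = x := by
    rw [← iterate_succ_apply, ← hp, iterate_minimalPeriod]
  rw [loopWord, loopWord, minimalPeriod_apply hx, hp, Nat.succ_eq_add_one, orbitWord_succ, hx',
    orbitWord_succ', hT]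

lemma trace_loopWord_iterate {T : B → R} (hT : ∀ x y, T (x * y) = T (y * x)) {f : α → α} {x : α}
    (hx : x ∈ periodicPts f) (β : α → B) (m : ℕ) :
    T (loopWord f β (f^[m] x)) = T (loopWord f β x) := by
  induction m with
  | zero => rfl
  | succ m ih =>
    rw [iterate_succ_apply', trace_loopWord_apply hT _ β, ih]
    obtain ⟨n, hn, h⟩ := hx
    exact ⟨n, hn, h.apply_iterate m⟩

end Words

lemma exists_iterate_eq_of_iterate_eq {f : α → α} {x y : α} (hx : x ∈ periodicPts f) {m : ℕ}
    (h : f^[m] x = y) : ∃ n, f^[n] y = x := by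
  obtain ⟨p, hp, hpx⟩ := hx
  refine ⟨p * m - m, ?_⟩
  rw [← h, ← iterate_add_apply, Nat.sub_add_cancel (Nat.le_mul_of_pos_left m hp)]
  exact hpx.mul_const m

/-- A finite set of points that meets every orbit in `V` exactly once. -/
structure IsTransversal (f : α → α) (V : Set α) (S : Finset α) : Prop where
  mem : ∀ b ∈ S, b ∈ V
  existsUnique : ∀ v ∈ V, ∃! b, b ∈ S ∧ ∃ m, f^[m] b = v

/-- The product over the orbits of the traces of their beads. -/
def loopProd [Monoid B] [CommMonoid R] (T : B → R) (f : α → α) (β : α → B) (S : Finset α) : R :=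
  ∏ b ∈ S, T (loopWord f β b)

lemma loopProd_eq_of_isTransversal [Monoid B] [CommMonoid R] {T : B → R}
    (hT : ∀ x y, T (x * y) = T (y * x)) {f : α → α} {V : Set α} (hV : V ⊆ periodicPts f)
    (β : α → B) {S S' : Finset α} (hS : IsTransversal f V S) (hS' : IsTransversal f V S') :
    loopProd T f β S = loopProd T f β S' := by
  choose! r hr using fun v hv => (hS'.existsUnique v hv).exists
  refine Finset.prod_bij (fun b _ => r b) (fun b hb => (hr b (hS.mem b hb)).1) ?_ ?_ ?_
  · intro b hb c hc hbc
    obtain ⟨m, hm⟩ := (hr b (hS.mem b hb)).2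
    obtain ⟨m', hm'⟩ := (hr c (hS.mem c hc)).2
    obtain ⟨n, hn⟩ := exists_iterate_eq_of_iterate_eq
      (hV (hS'.mem _ (hr b (hS.mem b hb)).1)) hm
    refine (hS.existsUnique c (hS.mem c hc)).unique ⟨hb, m' + n, ?_⟩ ⟨hc, 0, rfl⟩
    rw [iterate_add_apply, hn]
    simpa only [hbc] using hm'
  · intro c hc
    obtain ⟨b, ⟨hb, m, hm⟩, -⟩ := hS.existsUnique c (hS'.mem c hc)
    refine ⟨b, hb, ?_⟩
    obtain ⟨hr1, n, hn⟩ := hr b (hS.mem b hb)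
    refine (hS'.existsUnique c (hS'.mem c hc)).unique ⟨hr1, m + n, ?_⟩ ⟨hc, 0, rfl⟩
    rw [iterate_add_apply, hn, hm]
  · intro b hb
    obtain ⟨hr1, n, hn⟩ := hr b (hS.mem b hb)
    rw [← trace_loopWord_iterate hT (hV (hS'.mem _ hr1)) β n, hn]

/-- The product over the orbits is linear in every single bead, because every bead occurs exactly
once in it. -/
lemma loopProd_update {k : Type*} [CommSemiring k] [Semiring B] [Algebra k B] [CommSemiring R]
    [Algebra k R] [DecidableEq α] {T : B →ₗ[k] R} (hT : ∀ x y, T (x * y) = T (y * x)) {f : α → α}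
    {V : Set α} (hV : V ⊆ periodicPts f) {S : Finset α} (hS : IsTransversal f V S) {q : α}
    (hq : q ∈ V) (β : α → B) :
    ∃ φ : B →ₗ[k] R, ∀ x, loopProd T f (update β q x) S = φ x := by
  obtain ⟨b, ⟨hb, m, hm⟩, huniq⟩ := hS.existsUnique q hq
  obtain ⟨p, hp⟩ :=
    Nat.exists_eq_succ_of_ne_zero (minimalPeriod_pos_of_mem_periodicPts (hV hq)).ne'
  refine ⟨(∏ c ∈ S.erase b, T (loopWord f β c)) •
    T ∘ₗ LinearMap.mulRight k (orbitWord f β (f q) p), fun x => ?_⟩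
  have h1 : T (loopWord f (update β q x) b) = T (x * orbitWord f β (f q) p) := by
    rw [← trace_loopWord_iterate hT (hV (hS.mem b hb)) _ m, hm, loopWord, hp,
      Nat.succ_eq_add_one, orbitWord_succ', update_self]
    congr 2
    refine orbitWord_congr fun j hj => update_of_ne (fun h => ?_) _ _
    rw [← iterate_succ_apply] at h
    have := IsPeriodicPt.minimalPeriod_le (Nat.succ_pos j) h
    lia
  have h2 : ∀ c ∈ S.erase b, T (loopWord f (update β q x) c) = T (loopWord f β c) := by
    intro c hc
    rw [Finset.mem_erase] at hc
    congr 1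
    exact orbitWord_congr fun j _ => update_of_ne (fun h => hc.1 (huniq c ⟨hc.2, j, h⟩)) _ _
  rw [loopProd, ← Finset.mul_prod_erase S _ hb, h1, Finset.prod_congr rfl h2, mul_comm]
  simp

/-- A finite set of periodic points has a transversal, whose points can be chosen to satisfy any
condition that is satisfied somewhere on every orbit. -/
lemma exists_isTransversal {f : α → α} {V : Set α} (hfin : V.Finite) (hV : V ⊆ periodicPts f)
    (hf : ∀ v ∈ V, f v ∈ V) (p : α → Prop) (hp : ∀ v ∈ V, ∃ m, p (f^[m] v)) :
    ∃ S, IsTransversal f V S ∧ ∀ b ∈ S, p b := by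
  classical
  have hiter (v : α) (hv : v ∈ V) (m : ℕ) : f^[m] v ∈ V := by
    induction m with
    | zero => exact hv
    | succ m ih => rw [iterate_succ_apply']; exact hf _ ih
  -- The chosen point depends on the set of points of the orbit only.
  let r (v : α) : α := @Classical.epsilon α ⟨v⟩ fun b => p b ∧ ∃ m, f^[m] v = b
  have hr (v : α) (hv : v ∈ V) : p (r v) ∧ ∃ m, f^[m] v = r v := by
    obtain ⟨m, hm⟩ := hp v hv
    exact @Classical.epsilon_spec α (fun b => p b ∧ ∃ m, f^[m] v = b) ⟨_, hm, m, rfl⟩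
  have hreq (v w : α) (hv : v ∈ V) (h : ∃ m, f^[m] v = w) : r w = r v := by
    obtain ⟨m, hm⟩ := h
    obtain ⟨n, hn⟩ := exists_iterate_eq_of_iterate_eq (hV hv) hm
    have : (fun b => p b ∧ ∃ m, f^[m] w = b) = fun b => p b ∧ ∃ m, f^[m] v = b := by
      funext b
      refine propext (and_congr_right fun _ => ⟨?_, ?_⟩)
      · rintro ⟨l, hl⟩
        exact ⟨l + m, by rw [iterate_add_apply, hm, hl]⟩
      · rintro ⟨l, hl⟩
        exact ⟨l + n, by rw [iterate_add_apply, hn, hl]⟩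
    simp only [r, this]
  have hmem (v : α) (hv : v ∈ V) : r v ∈ V := by
    obtain ⟨m, hm⟩ := (hr v hv).2
    exact hm ▸ hiter v hv m
  refine ⟨hfin.toFinset.image r, ⟨fun b hb => ?_, fun v hv => ?_⟩, fun b hb => ?_⟩
  · obtain ⟨v, hv, rfl⟩ := Finset.mem_image.1 hb
    exact hmem v (hfin.mem_toFinset.1 hv)
  · obtain ⟨m, hm⟩ := (hr v hv).2
    refine ⟨r v, ⟨Finset.mem_image_of_mem _ (hfin.mem_toFinset.2 hv),
      exists_iterate_eq_of_iterate_eq (hV hv) hm⟩, ?_⟩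
    rintro b ⟨hb, l, hl⟩
    obtain ⟨w, hw, rfl⟩ := Finset.mem_image.1 hb
    have hw := hfin.mem_toFinset.1 hw
    rw [← hreq w (r w) hw (hr w hw).2, ← hreq (r w) v (hmem w hw) ⟨l, hl⟩]
  · obtain ⟨v, hv, rfl⟩ := Finset.mem_image.1 hb
    exact (hr v (hfin.mem_toFinset.1 hv)).1

/-- A map that is injective on a finite invariant set is periodic there. -/
lemma subset_periodicPts {f : α → α} {V : Set α} (hfin : V.Finite) (hf : ∀ v ∈ V, f v ∈ V)
    (hinj : ∀ v ∈ V, ∀ w ∈ V, f v = f w → v = w) : V ⊆ periodicPts f := by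
  intro v hv
  have hiter (m : ℕ) : f^[m] v ∈ V := by
    induction m with
    | zero => exact hv
    | succ m ih => rw [iterate_succ_apply']; exact hf _ ih
  have := hfin.to_subtype
  obtain ⟨a, b, hab, h⟩ :=
    Finite.exists_ne_map_eq_of_infinite fun m : ℕ => (⟨f^[m] v, hiter m⟩ : V)
  replace h : f^[a] v = f^[b] v := congrArg Subtype.val h
  wlog hlt : a < b generalizing a b
  · exact this b a hab.symm h.symm (by lia)
  refine ⟨b - a, by lia, ?_⟩
  have hcancel (m : ℕ) (w : α) (hw : ∀ n, f^[n] w ∈ V) (h : f^[m] w = f^[m] v) : w = v := by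
    induction m with
    | zero => exact h
    | succ m ih =>
      rw [iterate_succ_apply', iterate_succ_apply'] at h
      exact ih (hinj _ (hw m) _ (hiter m) h)
  refine hcancel a _ (fun n => ?_) ?_
  · rw [← iterate_add_apply]
    exact hiter _
  · rw [← iterate_add_apply, Nat.add_sub_cancel' hlt.le, h]

/-- The map `g` on `Q` is the first return map of `f` to the image of `Q` under `ι`, which meets
all orbits in `V`; the first return takes `n q` steps. -/
structure IsFirstReturn (f : α → α) (V : Set α) (g : α' → α') (Q : Set α') (ι : α' → α)
    (n : α' → ℕ) : Prop where
  periodic : V ⊆ periodicPts f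
  mapsTo : ∀ q ∈ Q, ι q ∈ V
  injOn : ∀ q ∈ Q, ∀ q' ∈ Q, ι q = ι q' → q = q'
  invariant : ∀ q ∈ Q, g q ∈ Q
  pos : ∀ q ∈ Q, 0 < n q
  return_eq : ∀ q ∈ Q, f^[n q] (ι q) = ι (g q)
  first : ∀ q ∈ Q, ∀ j, 0 < j → j < n q → ∀ q' ∈ Q, f^[j] (ι q) ≠ ι q'
  reach : ∀ v ∈ V, ∃ m, ∃ q ∈ Q, f^[m] v = ι q

namespace IsFirstReturn

variable {f : α → α} {V : Set α} {g : α' → α'} {Q : Set α'} {ι : α' → α} {n : α' → ℕ}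

/-- The time of the `m`-th return to `Q`. -/
def time (g : α' → α') (n : α' → ℕ) (q : α') (m : ℕ) : ℕ := ∑ i ∈ Finset.range m, n (g^[i] q)

lemma iterate_mem (h : IsFirstReturn f V g Q ι n) {q : α'} (hq : q ∈ Q) (m : ℕ) :
    g^[m] q ∈ Q := by
  induction m with
  | zero => exact hq
  | succ m ih => rw [iterate_succ_apply']; exact h.invariant _ ih

lemma iterate_time (h : IsFirstReturn f V g Q ι n) {q : α'} (hq : q ∈ Q) (m : ℕ) :
    f^[time g n q m] (ι q) = ι (g^[m] q) := by
  induction m with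
  | zero => rfl
  | succ m ih =>
    rw [time, Finset.sum_range_succ, add_comm, iterate_add_apply, ← time, ih,
      h.return_eq _ (h.iterate_mem hq m), iterate_succ_apply']

lemma strictMono_time (h : IsFirstReturn f V g Q ι n) {q : α'} (hq : q ∈ Q) :
    StrictMono (time g n q) := by
  refine strictMono_nat_of_lt_succ fun m => ?_
  rw [time, time, Finset.sum_range_succ]
  have := h.pos _ (h.iterate_mem hq m)
  lia

lemma exists_time_eq (h : IsFirstReturn f V g Q ι n) {q q' : α'} (hq : q ∈ Q) (hq' : q' ∈ Q)
    {t : ℕ} (ht : f^[t] (ι q) = ι q') : ∃ m, t = time g n q m := by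
  have hex : ∃ m, t < time g n q (m + 1) := ⟨t, lt_of_lt_of_le (Nat.lt_succ_self t)
    ((h.strictMono_time hq).le_apply)⟩
  classical
  obtain ⟨m, hm, hmin⟩ : ∃ m, t < time g n q (m + 1) ∧ time g n q m ≤ t := by
    refine ⟨Nat.find hex, Nat.find_spec hex, ?_⟩
    rcases hm : Nat.find hex with _ | l
    · simp [time]
    · have := Nat.find_min hex (m := l) (by lia)
      lia
  refine ⟨m, ?_⟩
  by_contra hne
  refine h.first _ (h.iterate_mem hq m) (t - time g n q m) (by lia) ?_ q' hq' ?_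
  · rw [time, Finset.sum_range_succ, ← time] at hm
    lia
  · rw [← h.iterate_time hq m, ← iterate_add_apply, Nat.sub_add_cancel hmin, ht]

lemma exists_period (h : IsFirstReturn f V g Q ι n) {q : α'} (hq : q ∈ Q) :
    q ∈ periodicPts g ∧ minimalPeriod f (ι q) = time g n q (minimalPeriod g q) := by
  have hpos := minimalPeriod_pos_of_mem_periodicPts (h.periodic (h.mapsTo q hq))
  obtain ⟨m, hm⟩ := h.exists_time_eq hq hq (iterate_minimalPeriod (f := f) (x := ι q))
  have hmpos : 0 < m := by
    rcases Nat.eq_zero_or_pos m with rfl | h0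
    · simp [time] at hm; lia
    · exact h0
  have hgm : IsPeriodicPt g m q := by
    refine h.injOn _ (h.iterate_mem hq m) _ hq ?_
    rw [← h.iterate_time hq m, ← hm, iterate_minimalPeriod]
  refine ⟨⟨m, hmpos, hgm⟩, le_antisymm ?_ ?_⟩
  · refine IsPeriodicPt.minimalPeriod_le ?_ ?_
    · exact lt_of_le_of_lt (Nat.zero_le _)
        ((h.strictMono_time hq) (hgm.minimalPeriod_pos hmpos))
    · rw [IsPeriodicPt, IsFixedPt, h.iterate_time hq, iterate_minimalPeriod]
  · rw [hm]
    exact (h.strictMono_time hq).monotone (hgm.minimalPeriod_le hmpos)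

lemma periodic_return (h : IsFirstReturn f V g Q ι n) : Q ⊆ periodicPts g :=
  fun _ hq => (h.exists_period hq).1

lemma isTransversal [DecidableEq α] (h : IsFirstReturn f V g Q ι n) {S : Finset α'}
    (hS : IsTransversal g Q S) : IsTransversal f V (S.image ι) := by
  refine ⟨fun b hb => ?_, fun v hv => ?_⟩
  · obtain ⟨q, hq, rfl⟩ := Finset.mem_image.1 hb
    exact h.mapsTo q (hS.mem q hq)
  · obtain ⟨m, q, hq, hm⟩ := h.reach v hv
    obtain ⟨b, ⟨hb, t, ht⟩, huniq⟩ := hS.existsUnique q hq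
    obtain ⟨m', hm'⟩ := exists_iterate_eq_of_iterate_eq (h.periodic hv) hm
    refine ⟨ι b, ⟨Finset.mem_image_of_mem _ hb, m' + time g n b t, ?_⟩, ?_⟩
    · rw [iterate_add_apply, h.iterate_time (hS.mem b hb), ht, hm']
    · rintro c ⟨hc, l, hl⟩
      obtain ⟨b', hb', rfl⟩ := Finset.mem_image.1 hc
      have hl' : f^[m + l] (ι b') = ι q := by rw [iterate_add_apply, hl, hm]
      obtain ⟨l', hl''⟩ := h.exists_time_eq (hS.mem _ hb') hq hl'
      rw [hl'', h.iterate_time (hS.mem _ hb')] at hl'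
      exact congrArg ι (huniq b' ⟨hb', l', h.injOn _ (h.iterate_mem (hS.mem _ hb') _) _ hq hl'⟩)

variable [Monoid B] {β : α → B} {β' : α' → B}

lemma orbitWord_time (h : IsFirstReturn f V g Q ι n)
    (hβ : ∀ q ∈ Q, orbitWord f β (ι q) (n q) = β' q) {q : α'} (hq : q ∈ Q) (m : ℕ) :
    orbitWord f β (ι q) (time g n q m) = orbitWord g β' q m := by
  induction m with
  | zero => simp [time]
  | succ m ih =>
    rw [time, Finset.sum_range_succ, ← time, orbitWord_add, ih, h.iterate_time hq,
      hβ _ (h.iterate_mem hq m), orbitWord_succ]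

/-- Passing to the first return map changes neither the orbits nor the products of their beads. -/
lemma loopProd_image [CommMonoid R] [DecidableEq α] (h : IsFirstReturn f V g Q ι n)
    (hβ : ∀ q ∈ Q, orbitWord f β (ι q) (n q) = β' q) (T : B → R) {S : Finset α'}
    (hS : IsTransversal g Q S) : loopProd T f β (S.image ι) = loopProd T g β' S := by
  rw [loopProd, Finset.prod_image
    fun b hb c hc hbc => h.injOn b (hS.mem b hb) c (hS.mem c hc) hbc]
  refine Finset.prod_congr rfl fun b hb => ?_
  rw [loopWord, (h.exists_period (hS.mem b hb)).2, h.orbitWord_time hβ (hS.mem b hb), loopWord]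

end IsFirstReturn

end Orbits

/-! ### The skew Laurent ring of the half turns -/

section TraceRing

universe v

variable {k R : Type*} {A : Type v} [CommRing k] [Ring A] [Algebra k A] [CommRing R] [Algebra k R]

/-- A `k`-algebra `B` with a homomorphism `incl` from `A`, an invertible element `turn` such that
`incl a * turn = turn * incl (θ a)`, and a trace whose value on `turn ^ d * incl a` is `τ d a`. -/
structure TraceRing (θ : A ≃ₐ[k] A) (τ : ℤ → A →ₗ[k] R) (B : Type*) [Ring B] [Algebra k B] where
  incl : A →ₐ[k] B
  turn : Bˣ
  incl_mul_turn : ∀ a, incl a * turn = turn * incl (θ a)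
  trace : B →ₗ[k] R
  trace_mul_comm : ∀ x y, trace (x * y) = trace (y * x)
  trace_turn_zpow : ∀ (d : ℤ) (a : A), trace ((turn ^ d : Bˣ) * incl a) = τ d a

namespace TraceRing

variable {θ : A ≃ₐ[k] A} {τ : ℤ → A →ₗ[k] R} {B : Type*} [Ring B] [Algebra k B]

lemma turn_inv_mul_incl (t : TraceRing θ τ B) (a : A) :
    (t.turn⁻¹ : Bˣ) * t.incl a = t.incl (θ a) * (t.turn⁻¹ : Bˣ) := by
  rw [Units.inv_mul_eq_iff_eq_mul, ← mul_assoc, ← t.incl_mul_turn, mul_assoc, Units.mul_inv,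
    mul_one]

end TraceRing

/-- The skew Laurent ring of `θ` carries a trace extending `τ`; the inverse of `turn` is the
variable of the skew Laurent ring, which acts on `A` by `θ`. -/
theorem exists_traceRing (θ : A ≃ₐ[k] A) (τ : ℤ → A →ₗ[k] R)
    (hcyc : ∀ (d : ℤ) (x y : A), τ d ((θ ^ d) y * x) = τ d (x * y))
    (hshift : ∀ (d : ℤ) (x : A), τ d (θ x) = τ d x) :
    ∃ (B : Type v) (_ : Ring B) (_ : Algebra k B), Nonempty (TraceRing θ τ B) := by
  let _ : MulSemiringAction (Multiplicative ℤ) A :=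
    MulSemiringAction.compHom A (zpowersHom (A ≃ₐ[k] A) θ)
  have hsmul (m : ℤ) (a : A) : Multiplicative.ofAdd m • a = (θ ^ m) a := rfl
  have hzpow (d m : ℤ) (x : A) : τ d ((θ ^ m) x) = τ d x := by
    have h1 (n : ℕ) (x : A) : τ d ((θ ^ n) x) = τ d x := by
      induction n with
      | zero => rfl
      | succ n ih => rw [pow_succ', AlgEquiv.mul_apply, hshift, ih]
    rcases m with n | n
    · simpa using h1 n x
    · rw [← h1 (n + 1), ← AlgEquiv.mul_apply, zpow_negSucc, mul_inv_cancel, AlgEquiv.one_apply]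
  let B := SkewMonoidAlgebra A (Multiplicative ℤ)
  let s (m : ℤ) (a : A) : B := SkewMonoidAlgebra.single (Multiplicative.ofAdd m) a
  have hs (m n : ℤ) (a b : A) : s m a * s n b = s (m + n) (a * (θ ^ m) b) := by
    exact SkewMonoidAlgebra.single_mul_single ..
  have hs1 : s 0 1 = 1 := rfl
  have hind (p : B → Prop) (h : ∀ m a, p (s m a)) (hadd : ∀ x y, p x → p y → p (x + y)) (x : B) :
      p x := by
    induction x using SkewMonoidAlgebra.induction_on with
    | zero => simpa [s] using h 0 0
    | single g a => exact h g.toAdd a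
    | add x y hx hy => exact hadd x y hx hy
  have hsk (c : k) (m : ℤ) (a : A) : c • s m a = s m (c • a) := SkewMonoidAlgebra.smul_single ..
  have hsadd (m : ℤ) (a b : A) : s m (a + b) = s m a + s m b := SkewMonoidAlgebra.single_add ..
  let _ : Algebra k B := Algebra.ofModule
    (fun c x y => by
      induction x using hind with
      | h m a =>
        induction y using hind with
        | h n b => simp only [hsk, hs, smul_mul_assoc]
        | hadd x y hx hy => simp only [mul_add, smul_add, hx, hy]
      | hadd x y hx hy => simp only [add_mul, smul_add, hx, hy])
    (fun c x y => by
      induction x using hind with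
      | h m a =>
        induction y using hind with
        | h n b => simp only [hsk, hs, map_smul, mul_smul_comm]
        | hadd x y hx hy => simp only [mul_add, smul_add, hx, hy]
      | hadd x y hx hy => simp only [add_mul, smul_add, hx, hy])
  let incl : A →ₐ[k] B := AlgHom.ofLinearMap
    { toFun := s 0, map_add' := hsadd 0, map_smul' := fun c a => (hsk c 0 a).symm } hs1
    (fun a b => by simp [hs])
  let turn : Bˣ := ⟨s (-1) 1, s 1 1, by simp [hs, hs1], by simp [hs, hs1]⟩
  let trace : B →ₗ[k] R := Finsupp.lsum k (fun g : Multiplicative ℤ => τ (-g.toAdd)) ∘ₗ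
    (SkewMonoidAlgebra.coeffLinearEquiv (S := k) (k := A)).toLinearMap
  have htrace (m : ℤ) (a : A) : trace (s m a) = τ (-m) a := by
    simp [trace, s, SkewMonoidAlgebra.coeffLinearEquiv, SkewMonoidAlgebra.coeffAddEquiv]
  have hincl (a : A) : incl a = s 0 a := rfl
  have hturn (d : ℤ) : ((turn ^ d : Bˣ) : B) = s (-d) 1 := by
    induction d with
    | zero => simp [hs1]
    | succ n ih =>
      rw [zpow_add_one, Units.val_mul, ih]
      simp only [turn, hs]
      simp; ring_nf
    | pred n ih =>
      rw [zpow_sub_one, Units.val_mul, ih]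
      change _ * s 1 1 = _
      simp only [hs]
      simp; ring_nf
  refine ⟨B, inferInstance, inferInstance, ⟨⟨incl, turn, fun a => ?_, trace, fun x y => ?_,
    fun d a => ?_⟩⟩⟩
  · change s 0 a * s (-1) 1 = s (-1) 1 * s 0 (θ a)
    rw [hs, hs]
    simp only [zpow_zero, map_one, mul_one, one_mul, zpow_neg, zpow_one]
    rw [← AlgEquiv.mul_apply, inv_mul_cancel]
    simp
  · induction x using hind with
    | h m a =>
      induction y using hind with
      | h n b =>
        rw [hs, hs, htrace, htrace, ← hcyc, ← hzpow _ n, map_mul, ← AlgEquiv.mul_apply,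
          ← AlgEquiv.mul_apply, ← zpow_add, ← zpow_add]
        rw [show n + -(m + n) + m = 0 by ring, add_comm n m]
        simp
      | hadd x y hx hy => rw [mul_add, add_mul, map_add, map_add, hx, hy]
    | hadd x y hx hy => rw [mul_add, add_mul, map_add, map_add, hx, hy]
  · rw [hturn, hincl, hs, htrace, one_mul, hzpow]
    simp

end TraceRing

/-! ### Crossing tensors in all directions -/

section CrossingTensors

variable {k A : Type*} [CommRing k] [Ring A] [Algebra k A]

variable (k A) in
/-- The multiplication of beads on a strand directed `d`, where the beads are listed from bottom
to top. -/
def dirMul : Dir → A →ₗ[k] A →ₗ[k] A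
  | .up => LinearMap.mul k A
  | .down => (LinearMap.mul k A).flip

@[simp] lemma dirMul_up (a b : A) : dirMul k A .up a b = a * b := rfl

@[simp] lemma dirMul_down (a b : A) : dirMul k A .down a b = b * a := rfl

/-- The multiplication of beads on two strands directed `x` and `y`. -/
def dirMul₂ (x y : Dir) : A ⊗[k] A →ₗ[k] A ⊗[k] A →ₗ[k] A ⊗[k] A :=
  TensorProduct.map₂ (dirMul k A x) (dirMul k A y)

/-- The multiplication of beads on three strands directed `x`, `y` and `z`. -/
def dirMul₃ (x y z : Dir) :
    A ⊗[k] (A ⊗[k] A) →ₗ[k] A ⊗[k] (A ⊗[k] A) →ₗ[k] A ⊗[k] (A ⊗[k] A) :=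
  TensorProduct.map₂ (dirMul k A x) (dirMul₂ y z)

@[simp] lemma dirMul₂_tmul (x y : Dir) (a b c d : A) :
    dirMul₂ x y (a ⊗ₜ[k] b) (c ⊗ₜ d) = dirMul k A x a c ⊗ₜ dirMul k A y b d := rfl

@[simp] lemma dirMul₃_tmul (x y z : Dir) (a c : A) (s t : A ⊗[k] A) :
    dirMul₃ x y z (a ⊗ₜ[k] s) (c ⊗ₜ t) = dirMul k A x a c ⊗ₜ dirMul₂ y z s t := rfl

/-- To prove that two bilinear expressions agree, it suffices to compare them on pure tensors. -/
lemma bilinear_ext {M N P : Type*} [AddCommGroup M] [Module k M] [AddCommGroup N] [Module k N]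
    [AddCommGroup P] [Module k P] {M' N' : Type*} [AddCommGroup M'] [Module k M']
    [AddCommGroup N'] [Module k N'] {f g : M ⊗[k] N →ₗ[k] M' ⊗[k] N' →ₗ[k] P}
    (h : ∀ a b c d, f (a ⊗ₜ b) (c ⊗ₜ d) = g (a ⊗ₜ b) (c ⊗ₜ d)) (s : M ⊗[k] N) (t : M' ⊗[k] N') :
    f s t = g s t := by
  have : f = g := by
    ext a b c d
    exact h a b c d
  rw [this]

lemma dirMul₂_up_up (s t : A ⊗[k] A) : dirMul₂ .up .up s t = s * t :=
  bilinear_ext (f := dirMul₂ .up .up) (g := LinearMap.mul k _) (fun _ _ _ _ => by simp) s t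

lemma dirMul₂_down_down (s t : A ⊗[k] A) : dirMul₂ .down .down s t = t * s :=
  bilinear_ext (f := dirMul₂ .down .down) (g := (LinearMap.mul k _).flip)
    (fun _ _ _ _ => by simp) s t

lemma dirMul_rev (x : Dir) (a b : A) : dirMul k A x.rev a b = dirMul k A x b a := by
  cases x <;> rfl

lemma dirMul₂_rev (x y : Dir) (s t : A ⊗[k] A) : dirMul₂ x.rev y.rev s t = dirMul₂ x y t s :=
  bilinear_ext (g := (dirMul₂ x y).flip) (fun _ _ _ _ => by simp [dirMul_rev]) s t

lemma comm_dirMul₂ (x y : Dir) (s t : A ⊗[k] A) :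
    TensorProduct.comm k A A (dirMul₂ x y s t) =
      dirMul₂ y x (TensorProduct.comm k A A s) (TensorProduct.comm k A A t) :=
  bilinear_ext (f := (dirMul₂ x y).compr₂ (TensorProduct.comm k A A).toLinearMap)
    (g := (dirMul₂ y x).compl₁₂ (TensorProduct.comm k A A).toLinearMap
      (TensorProduct.comm k A A).toLinearMap) (fun _ _ _ _ => rfl) s t

lemma map_dirMul (f : A →ₐ[k] A) (x : Dir) (a b : A) :
    f (dirMul k A x a b) = dirMul k A x (f a) (f b) := by
  cases x <;> simp

lemma map_dirMul₂ (f g : A →ₐ[k] A) (x y : Dir) (s t : A ⊗[k] A) :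
    Algebra.TensorProduct.map f g (dirMul₂ x y s t) =
      dirMul₂ x y (Algebra.TensorProduct.map f g s) (Algebra.TensorProduct.map f g t) :=
  bilinear_ext (f := (dirMul₂ x y).compr₂ (Algebra.TensorProduct.map f g).toLinearMap)
    (g := (dirMul₂ x y).compl₁₂ (Algebra.TensorProduct.map f g).toLinearMap
      (Algebra.TensorProduct.map f g).toLinearMap) (fun _ _ _ _ => by simp [map_dirMul]) s t

lemma dirMul_assoc (x : Dir) (a b c : A) :
    dirMul k A x (dirMul k A x a b) c = dirMul k A x a (dirMul k A x b c) := by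
  cases x <;> simp [mul_assoc]

lemma dirMul₂_assoc (x y : Dir) (r s t : A ⊗[k] A) :
    dirMul₂ x y (dirMul₂ x y r s) t = dirMul₂ x y r (dirMul₂ x y s t) := by
  induction r using TensorProduct.induction_on with
  | zero => simp
  | add r r' h h' => simp only [map_add, LinearMap.add_apply, h, h']
  | tmul a b =>
    exact bilinear_ext (f := (dirMul₂ x y) ∘ₗ dirMul₂ x y (a ⊗ₜ b))
      (g := (dirMul₂ x y).compr₂ (dirMul₂ x y (a ⊗ₜ b)))
      (fun _ _ _ _ => by simp [dirMul_assoc]) s t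

lemma dirMul₃_assoc (x y z : Dir) (r s t : A ⊗[k] (A ⊗[k] A)) :
    dirMul₃ x y z (dirMul₃ x y z r s) t = dirMul₃ x y z r (dirMul₃ x y z s t) := by
  induction r using TensorProduct.induction_on with
  | zero => simp
  | add r r' h h' => simp only [map_add, LinearMap.add_apply, h, h']
  | tmul a b =>
    exact bilinear_ext (f := (dirMul₃ x y z) ∘ₗ dirMul₃ x y z (a ⊗ₜ b))
      (g := (dirMul₃ x y z).compr₂ (dirMul₃ x y z (a ⊗ₜ b)))
      (fun _ _ _ _ => by simp [dirMul_assoc, dirMul₂_assoc]) s t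

lemma dirMul_one (x : Dir) (a : A) : dirMul k A x a 1 = a := by cases x <;> simp

lemma one_dirMul (x : Dir) (a : A) : dirMul k A x 1 a = a := by cases x <;> simp

lemma dirMul₂_one (x y : Dir) (s : A ⊗[k] A) : dirMul₂ x y s 1 = s := by
  induction s using TensorProduct.induction_on with
  | zero => simp
  | add r r' h h' => simp only [map_add, LinearMap.add_apply, h, h']
  | tmul a b => simp [Algebra.TensorProduct.one_def, dirMul_one]

lemma one_dirMul₂ (x y : Dir) (s : A ⊗[k] A) : dirMul₂ x y 1 s = s := by
  induction s using TensorProduct.induction_on with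
  | zero => simp
  | add r r' h h' => simp only [map_add, h, h']
  | tmul a b => simp [Algebra.TensorProduct.one_def, one_dirMul]

lemma dirMul₃_one (x y z : Dir) (s : A ⊗[k] (A ⊗[k] A)) : dirMul₃ x y z s 1 = s := by
  induction s using TensorProduct.induction_on with
  | zero => simp
  | add r r' h h' => simp only [map_add, LinearMap.add_apply, h, h']
  | tmul a b => rw [Algebra.TensorProduct.one_def]; simp [dirMul_one, dirMul₂_one]

lemma one_dirMul₃ (x y z : Dir) (s : A ⊗[k] (A ⊗[k] A)) : dirMul₃ x y z 1 s = s := by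
  induction s using TensorProduct.induction_on with
  | zero => simp
  | add r r' h h' => simp only [map_add, h, h']
  | tmul a b => rw [Algebra.TensorProduct.one_def]; simp [one_dirMul, one_dirMul₂]

@[simp] lemma leg12_tmul (a b : A) : leg12 (a ⊗ₜ[k] b) = a ⊗ₜ (b ⊗ₜ 1) := rfl

@[simp] lemma leg13_tmul (a b : A) : leg13 (a ⊗ₜ[k] b) = a ⊗ₜ (1 ⊗ₜ b) := rfl

@[simp] lemma leg23_tmul (a b : A) : leg23 (a ⊗ₜ[k] b) = 1 ⊗ₜ (a ⊗ₜ b) := rfl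

lemma dirMul₃_leg12 (x y z : Dir) (s t : A ⊗[k] A) :
    dirMul₃ x y z (leg12 s) (leg12 t) = leg12 (dirMul₂ x y s t) :=
  bilinear_ext (f := (dirMul₃ x y z).compl₁₂ leg12.toLinearMap leg12.toLinearMap)
    (g := (dirMul₂ x y).compr₂ leg12.toLinearMap) (fun _ _ _ _ => by simp [dirMul_one]) s t

/-- The automorphism `θ` applied to the first of two tensor factors. -/
abbrev act₁ (θ : A ≃ₐ[k] A) : A ⊗[k] A →ₐ[k] A ⊗[k] A :=
  Algebra.TensorProduct.map (θ : A →ₐ[k] A) (AlgHom.id k A)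

/-- The automorphism `θ` applied to the second of two tensor factors. -/
abbrev act₂ (θ : A ≃ₐ[k] A) : A ⊗[k] A →ₐ[k] A ⊗[k] A :=
  Algebra.TensorProduct.map (AlgHom.id k A) (θ : A →ₐ[k] A)

lemma comm_act₁ (θ : A ≃ₐ[k] A) (s : A ⊗[k] A) :
    TensorProduct.comm k A A (act₁ θ s) = act₂ θ (TensorProduct.comm k A A s) := by
  induction s using TensorProduct.induction_on with
  | zero => simp
  | add r r' h h' => simp only [map_add, h, h']
  | tmul a b => simp

lemma act₁_act₂ (θ : A ≃ₐ[k] A) (s : A ⊗[k] A) :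
    act₁ θ (act₂ θ s) = TensorProduct.map θ.toLinearMap θ.toLinearMap s := by
  induction s using TensorProduct.induction_on with
  | zero => simp
  | add r r' h h' => simp only [map_add, h, h']
  | tmul a b => simp

lemma act₁_injective (θ : A ≃ₐ[k] A) : Function.Injective (act₁ θ) := by
  refine Function.LeftInverse.injective (g := act₁ θ.symm) fun s => ?_
  induction s using TensorProduct.induction_on with
  | zero => simp
  | add r r' h h' => simp only [map_add, h, h']
  | tmul a b => simp

/-- The Yang–Baxter equation for three elements of `A ⊗ A`. -/
def YangBaxter (p q r : (A ⊗[k] A)ˣ) : Prop :=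
  leg12 (p : A ⊗[k] A) * leg13 (q : A ⊗[k] A) * leg23 (r : A ⊗[k] A) =
    leg23 (r : A ⊗[k] A) * leg13 (q : A ⊗[k] A) * leg12 (p : A ⊗[k] A)

/-- The inverse of `p` with interchanged tensor factors. -/
def flipInv (p : (A ⊗[k] A)ˣ) : (A ⊗[k] A)ˣ :=
  Units.map (Algebra.TensorProduct.comm k A A).toAlgHom.toRingHom.toMonoidHom p⁻¹

lemma coe_flipInv (p : (A ⊗[k] A)ˣ) :
    (flipInv p : A ⊗[k] A) = TensorProduct.comm k A A (p⁻¹ : (A ⊗[k] A)ˣ) := rfl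

lemma coe_flipInv_inv (p : (A ⊗[k] A)ˣ) :
    ((flipInv p)⁻¹ : (A ⊗[k] A)ˣ) = TensorProduct.comm k A A (p : A ⊗[k] A) := rfl

lemma comm_mul (s t : A ⊗[k] A) : TensorProduct.comm k A A (s * t) =
    TensorProduct.comm k A A s * TensorProduct.comm k A A t :=
  map_mul (Algebra.TensorProduct.comm k A A) s t

lemma comm_one : TensorProduct.comm k A A 1 = 1 := rfl

/-- Interchange of the last two of three tensor factors. -/
def swap23 : A ⊗[k] (A ⊗[k] A) ≃ₐ[k] A ⊗[k] (A ⊗[k] A) :=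
  Algebra.TensorProduct.congr AlgEquiv.refl (Algebra.TensorProduct.comm k A A)

/-- Interchange of the first two of three tensor factors. -/
def swap12 : A ⊗[k] (A ⊗[k] A) ≃ₐ[k] A ⊗[k] (A ⊗[k] A) :=
  Algebra.TensorProduct.leftComm k A A A

lemma swap23_leg12 (s : A ⊗[k] A) : swap23 (leg12 s) = leg13 s := by
  induction s using TensorProduct.induction_on with
  | zero => simp
  | add r r' h h' => simp only [map_add, h, h']
  | tmul a b => simp [swap23]

lemma swap23_leg13 (s : A ⊗[k] A) : swap23 (leg13 s) = leg12 s := by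
  induction s using TensorProduct.induction_on with
  | zero => simp
  | add r r' h h' => simp only [map_add, h, h']
  | tmul a b => simp [swap23]

lemma swap23_leg23 (s : A ⊗[k] A) : swap23 (leg23 s) = leg23 (TensorProduct.comm k A A s) := by
  induction s using TensorProduct.induction_on with
  | zero => simp
  | add r r' h h' => simp only [map_add, h, h']
  | tmul a b => simp [swap23]

lemma swap12_leg12 (s : A ⊗[k] A) : swap12 (leg12 s) = leg12 (TensorProduct.comm k A A s) := by
  induction s using TensorProduct.induction_on with
  | zero => simp
  | add r r' h h' => simp only [map_add, h, h']
  | tmul a b => simp [swap12]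

lemma swap12_leg13 (s : A ⊗[k] A) : swap12 (leg13 s) = leg23 s := by
  induction s using TensorProduct.induction_on with
  | zero => simp
  | add r r' h h' => simp only [map_add, h, h']
  | tmul a b => simp [swap12]

lemma swap12_leg23 (s : A ⊗[k] A) : swap12 (leg23 s) = leg13 s := by
  induction s using TensorProduct.induction_on with
  | zero => simp
  | add r r' h h' => simp only [map_add, h, h']
  | tmul a b => simp [swap12]

namespace YangBaxter

variable {p q r : (A ⊗[k] A)ˣ}

/-- The Yang–Baxter equation seen from a different order of the three strands. -/
lemma swap_right (h : YangBaxter p q r) : YangBaxter q p (flipInv r) := by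
  have h' := congrArg swap23 h
  simp only [map_mul, swap23_leg12, swap23_leg13, swap23_leg23] at h'
  have h1 : leg23 (TensorProduct.comm k A A (r : A ⊗[k] A)) *
      leg23 (flipInv r : A ⊗[k] A) = 1 := by
    rw [← map_mul, coe_flipInv, ← comm_mul, Units.mul_inv, comm_one, map_one]
  have h2 : leg23 (flipInv r : A ⊗[k] A) *
      leg23 (TensorProduct.comm k A A (r : A ⊗[k] A)) = 1 := by
    rw [← map_mul, coe_flipInv, ← comm_mul, Units.inv_mul, comm_one, map_one]
  calc _ = leg23 (flipInv r : A ⊗[k] A) * (leg23 (TensorProduct.comm k A A (r : A ⊗[k] A)) *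
        leg12 (q : A ⊗[k] A) * leg13 (p : A ⊗[k] A)) * leg23 (flipInv r : A ⊗[k] A) := by
        rw [← mul_assoc, ← mul_assoc, h2, one_mul]
    _ = _ := by rw [← h', mul_assoc, mul_assoc _ _ (leg23 (flipInv r : A ⊗[k] A)), h1, mul_one,
      ← mul_assoc]

/-- The Yang–Baxter equation seen from a different order of the three strands. -/
lemma swap_left (h : YangBaxter p q r) : YangBaxter (flipInv p) r q := by
  have h' := congrArg swap12 h
  simp only [map_mul, swap12_leg12, swap12_leg13, swap12_leg23] at h'
  have h1 : leg12 (TensorProduct.comm k A A (p : A ⊗[k] A)) *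
      leg12 (flipInv p : A ⊗[k] A) = 1 := by
    rw [← map_mul, coe_flipInv, ← comm_mul, Units.mul_inv, comm_one, map_one]
  have h2 : leg12 (flipInv p : A ⊗[k] A) *
      leg12 (TensorProduct.comm k A A (p : A ⊗[k] A)) = 1 := by
    rw [← map_mul, coe_flipInv, ← comm_mul, Units.inv_mul, comm_one, map_one]
  calc _ = leg12 (flipInv p : A ⊗[k] A) * (leg13 (r : A ⊗[k] A) * leg23 (q : A ⊗[k] A) *
        leg12 (TensorProduct.comm k A A (p : A ⊗[k] A))) * leg12 (flipInv p : A ⊗[k] A) := by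
        rw [mul_assoc, mul_assoc, mul_assoc (_ * _), h1, mul_one]
    _ = _ := by rw [← h', ← mul_assoc, ← mul_assoc, h2, one_mul]

end YangBaxter

/-- The properties of the elements `N c` attached to the crossings `c` with both strands directed
up, in a frame where a bead that slides across a counterclockwise maximum is changed by `θ` and no
other turn except the clockwise minimum changes beads. -/
structure IsCrossingFamily (θ : A ≃ₐ[k] A) (N : Crossing → (A ⊗[k] A)ˣ) : Prop where
  invariant : ∀ c, act₁ θ (act₂ θ (N c)) = N c
  flip : ∀ c, N c.flip = flipInv (N c)
  mul_op : ∀ c, dirMul₂ .up .down ((N c)⁻¹ : (A ⊗[k] A)ˣ) (act₂ θ (N c)) = 1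
  op_mul : ∀ c, dirMul₂ .up .down (act₂ θ (N c)) ((N c)⁻¹ : (A ⊗[k] A)ˣ) = 1
  yangBaxter : ∀ c12 c13 c23, TypeThreeAllowed c12 c13 c23 → YangBaxter (N c12) (N c13) (N c23)

/-- The beads on the two strands of a crossing, the first factor on the strand `/`. -/
def crossingTensor (θ : A ≃ₐ[k] A) (N : Crossing → (A ⊗[k] A)ˣ) (c : Crossing) :
    Dir → Dir → A ⊗[k] A
  | .up, .up | .down, .down => N c
  | .up, .down => ((N c)⁻¹ : (A ⊗[k] A)ˣ)
  | .down, .up => act₁ θ ((N c)⁻¹ : (A ⊗[k] A)ˣ)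

namespace IsCrossingFamily

variable {θ : A ≃ₐ[k] A} {N : Crossing → (A ⊗[k] A)ˣ}

lemma comm_flip (h : IsCrossingFamily θ N) (c : Crossing) :
    TensorProduct.comm k A A (N c.flip : A ⊗[k] A) = ((N c)⁻¹ : (A ⊗[k] A)ˣ) := by
  rw [h.flip, coe_flipInv, TensorProduct.comm_comm]

lemma comm_flip_inv (h : IsCrossingFamily θ N) (c : Crossing) :
    TensorProduct.comm k A A ((N c.flip)⁻¹ : (A ⊗[k] A)ˣ) = (N c : A ⊗[k] A) := by
  rw [h.flip, coe_flipInv_inv, TensorProduct.comm_comm]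

/-- Turning the strand `/` that is directed up across a clockwise maximum. -/
lemma slide_up (h : IsCrossingFamily θ N) (c : Crossing) (y : Dir) :
    TensorProduct.comm k A A (crossingTensor θ N c.flip y .down) = crossingTensor θ N c .up y := by
  cases y
  · exact h.comm_flip_inv c
  · exact h.comm_flip c

/-- Turning the strand `/` that is directed down across a counterclockwise maximum. -/
lemma slide_down (h : IsCrossingFamily θ N) (c : Crossing) (y : Dir) :
    act₁ θ (TensorProduct.comm k A A (crossingTensor θ N c.flip y .up)) =
      crossingTensor θ N c .down y := by
  cases y
  · exact congrArg (act₁ θ) (h.comm_flip c)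
  · simp only [crossingTensor]
    rw [comm_act₁, h.comm_flip_inv, h.invariant]

lemma mul_op' (h : IsCrossingFamily θ N) (c : Crossing) :
    dirMul₂ .up .down (N c : A ⊗[k] A) (act₁ θ ((N c)⁻¹ : (A ⊗[k] A)ˣ)) = 1 := by
  have := congrArg (act₁ θ) (h.op_mul c)
  rwa [map_dirMul₂, h.invariant, map_one] at this

lemma op_mul' (h : IsCrossingFamily θ N) (c : Crossing) :
    dirMul₂ .up .down (act₁ θ ((N c)⁻¹ : (A ⊗[k] A)ˣ)) (N c : A ⊗[k] A) = 1 := by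
  have := congrArg (act₁ θ) (h.mul_op c)
  rwa [map_dirMul₂, h.invariant, map_one] at this

/-- The moves of type two, for all directions of the two strands: for parallel strands the two
crossings are inverse to each other, for antiparallel strands this is the condition in
`A ⊗ Aᵒᵖ`. -/
lemma typeTwo (h : IsCrossingFamily θ N) (c : Crossing) (x y : Dir) :
    dirMul₂ x y (crossingTensor θ N c x y)
      (TensorProduct.comm k A A (crossingTensor θ N c.flip y x)) = 1 := by
  cases x <;> cases y <;> simp only [crossingTensor]
  · rw [dirMul₂_up_up, h.comm_flip, Units.mul_inv]
  · rw [comm_act₁, h.comm_flip_inv, h.mul_op]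
  · rw [h.comm_flip_inv]
    exact (dirMul₂_rev .up .down _ _).trans (h.mul_op' c)
  · rw [dirMul₂_down_down, h.comm_flip, Units.inv_mul]

end IsCrossingFamily

lemma dirMul₃_rev (x y z : Dir) (s t : A ⊗[k] (A ⊗[k] A)) :
    dirMul₃ x.rev y.rev z.rev s t = dirMul₃ x y z t s :=
  bilinear_ext (g := (dirMul₃ x y z).flip)
    (fun _ _ _ _ => by simp [dirMul_rev, dirMul₂_rev]) s t

/-- The products of three crossings of three strands. For six of the eight directions the orders
of the crossings along the three strands are compatible, so that the product is an ordinary product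
of the three legs; for the other two directions this holds once the first crossing is moved
to the end. -/
lemma dirMul₃_legs (p q r : A ⊗[k] A) :
    dirMul₃ .up .up .up (dirMul₃ .up .up .up (leg12 p) (leg13 q)) (leg23 r) =
        leg12 p * leg13 q * leg23 r ∧
      dirMul₃ .up .up .down (dirMul₃ .up .up .down (leg12 p) (leg13 q)) (leg23 r) =
        leg12 p * leg23 r * leg13 q ∧
      dirMul₃ .down .up .up (dirMul₃ .down .up .up (leg12 p) (leg13 q)) (leg23 r) =
        leg13 q * leg12 p * leg23 r ∧
      dirMul₃ .down .down .down (dirMul₃ .down .down .down (leg12 p) (leg13 q)) (leg23 r) =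
        leg23 r * leg13 q * leg12 p ∧
      dirMul₃ .down .down .up (dirMul₃ .down .down .up (leg12 p) (leg13 q)) (leg23 r) =
        leg13 q * leg23 r * leg12 p ∧
      dirMul₃ .up .down .down (dirMul₃ .up .down .down (leg12 p) (leg13 q)) (leg23 r) =
        leg23 r * leg12 p * leg13 q ∧
      dirMul₃ .up .down .up (dirMul₃ .up .down .up (leg13 q) (leg23 r)) (leg12 p) =
        leg13 q * leg12 p * leg23 r ∧
      dirMul₃ .down .up .down (dirMul₃ .down .up .down (leg13 q) (leg23 r)) (leg12 p) =
        leg23 r * leg12 p * leg13 q := by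
  induction p using TensorProduct.induction_on with
  | zero => simp
  | add p p' h h' => simp only [map_add, LinearMap.add_apply, add_mul, mul_add, h, h', and_self]
  | tmul a b =>
    induction q using TensorProduct.induction_on with
    | zero => simp
    | add q q' h h' => simp only [map_add, LinearMap.add_apply, add_mul, mul_add, h, h', and_self]
    | tmul c d =>
      induction r using TensorProduct.induction_on with
      | zero => simp
      | add r r' h h' =>
        simp only [map_add, LinearMap.add_apply, add_mul, mul_add, h, h', and_self]
      | tmul e f => simp

/-- The automorphism `θ` applied to the first of three tensor factors. -/
def actFst (θ : A ≃ₐ[k] A) : A ⊗[k] (A ⊗[k] A) →ₐ[k] A ⊗[k] (A ⊗[k] A) :=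
  Algebra.TensorProduct.map (θ : A →ₐ[k] A) (AlgHom.id k _)

/-- The automorphism `θ` applied to the second of three tensor factors. -/
def actSnd (θ : A ≃ₐ[k] A) : A ⊗[k] (A ⊗[k] A) →ₐ[k] A ⊗[k] (A ⊗[k] A) :=
  Algebra.TensorProduct.map (AlgHom.id k A) (act₁ θ)

lemma actFst_leg12 (θ : A ≃ₐ[k] A) (s : A ⊗[k] A) : actFst θ (leg12 s) = leg12 (act₁ θ s) := by
  induction s using TensorProduct.induction_on with
  | zero => simp
  | add r r' h h' => simp only [map_add, h, h']
  | tmul a b => simp [actFst]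

lemma actFst_leg13 (θ : A ≃ₐ[k] A) (s : A ⊗[k] A) : actFst θ (leg13 s) = leg13 (act₁ θ s) := by
  induction s using TensorProduct.induction_on with
  | zero => simp
  | add r r' h h' => simp only [map_add, h, h']
  | tmul a b => simp [actFst]

lemma actFst_leg23 (θ : A ≃ₐ[k] A) (s : A ⊗[k] A) : actFst θ (leg23 s) = leg23 s := by
  induction s using TensorProduct.induction_on with
  | zero => simp
  | add r r' h h' => simp only [map_add, h, h']
  | tmul a b => simp [actFst]

lemma actSnd_leg12 (θ : A ≃ₐ[k] A) (s : A ⊗[k] A) : actSnd θ (leg12 s) = leg12 (act₂ θ s) := by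
  induction s using TensorProduct.induction_on with
  | zero => simp
  | add r r' h h' => simp only [map_add, h, h']
  | tmul a b => simp [actSnd]

lemma actSnd_leg13 (θ : A ≃ₐ[k] A) (s : A ⊗[k] A) : actSnd θ (leg13 s) = leg13 s := by
  induction s using TensorProduct.induction_on with
  | zero => simp
  | add r r' h h' => simp only [map_add, h, h']
  | tmul a b => simp [actSnd]

lemma actSnd_leg23 (θ : A ≃ₐ[k] A) (s : A ⊗[k] A) : actSnd θ (leg23 s) = leg23 (act₁ θ s) := by
  induction s using TensorProduct.induction_on with
  | zero => simp
  | add r r' h h' => simp only [map_add, h, h']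
  | tmul a b => simp [actSnd]

namespace YangBaxter

variable {p q r : (A ⊗[k] A)ˣ}

/-- The Yang–Baxter equation as an identity between units, and solved for the inverses that
occur when some of the strands are directed down. -/
lemma units (h : YangBaxter p q r) {P Q S : (A ⊗[k] (A ⊗[k] A))ˣ}
    (hP : P = Units.map (leg12 (k := k) (A := A)).toRingHom.toMonoidHom p)
    (hQ : Q = Units.map (leg13 (k := k) (A := A)).toRingHom.toMonoidHom q)
    (hS : S = Units.map (leg23 (k := k) (A := A)).toRingHom.toMonoidHom r) :
    P * S⁻¹ * Q⁻¹ = Q⁻¹ * S⁻¹ * P ∧ Q⁻¹ * P⁻¹ * S = S * P⁻¹ * Q⁻¹ ∧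
      Q * P * S⁻¹ = S⁻¹ * P * Q := by
  have h' : P * Q * S = S * Q * P := by
    subst hP hQ hS
    exact Units.ext h
  refine ⟨?_, ?_, ?_⟩
  · rw [mul_assoc, mul_assoc, ← mul_inv_rev, eq_inv_mul_iff_mul_eq, eq_inv_mul_iff_mul_eq,
      ← mul_assoc, ← mul_assoc, mul_inv_eq_iff_eq_mul, ← h']
    group
  · rw [← mul_inv_rev, mul_assoc S, ← mul_inv_rev, inv_mul_eq_iff_eq_mul, ← mul_assoc,
      eq_mul_inv_iff_mul_eq, h', mul_assoc]
  · rw [mul_assoc, eq_comm, mul_assoc, inv_mul_eq_iff_eq_mul, ← mul_assoc, ← mul_assoc,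
      eq_mul_inv_iff_mul_eq, h']

lemma inv_left (h : YangBaxter p q r) :
    leg13 ((q⁻¹ : (A ⊗[k] A)ˣ) : A ⊗[k] A) * leg12 ((p⁻¹ : (A ⊗[k] A)ˣ) : A ⊗[k] A) *
        leg23 (r : A ⊗[k] A) =
      leg23 (r : A ⊗[k] A) * leg12 ((p⁻¹ : (A ⊗[k] A)ˣ) : A ⊗[k] A) *
        leg13 ((q⁻¹ : (A ⊗[k] A)ˣ) : A ⊗[k] A) :=
  congrArg Units.val (h.units rfl rfl rfl).2.1

lemma inv_right (h : YangBaxter p q r) :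
    leg12 (p : A ⊗[k] A) * leg23 ((r⁻¹ : (A ⊗[k] A)ˣ) : A ⊗[k] A) *
        leg13 ((q⁻¹ : (A ⊗[k] A)ˣ) : A ⊗[k] A) =
      leg13 ((q⁻¹ : (A ⊗[k] A)ˣ) : A ⊗[k] A) * leg23 ((r⁻¹ : (A ⊗[k] A)ˣ) : A ⊗[k] A) *
        leg12 (p : A ⊗[k] A) :=
  congrArg Units.val (h.units rfl rfl rfl).1

lemma inv_last (h : YangBaxter p q r) :
    leg13 (q : A ⊗[k] A) * leg12 (p : A ⊗[k] A) *
        leg23 ((r⁻¹ : (A ⊗[k] A)ˣ) : A ⊗[k] A) =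
      leg23 ((r⁻¹ : (A ⊗[k] A)ˣ) : A ⊗[k] A) * leg12 (p : A ⊗[k] A) *
        leg13 (q : A ⊗[k] A) :=
  congrArg Units.val (h.units rfl rfl rfl).2.2

end YangBaxter

/-- If `a` is invertible with inverse `a'` for one of the multiplications of beads on three strands,
then it may be moved from one side of the Yang–Baxter equation to the other one. -/
lemma dirMul₃_conj {x y z : Dir} {a a' b c : A ⊗[k] (A ⊗[k] A)}
    (h1 : dirMul₃ x y z a a' = 1) (h2 : dirMul₃ x y z a' a = 1)
    (h : dirMul₃ x y z (dirMul₃ x y z b c) a' = dirMul₃ x y z (dirMul₃ x y z a' c) b) :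
    dirMul₃ x y z (dirMul₃ x y z a b) c = dirMul₃ x y z (dirMul₃ x y z c b) a := by
  have h3 := congrArg (fun t => dirMul₃ x y z (dirMul₃ x y z a t) a) h
  simp only [dirMul₃_assoc, h2, dirMul₃_one] at h3
  rw [dirMul₃_assoc, h3, ← dirMul₃_assoc, h1, one_dirMul₃, dirMul₃_assoc]

namespace IsCrossingFamily

variable {θ : A ≃ₐ[k] A} {N : Crossing → (A ⊗[k] A)ˣ}

/-- The Yang–Baxter equation for all directions of the three strands. Reversing all strands reverses
all products. If the crossings are met in compatible orders, the equation is the one for three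
strands directed up, solved for the inverses that occur; in the two other cases one crossing has to
be moved to the other side, where its inverse for the multiplication of antiparallel beads
appears. -/
lemma typeThree (h : IsCrossingFamily θ N) {c12 c13 c23 : Crossing}
    (hc : TypeThreeAllowed c12 c13 c23) (x y z : Dir) :
    dirMul₃ x y z (dirMul₃ x y z (leg12 (crossingTensor θ N c12 x y))
        (leg13 (crossingTensor θ N c13 x z))) (leg23 (crossingTensor θ N c23 y z)) =
      dirMul₃ x y z (dirMul₃ x y z (leg23 (crossingTensor θ N c23 y z))
        (leg13 (crossingTensor θ N c13 x z))) (leg12 (crossingTensor θ N c12 x y)) := by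
  have hY := h.yangBaxter _ _ _ hc
  have hrev (p q r : A ⊗[k] A) : dirMul₃ x y z (dirMul₃ x y z (leg23 r) (leg13 q)) (leg12 p) =
      dirMul₃ x.rev y.rev z.rev (dirMul₃ x.rev y.rev z.rev (leg12 p) (leg13 q)) (leg23 r) := by
    rw [dirMul₃_rev, dirMul₃_rev, dirMul₃_assoc]
  have hrev' (p q r : A ⊗[k] A) : dirMul₃ x y z (dirMul₃ x y z (leg12 p) (leg23 r)) (leg13 q) =
      dirMul₃ x.rev y.rev z.rev (dirMul₃ x.rev y.rev z.rev (leg13 q) (leg23 r)) (leg12 p) := by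
    rw [dirMul₃_rev, dirMul₃_rev, dirMul₃_assoc]
  cases x <;> cases y <;> cases z <;> simp only [crossingTensor]
  · rw [hrev]
    dsimp only [Dir.rev]
    rw [(dirMul₃_legs _ _ _).1, (dirMul₃_legs _ _ _).2.2.2.1]
    exact hY
  · rw [hrev]
    dsimp only [Dir.rev]
    rw [(dirMul₃_legs _ _ _).2.1, (dirMul₃_legs _ _ _).2.2.2.2.1]
    exact hY.inv_right
  · refine dirMul₃_conj (a' := leg12 (act₂ θ (N c12))) ?_ ?_ ?_
    · rw [dirMul₃_leg12, h.mul_op, map_one]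
    · rw [dirMul₃_leg12, h.op_mul, map_one]
    · rw [hrev']
      dsimp only [Dir.rev]
      rw [(dirMul₃_legs _ _ _).2.2.2.2.2.2.1, (dirMul₃_legs _ _ _).2.2.2.2.2.2.2]
      have := congrArg (actSnd θ) hY.inv_last
      simpa only [map_mul, actSnd_leg12, actSnd_leg13, actSnd_leg23] using this
  · rw [hrev]
    dsimp only [Dir.rev]
    rw [(dirMul₃_legs _ _ _).2.2.1, (dirMul₃_legs _ _ _).2.2.2.2.2.1]
    exact hY.inv_left.symm
  · rw [hrev]
    dsimp only [Dir.rev]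
    rw [(dirMul₃_legs _ _ _).2.2.1, (dirMul₃_legs _ _ _).2.2.2.2.2.1]
    have := congrArg (actFst θ) hY.inv_left
    simpa only [map_mul, actFst_leg12, actFst_leg13, actFst_leg23] using this
  · refine dirMul₃_conj (a' := leg12 (N c12)) ?_ ?_ ?_
    · rw [dirMul₃_leg12, ← map_one leg12, ← h.mul_op' c12, ← dirMul₂_rev, Dir.rev, Dir.rev]
    · rw [dirMul₃_leg12, ← map_one leg12, ← h.op_mul' c12, ← dirMul₂_rev, Dir.rev, Dir.rev]
    · rw [hrev']
      dsimp only [Dir.rev]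
      rw [(dirMul₃_legs _ _ _).2.2.2.2.2.2.2, (dirMul₃_legs _ _ _).2.2.2.2.2.2.1]
      exact hY.inv_last.symm
  · rw [hrev]
    dsimp only [Dir.rev]
    rw [(dirMul₃_legs _ _ _).2.1, (dirMul₃_legs _ _ _).2.2.2.2.1]
    have := congrArg (fun t => actFst θ (actSnd θ t)) hY.inv_right
    simp only [map_mul, actFst_leg12, actFst_leg13, actFst_leg23, actSnd_leg12, actSnd_leg13,
      actSnd_leg23, h.invariant] at this
    exact this.symm
  · rw [hrev]
    dsimp only [Dir.rev]
    rw [(dirMul₃_legs _ _ _).1, (dirMul₃_legs _ _ _).2.2.2.1]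
    exact hY.symm

end IsCrossingFamily

end CrossingTensors

/-! ### The crossing family of a bi-oriented quantum algebra -/

section Family

variable {k A : Type*} [CommRing k] [Ring A] [Algebra k A]

lemma mapOp_mul_mapOp (f g f' g' : A ≃ₐ[k] A) (s t : A ⊗[k] A) :
    mapOp f g s * mapOp f' g' t =
      TensorProduct.map LinearMap.id (MulOpposite.opLinearEquiv k).toLinearMap
        (dirMul₂ .up .down (TensorProduct.map f.toLinearMap g.toLinearMap s)
          (TensorProduct.map f'.toLinearMap g'.toLinearMap t)) := by
  induction s using TensorProduct.induction_on with
  | zero => simp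
  | add r r' h h' => simp only [map_add, LinearMap.add_apply, add_mul, h, h']
  | tmul a b =>
    induction t using TensorProduct.induction_on with
    | zero => simp
    | add r r' h h' => simp only [map_add, mul_add, h, h']
    | tmul c d => simp [mapOp]

lemma op_injective : Function.Injective (TensorProduct.map LinearMap.id
    (MulOpposite.opLinearEquiv k).toLinearMap : A ⊗[k] A →ₗ[k] A ⊗[k] Aᵐᵒᵖ) :=
  (TensorProduct.congr (LinearEquiv.refl k A) (MulOpposite.opLinearEquiv k)).injective

variable {ρ γ : (A ⊗[k] A)ˣ} {D U : A ≃ₐ[k] A}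

lemma map_inv_eq_of_map_eq {p : (A ⊗[k] A)ˣ} {f g : A →ₐ[k] A}
    (h : Algebra.TensorProduct.map f g (p : A ⊗[k] A) = p) :
    Algebra.TensorProduct.map f g ((p⁻¹ : (A ⊗[k] A)ˣ) : A ⊗[k] A) = (p⁻¹ : (A ⊗[k] A)ˣ) := by
  refine (left_inv_eq_right_inv (Units.inv_mul p) ?_).symm
  nth_rw 1 [← h]
  rw [← map_mul, Units.mul_inv, map_one]

namespace IsOrientedQuantumAlgebra

lemma invariant (h : IsOrientedQuantumAlgebra ρ D U) :
    act₁ (U * D) (act₂ (U * D) (ρ : A ⊗[k] A)) = ρ := by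
  rw [act₁_act₂]
  calc _ = TensorProduct.map U.toLinearMap U.toLinearMap
        (TensorProduct.map D.toLinearMap D.toLinearMap (ρ : A ⊗[k] A)) := by
        rw [← LinearMap.comp_apply, ← TensorProduct.map_comp]; rfl
    _ = ρ := by rw [h.D_inv, h.U_inv]

lemma act₂_D (h : IsOrientedQuantumAlgebra ρ D U) :
    Algebra.TensorProduct.map (AlgHom.id k A) (D : A →ₐ[k] A)
      (Algebra.TensorProduct.map (AlgHom.id k A) (U : A →ₐ[k] A) (ρ : A ⊗[k] A)) =
      act₂ (U * D) (ρ : A ⊗[k] A) := by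
  rw [← AlgHom.comp_apply, ← Algebra.TensorProduct.map_comp]
  congr 2
  ext x
  exact h.comm x

lemma act₂_D' (h : IsOrientedQuantumAlgebra ρ D U) :
    Algebra.TensorProduct.map (AlgHom.id k A) (D : A →ₐ[k] A)
      (Algebra.TensorProduct.map (D : A →ₐ[k] A) (AlgHom.id k A)
        ((ρ⁻¹ : (A ⊗[k] A)ˣ) : A ⊗[k] A)) = (ρ⁻¹ : (A ⊗[k] A)ˣ) := by
  rw [← AlgHom.comp_apply, ← Algebra.TensorProduct.map_comp]
  exact map_inv_eq_of_map_eq h.D_inv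

/-- In the frame, the condition in `A ⊗ Aᵒᵖ` says that `(1 ⊗ θ) ρ` is inverse to `ρ⁻¹` when beads on
the second strand are multiplied downwards. -/
lemma dirMul₂_mul_op (h : IsOrientedQuantumAlgebra ρ D U) :
    dirMul₂ .up .down (act₂ (U * D) (ρ : A ⊗[k] A)) ((ρ⁻¹ : (A ⊗[k] A)ˣ) : A ⊗[k] A) = 1 := by
  have h1 := h.mul_op
  rw [mapOp_mul_mapOp] at h1
  have h2 := congrArg (Algebra.TensorProduct.map (AlgHom.id k A) (D : A →ₐ[k] A))
    (op_injective (h1.trans (show 1 = _ from rfl)) : _ = (1 : A ⊗[k] A))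
  rw [map_dirMul₂, map_one] at h2
  exact (congrArg₂ (fun s t => dirMul₂ .up .down s t) h.act₂_D h.act₂_D').symm.trans h2

lemma dirMul₂_op_mul (h : IsOrientedQuantumAlgebra ρ D U) :
    dirMul₂ .up .down ((ρ⁻¹ : (A ⊗[k] A)ˣ) : A ⊗[k] A) (act₂ (U * D) (ρ : A ⊗[k] A)) = 1 := by
  have h1 := h.op_mul
  rw [mapOp_mul_mapOp] at h1
  have h2 := congrArg (Algebra.TensorProduct.map (AlgHom.id k A) (D : A →ₐ[k] A))
    (op_injective (h1.trans (show 1 = _ from rfl)) : _ = (1 : A ⊗[k] A))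
  rw [map_dirMul₂, map_one] at h2
  exact (congrArg₂ (fun s t => dirMul₂ .up .down s t) h.act₂_D' h.act₂_D).symm.trans h2

end IsOrientedQuantumAlgebra

/-- The elements attached to the crossings with both strands directed up, the first factor on the
strand `/`. -/
def crossingElement (ρ γ : (A ⊗[k] A)ˣ) : Crossing → (A ⊗[k] A)ˣ
  | .slashOver => ρ
  | .backslashOver => flipInv ρ
  | .virt => γ

lemma flipInv_flipInv (p : (A ⊗[k] A)ˣ) : flipInv (flipInv p) = p := by
  ext
  rw [coe_flipInv, coe_flipInv_inv, TensorProduct.comm_comm]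

lemma act_comm (θ : A ≃ₐ[k] A) (s : A ⊗[k] A) :
    act₁ θ (act₂ θ (TensorProduct.comm k A A s)) =
      TensorProduct.comm k A A (act₁ θ (act₂ θ s)) := by
  induction s using TensorProduct.induction_on with
  | zero => simp
  | add r r' h h' => simp only [map_add, h, h']
  | tmul a b => simp

lemma comm_act₂ (θ : A ≃ₐ[k] A) (s : A ⊗[k] A) :
    TensorProduct.comm k A A (act₂ θ s) = act₁ θ (TensorProduct.comm k A A s) := by
  rw [← TensorProduct.comm_comm k A A (act₁ θ _), comm_act₁, TensorProduct.comm_comm]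

lemma IsBiOrientedQuantumAlgebra.inv_virtual (h : IsBiOrientedQuantumAlgebra ρ γ D U) :
    ((γ⁻¹ : (A ⊗[k] A)ˣ) : A ⊗[k] A) = TensorProduct.comm k A A (γ : A ⊗[k] A) :=
  left_inv_eq_right_inv (Units.inv_mul γ) h.involutive

lemma IsBiOrientedQuantumAlgebra.isCrossingFamily (h : IsBiOrientedQuantumAlgebra ρ γ D U) :
    IsCrossingFamily (U * D) (crossingElement ρ γ) := by
  have hγ : flipInv γ = γ := by
    ext
    rw [coe_flipInv, h.inv_virtual, TensorProduct.comm_comm]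
  have hinv : act₁ (U * D) (act₂ (U * D) ((ρ⁻¹ : (A ⊗[k] A)ˣ) : A ⊗[k] A)) =
      (ρ⁻¹ : (A ⊗[k] A)ˣ) := by
    have h1 := h.real.invariant
    rw [← AlgHom.comp_apply, ← Algebra.TensorProduct.map_comp] at h1 ⊢
    exact map_inv_eq_of_map_eq h1
  refine ⟨?_, ?_, ?_, ?_, ?_⟩
  · rintro (_ | _ | _)
    · exact h.real.invariant
    · simp only [crossingElement, coe_flipInv]
      rw [act_comm, hinv]
    · exact h.virtual.invariant
  · rintro (_ | _ | _)
    · rfl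
    · exact (flipInv_flipInv ρ).symm
    · exact hγ.symm
  · rintro (_ | _ | _)
    · exact h.real.dirMul₂_op_mul
    · -- The relation for `flipInv ρ` is the one for `ρ` read with interchanged factors.
      simp only [crossingElement, coe_flipInv, coe_flipInv_inv]
      refine act₁_injective (U * D) ?_
      rw [map_dirMul₂, act_comm, hinv, map_one]
      rw [← comm_act₂, ← comm_dirMul₂, ← dirMul₂_rev, Dir.rev, Dir.rev,
        h.real.dirMul₂_op_mul, comm_one]
    · exact h.virtual.dirMul₂_op_mul
  · rintro (_ | _ | _)
    · exact h.real.dirMul₂_mul_op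
    · simp only [crossingElement, coe_flipInv, coe_flipInv_inv]
      refine act₁_injective (U * D) ?_
      rw [map_dirMul₂, act_comm, hinv, map_one, ← comm_act₂, ← comm_dirMul₂, ← dirMul₂_rev,
        Dir.rev, Dir.rev, h.real.dirMul₂_mul_op, comm_one]
    · exact h.virtual.dirMul₂_mul_op
  · have hsss : YangBaxter ρ ρ ρ := h.real.yangBaxter
    have hvvv : YangBaxter γ γ γ := h.virtual.yangBaxter
    have hvsv : YangBaxter γ ρ γ := h.mixed₁₃
    have hvvs : YangBaxter γ γ ρ := h.mixed₂₃
    have hsvv : YangBaxter ρ γ γ := h.mixed₁₂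
    have hssb := hsss.swap_right
    have hbss := hsss.swap_left
    have hbbs := hssb.swap_left
    have hsbb := hbss.swap_right
    have hbbb := hbbs.swap_right
    have hvvb := hvvs.swap_right
    have hbvv := hsvv.swap_left
    have hvbv := hvvb.swap_left
    rw [hγ] at hvbv
    rintro (_ | _ | _) (_ | _ | _) (_ | _ | _) hc <;>
      first
      | assumption
      | simp [TypeThreeAllowed] at hc

variable (P : Presentations ρ γ)

variable (D) in
/-- Beads on strands directed down are changed by `D`, so that they are treated as if they were on
a strand directed up that is reached through a counterclockwise minimum. -/
def frame : Dir → A →ₐ[k] A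
  | .up => AlgHom.id k A
  | .down => D

lemma Presentation.sum_map {x : A ⊗[k] A} (p : Presentation x) (f g : A →ₐ[k] A) :
    ∑ n, f (p.fst n) ⊗ₜ[k] g (p.snd n) = Algebra.TensorProduct.map f g x := by
  conv_rhs => rw [← p.sum_eq, map_sum]
  rfl

lemma Presentation.sum_map' {x : A ⊗[k] A} (p : Presentation x) (f g : A →ₐ[k] A) :
    ∑ n, f (p.snd n) ⊗ₜ[k] g (p.fst n) =
      Algebra.TensorProduct.map f g (TensorProduct.comm k A A x) := by
  conv_rhs => rw [← p.sum_eq, map_sum, map_sum]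
  rfl

lemma map_id_id (s : A ⊗[k] A) :
    Algebra.TensorProduct.map (AlgHom.id k A) (AlgHom.id k A) s = s := by
  rw [Algebra.TensorProduct.map_id, AlgHom.id_apply]

lemma map_comm (f : A →ₐ[k] A) (s : A ⊗[k] A) :
    Algebra.TensorProduct.map f f (TensorProduct.comm k A A s) =
      TensorProduct.comm k A A (Algebra.TensorProduct.map f f s) := by
  induction s using TensorProduct.induction_on with
  | zero => simp
  | add r r' h h' => simp only [map_add, h, h']
  | tmul a b => simp

/-- In the frame, the beads of a crossing with strands directed `x` and `y` are the two factors of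
`crossingTensor`. -/
lemma sum_frame_bead (h : IsBiOrientedQuantumAlgebra ρ γ D U) (c : Crossing) (x y : Dir) :
    ∑ n, frame D x (slashBead U P c x y n) ⊗ₜ[k] frame D y (backslashBead D P c x y n) =
      crossingTensor (U * D) (crossingElement ρ γ) c x y := by
  have hD (a : A) : (D : A →ₐ[k] A) (D.symm a) = a := D.apply_symm_apply a
  have hDU (a : A) : (D : A →ₐ[k] A) (U a) = (U * D) a := h.real.comm a
  cases x <;> cases y
  · cases c
    · exact ((P _).sum_map (AlgHom.id k A) (AlgHom.id k A)).trans (map_id_id _)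
    · exact ((P _).sum_map' (AlgHom.id k A) (AlgHom.id k A)).trans (map_id_id _)
    · exact ((P _).sum_map (AlgHom.id k A) (AlgHom.id k A)).trans (map_id_id _)
  · simp only [slashBead, backslashBead, frame, crossingTensor, AlgHom.id_apply, and_self,
      if_true, reduceCtorEq, if_false, hD]
    cases c
    · exact ((P _).sum_map (AlgHom.id k A) (AlgHom.id k A)).trans (map_id_id _)
    · exact ((P _).sum_map' (AlgHom.id k A) (AlgHom.id k A)).trans (map_id_id _)
    · exact ((P _).sum_map' (AlgHom.id k A) (AlgHom.id k A)).trans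
        ((map_id_id _).trans h.inv_virtual.symm)
  · simp only [slashBead, backslashBead, frame, crossingTensor, AlgHom.id_apply, and_self,
      if_true, reduceCtorEq, if_false, hDU]
    cases c
    · exact (P _).sum_map ((U * D : A ≃ₐ[k] A) : A →ₐ[k] A) (AlgHom.id k A)
    · exact (P _).sum_map' ((U * D : A ≃ₐ[k] A) : A →ₐ[k] A) (AlgHom.id k A)
    · exact ((P _).sum_map' ((U * D : A ≃ₐ[k] A) : A →ₐ[k] A) (AlgHom.id k A)).trans
        (congrArg _ h.inv_virtual.symm)
  · cases c
    · exact ((P _).sum_map (D : A →ₐ[k] A) (D : A →ₐ[k] A)).trans h.real.D_inv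
    · exact ((P _).sum_map' (D : A →ₐ[k] A) (D : A →ₐ[k] A)).trans ((map_comm _ _).trans
        (congrArg _ (map_inv_eq_of_map_eq h.real.D_inv)))
    · exact ((P _).sum_map (D : A →ₐ[k] A) (D : A →ₐ[k] A)).trans h.virtual.D_inv

end Family

/-! ### Strands running through slices -/

section Steps

/-- Directions of the strands at the bottom (`d = up`) or at the top (`d = down`) of a piece, that
is, on the side where strands directed `d` enter the piece. -/
def Gen.inWord (g : Gen) : Dir → List Dir
  | .up => g.dom
  | .down => g.cod

/-- Directions of the strands on the side of a slice where strands directed `d` enter it. -/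
def Slice.inWord (s : Slice) : Dir → List Dir
  | .up => s.src
  | .down => s.tgt

/-- The direction in which a strand leaves a piece that it has entered in direction `d`. -/
def Gen.turn : Gen → Dir → Dir
  | .cap _, _ => .down
  | .cup _, _ => .up
  | .cross _ _ _, d => d

/-- The direction and the position in which a strand leaves a slice that it has entered in
direction `d` and position `p`. -/
def Slice.thru (s : Slice) (d : Dir) (p : ℕ) : Dir × ℕ :=
  if s.Hits d p then (s.gen.turn d, 2 * s.left.length + 1 - p)
  else (d, if p < s.left.length then p
    else p - (s.gen.inWord d).length + (s.gen.inWord d.rev).length)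

@[simp] lemma Dir.rev_rev (d : Dir) : d.rev.rev = d := by cases d <;> rfl

lemma Slice.inWord_eq (s : Slice) (d : Dir) :
    s.inWord d = s.left ++ s.gen.inWord d ++ s.right := by cases d <;> rfl

lemma Slice.hits_iff (s : Slice) (d : Dir) (p : ℕ) : s.Hits d p ↔
    s.left.length ≤ p ∧ p < s.left.length + (s.gen.inWord d).length := by cases d <;> rfl

lemma Gen.length_inWord_le (g : Gen) (d : Dir) : (g.inWord d).length ≤ 2 := by
  cases g <;> cases d <;> simp [Gen.inWord, Gen.dom, Gen.cod]

lemma Slice.thru_of_lt {s : Slice} {p : ℕ} (h : p < s.left.length) (d : Dir) :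
    s.thru d p = (d, p) := by
  rw [Slice.thru, if_neg, if_pos h]
  rw [Slice.hits_iff]
  lia

lemma Slice.thru_of_hits {s : Slice} {d : Dir} {q : ℕ} (h : q < (s.gen.inWord d).length) :
    s.thru d (s.left.length + q) = (s.gen.turn d, s.left.length + (1 - q)) := by
  have := s.gen.length_inWord_le d
  rw [Slice.thru, if_pos]
  · congr 1
    lia
  · rw [Slice.hits_iff]
    lia

lemma Slice.thru_of_ge (s : Slice) (d : Dir) (q : ℕ) :
    s.thru d (s.left.length + (s.gen.inWord d).length + q) =
      (d, s.left.length + (s.gen.inWord d.rev).length + q) := by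
  rw [Slice.thru, if_neg, if_neg]
  · congr 1
    lia
  · lia
  · rw [Slice.hits_iff]
    lia

/-- A position on the bottom or the top of a slice is to the left of the piece, belongs to the piece
or is to the right of the piece. -/
lemma Slice.position_cases (s : Slice) (d : Dir) (p : ℕ) : p < s.left.length ∨
    (∃ q, q < (s.gen.inWord d).length ∧ p = s.left.length + q) ∨
    ∃ q, p = s.left.length + (s.gen.inWord d).length + q := by
  rcases lt_or_ge p s.left.length with h | h
  · exact .inl h
  rcases lt_or_ge p (s.left.length + (s.gen.inWord d).length) with h' | h'
  · exact .inr (.inl ⟨p - s.left.length, by lia, by lia⟩)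
  · exact .inr (.inr ⟨p - (s.left.length + (s.gen.inWord d).length), by lia⟩)

lemma Gen.length_inWord_turn {g : Gen} {d : Dir} {q : ℕ} (h : q < (g.inWord d).length) :
    1 - q < (g.inWord (g.turn d).rev).length ∧ 1 - (1 - q) = q ∧
      g.turn (g.turn d).rev = d.rev := by
  cases g <;> cases d <;>
    simp only [Gen.inWord, Gen.turn, Gen.dom, Gen.cod, Dir.rev, List.length_cons,
      List.length_nil] at h ⊢ <;> lia

lemma Gen.getElem_inWord_turn {g : Gen} {d : Dir} {q : ℕ} (h : (g.inWord d)[q]? = some d) :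
    (g.inWord (g.turn d).rev)[1 - q]? = some (g.turn d) := by
  have hq : q < 2 := lt_of_lt_of_le (List.getElem?_eq_some_iff.1 h).1 (g.length_inWord_le d)
  rcases g with (_ | _) | (_ | _) | ⟨_, _ | _, _ | _⟩ <;> cases d <;> interval_cases q <;>
    first | rfl | simp [Gen.inWord, Gen.dom, Gen.cod, Dir.rev] at h

lemma Slice.getElem_inWord_left {s : Slice} {p : ℕ} (h : p < s.left.length) (d : Dir) :
    (s.inWord d)[p]? = s.left[p]? := by
  rw [s.inWord_eq, List.append_assoc, List.getElem?_append_left h]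

lemma Slice.getElem_inWord_gen {s : Slice} {q : ℕ} {d : Dir} (h : q < (s.gen.inWord d).length) :
    (s.inWord d)[s.left.length + q]? = (s.gen.inWord d)[q]? := by
  rw [s.inWord_eq, List.append_assoc, List.getElem?_append_right (by lia),
    Nat.add_sub_cancel_left, List.getElem?_append_left h]

lemma Slice.getElem_inWord_right (s : Slice) (q : ℕ) (d : Dir) :
    (s.inWord d)[s.left.length + (s.gen.inWord d).length + q]? = s.right[q]? := by
  rw [s.inWord_eq, List.getElem?_append_right (by simp)]
  congr 1
  simp

/-- Running through a slice backwards. -/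
lemma Slice.thru_rev {s : Slice} {d : Dir} {p : ℕ} :
    s.thru (s.thru d p).1.rev (s.thru d p).2 = (d.rev, p) := by
  rcases s.position_cases d p with h | ⟨q, hq, rfl⟩ | ⟨q, rfl⟩
  · rw [thru_of_lt h, thru_of_lt h]
  · obtain ⟨h1, h2, h3⟩ := Gen.length_inWord_turn hq
    rw [thru_of_hits hq, thru_of_hits h1, h2, h3]
  · have := s.thru_of_ge d.rev q
    rw [Dir.rev_rev] at this
    rw [thru_of_ge, this]

/-- A strand keeps its orientation. -/
lemma Slice.getElem_thru {s : Slice} {d : Dir} {p : ℕ} (h : (s.inWord d)[p]? = some d) :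
    (s.inWord (s.thru d p).1.rev)[(s.thru d p).2]? = some (s.thru d p).1 := by
  rcases s.position_cases d p with hp | ⟨q, hq, rfl⟩ | ⟨q, rfl⟩
  · rw [thru_of_lt hp]
    rwa [getElem_inWord_left hp] at h ⊢
  · rw [getElem_inWord_gen hq] at h
    rw [thru_of_hits hq]
    change (s.inWord _)[s.left.length + (1 - q)]? = _
    rw [getElem_inWord_gen (Gen.length_inWord_turn hq).1]
    exact Gen.getElem_inWord_turn h
  · rw [getElem_inWord_right] at h
    rw [thru_of_ge]
    change (s.inWord d.rev)[_]? = _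
    rw [getElem_inWord_right, h]

/-- A point of a strand between two slices: its level, its position in this level, and the direction
of the strand. The level `i` is at the bottom of the `i`-th slice. -/
abbrev Pos := ℕ × ℕ × Dir

/-- The index of the slice that is entered at a point of a strand. -/
def enteredIdx : Pos → Option ℕ
  | (i, _, .up) => some i
  | (0, _, .down) => none
  | (i + 1, _, .down) => some i

/-- The point where a strand leaves the `i`-th slice. -/
def exitPos (i : ℕ) (x : Dir × ℕ) : Pos :=
  (match x.1 with
    | .up => i + 1
    | .down => i, x.2, x.1)

/-- The slice entered at a point of a strand, and its index. -/
def entered (L : List Slice) (x : Pos) : Option (ℕ × Slice) :=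
  (enteredIdx x).bind fun i => L[i]?.map fun s => (i, s)

/-- The point of a strand that follows `x` after the next slice; `none` at the boundary. -/
def step (L : List Slice) (x : Pos) : Option Pos :=
  (entered L x).map fun y => exitPos y.1 (y.2.thru x.2.2 x.2.1)

/-- The same point on the strand with the opposite orientation. -/
def Pos.reverse (x : Pos) : Pos := (x.1, x.2.1, x.2.2.rev)

lemma enteredIdx_reverse_exitPos (i : ℕ) (y : Dir × ℕ) :
    enteredIdx (exitPos i y).reverse = some i := by
  rcases y with ⟨_ | _, p⟩ <;> rfl

lemma exitPos_of_enteredIdx {x : Pos} {i : ℕ} (h : enteredIdx x = some i) :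
    exitPos i (x.2.2.rev, x.2.1) = x.reverse := by
  obtain ⟨_ | j, p, _ | _⟩ := x <;> simp [enteredIdx] at h <;> subst h <;> rfl

lemma entered_eq_some {L : List Slice} {x : Pos} {i : ℕ} {s : Slice} :
    entered L x = some (i, s) ↔ enteredIdx x = some i ∧ L[i]? = some s := by
  simp only [entered, Option.bind_eq_some_iff, Option.map_eq_some_iff, Prod.mk.injEq]
  constructor
  · rintro ⟨_, h, _, h', rfl, rfl⟩
    exact ⟨h, h'⟩
  · rintro ⟨h, h'⟩
    exact ⟨i, h, s, h', rfl, rfl⟩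

lemma step_eq_some {L : List Slice} {x y : Pos} : step L x = some y ↔
    ∃ i s, enteredIdx x = some i ∧ L[i]? = some s ∧ exitPos i (s.thru x.2.2 x.2.1) = y := by
  simp only [step, Option.map_eq_some_iff, Prod.exists, entered_eq_some, and_assoc]

lemma step_reverse {L : List Slice} {x y : Pos} (h : step L x = some y) :
    step L y.reverse = some x.reverse := by
  obtain ⟨i, s, h1, h2, rfl⟩ := step_eq_some.1 h
  refine step_eq_some.2 ⟨i, s, enteredIdx_reverse_exitPos _ _, h2, ?_⟩
  rw [← exitPos_of_enteredIdx h1, ← Slice.thru_rev]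
  rfl

lemma reverse_injective : Function.Injective Pos.reverse := by
  rintro ⟨i, p, d⟩ ⟨i', p', d'⟩ h
  simp only [Pos.reverse, Prod.mk.injEq] at h
  obtain ⟨rfl, rfl, h⟩ := h
  rw [← d.rev_rev, h, d'.rev_rev]

lemma step_injective {L : List Slice} {x x' y : Pos} (h : step L x = some y)
    (h' : step L x' = some y) : x = x' :=
  reverse_injective (Option.some.inj ((step_reverse h).symm.trans (step_reverse h')))

/-- The directions of the strands at level `i` of a stack of slices that starts from the
word `u`. -/
def levelWord (u : List Dir) : List Slice → ℕ → List Dir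
  | _, 0 => u
  | [], _ + 1 => []
  | s :: t, i + 1 => levelWord s.tgt t i

/-- The point `x` lies on a strand and has the direction of the strand. -/
def Valid (u : List Dir) (L : List Slice) (x : Pos) : Prop :=
  (levelWord u L x.1)[x.2.1]? = some x.2.2

lemma levelWord_zero (u : List Dir) (L : List Slice) : levelWord u L 0 = u := by
  cases L <;> rfl

lemma Composable.levelWord_eq {u v : List Dir} {L : List Slice} (h : Composable u L v) {i : ℕ}
    {s : Slice} (hs : L[i]? = some s) :
    levelWord u L i = s.src ∧ levelWord u L (i + 1) = s.tgt := by
  induction L generalizing u i with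
  | nil => simp at hs
  | cons a t ih =>
    rcases i with _ | i
    · obtain rfl : a = s := by simpa using hs
      exact ⟨h.1.symm, levelWord_zero _ _⟩
    · exact ih h.2 (by simpa using hs)

lemma Composable.levelWord_length {u v : List Dir} {L : List Slice} (h : Composable u L v) :
    levelWord u L L.length = v := by
  induction L generalizing u with
  | nil => exact h
  | cons a t ih => exact ih h.2

lemma levelWord_of_gt {u : List Dir} {L : List Slice} {i : ℕ} (h : L.length < i) :
    levelWord u L i = [] := by
  induction L generalizing u i with
  | nil =>
    rcases i with _ | i
    · simp at h
    · rfl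
  | cons a t ih =>
    rcases i with _ | i
    · simp at h
    · exact ih (by simpa using h)

lemma composable_append {u v : List Dir} {L M : List Slice} :
    Composable u (L ++ M) v ↔ ∃ w, Composable u L w ∧ Composable w M v := by
  induction L generalizing u with
  | nil => simp [Composable]
  | cons a t ih => simp [Composable, ih, and_assoc]

lemma levelWord_append_left {u v : List Dir} {L M : List Slice} (h : Composable u L v) {i : ℕ}
    (hi : i ≤ L.length) : levelWord u (L ++ M) i = levelWord u L i := by
  induction L generalizing u i with
  | nil =>
    obtain rfl : i = 0 := by simpa using hi
    simp [levelWord_zero]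
  | cons a t ih =>
    rcases i with _ | i
    · rfl
    · exact ih h.2 (by simpa using hi)

lemma levelWord_append_right {u v : List Dir} {L M : List Slice} (h : Composable u L v) (i : ℕ) :
    levelWord u (L ++ M) (L.length + i) = levelWord v M i := by
  induction L generalizing u with
  | nil =>
    obtain rfl : u = v := h
    simp
  | cons a t ih =>
    rw [List.length_cons, Nat.add_right_comm]
    exact ih h.2

lemma Composable.levelWord_entered {u v : List Dir} {L : List Slice} (h : Composable u L v)
    {x : Pos} {i : ℕ} {s : Slice} (hi : enteredIdx x = some i) (hs : L[i]? = some s) :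
    levelWord u L x.1 = s.inWord x.2.2 := by
  obtain ⟨_ | j, p, _ | _⟩ := x <;> simp [enteredIdx] at hi <;> subst hi
  · exact (h.levelWord_eq hs).1
  · exact (h.levelWord_eq hs).1
  · exact (h.levelWord_eq hs).2

lemma Composable.levelWord_exitPos {u v : List Dir} {L : List Slice} (h : Composable u L v)
    {i : ℕ} {s : Slice} (hs : L[i]? = some s) (y : Dir × ℕ) :
    levelWord u L (exitPos i y).1 = s.inWord y.1.rev := by
  rcases y with ⟨_ | _, p⟩
  · exact (h.levelWord_eq hs).2
  · exact (h.levelWord_eq hs).1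

lemma Composable.valid_step {u v : List Dir} {L : List Slice} (h : Composable u L v) {x y : Pos}
    (hx : Valid u L x) (hy : step L x = some y) : Valid u L y := by
  obtain ⟨i, s, h1, h2, rfl⟩ := step_eq_some.1 hy
  rw [Valid, h.levelWord_entered h1 h2] at hx
  rw [Valid, h.levelWord_exitPos h2]
  exact Slice.getElem_thru hx

lemma Valid.le_length {u : List Dir} {L : List Slice} {x : Pos} (h : Valid u L x) :
    x.1 ≤ L.length := by
  by_contra hlt
  rw [Valid, levelWord_of_gt (by lia)] at h
  simp at h

/-- A strand ends only at the boundary. -/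
lemma Valid.step_cases {u : List Dir} {L : List Slice} {x : Pos} (h : Valid u L x) :
    (∃ y, step L x = some y) ∨ (x.1 = 0 ∧ x.2.2 = .down) ∨ (x.1 = L.length ∧ x.2.2 = .up) := by
  have hle := h.le_length
  have key (i : ℕ) (hi : i < L.length) (hx : enteredIdx x = some i) : ∃ y, step L x = some y :=
    ⟨_, step_eq_some.2 ⟨i, L[i], hx, List.getElem?_eq_getElem hi, rfl⟩⟩
  obtain ⟨_ | j, p, _ | _⟩ := x
  · rcases hle.lt_or_eq with h' | h'
    · exact .inl (key 0 h' rfl)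
    · exact .inr (.inr ⟨h', rfl⟩)
  · exact .inr (.inl ⟨rfl, rfl⟩)
  · rcases hle.lt_or_eq with h' | h'
    · exact .inl (key _ h' rfl)
    · exact .inr (.inr ⟨h', rfl⟩)
  · exact .inl (key j hle rfl)

lemma finite_valid (u : List Dir) (L : List Slice) : {x | Valid u L x}.Finite := by
  have h : (Set.Iic L.length).Finite := Set.finite_Iic _
  refine (h.biUnion (t := fun i => (fun p : ℕ × Dir => ((i, p) : Pos)) ''
    (Set.Iio (levelWord u L i).length ×ˢ Set.univ)) fun i _ => ?_).subset fun x hx => ?_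
  · have : Finite Dir := Finite.of_surjective (fun b : Bool => if b then Dir.up else Dir.down)
      fun d => by cases d; exacts [⟨true, rfl⟩, ⟨false, rfl⟩]
    exact ((Set.finite_Iio _).prod Set.finite_univ).image _
  · simp only [Set.mem_iUnion]
    exact ⟨x.1, hx.le_length, x.2, ⟨(List.getElem?_eq_some_iff.1 hx).1, trivial⟩, rfl⟩

/-- Following the strands of a closed diagram. -/
def follow (L : List Slice) (x : Pos) : Pos := (step L x).getD x

section Closed

variable {L : List Slice}

lemma Composable.step_follow (h : Composable [] L []) {x : Pos} (hx : Valid [] L x) :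
    step L x = some (follow L x) := by
  rcases hx.step_cases with ⟨y, hy⟩ | ⟨h1, -⟩ | ⟨h1, -⟩
  · simp [follow, hy]
  · rw [Valid, h1, levelWord_zero] at hx
    simp at hx
  · rw [Valid, h1, h.levelWord_length] at hx
    simp at hx

lemma Composable.valid_follow (h : Composable [] L []) {x : Pos} (hx : Valid [] L x) :
    Valid [] L (follow L x) :=
  h.valid_step hx (h.step_follow hx)

lemma Composable.valid_subset_periodicPts (h : Composable [] L []) :
    {x | Valid [] L x} ⊆ Function.periodicPts (follow L) :=
  subset_periodicPts (finite_valid _ _) (fun _ hx => h.valid_follow hx) fun _ hx _ hy hxy =>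
    step_injective (h.step_follow hx) (hxy ▸ h.step_follow hy)

end Closed

end Steps

/-! ### Tangles inside diagrams -/

section Tangles

variable {k A R B : Type*} [CommRing k] [Ring A] [Algebra k A] [CommRing R] [Algebra k R]
  [Ring B] [Algebra k B] {θ : A ≃ₐ[k] A} {τ : ℤ → A →ₗ[k] R} (t : TraceRing θ τ B)

/-- The bead, in the frame, that is met on a strand of a piece; `ab` are the beads on the strands
`/` and `\` of a crossing. -/
def Gen.bead (g : Gen) (ab : A × A) (onSlash : Prop) [Decidable onSlash] : B :=
  match g with
  | .cap .down => t.turn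
  | .cup .up => (t.turn⁻¹ : Bˣ)
  | .cap .up | .cup .down => 1
  | .cross _ _ _ => t.incl (if onSlash then ab.1 else ab.2)

/-- The bead that is met on the strand that enters a slice in direction `d` and position `p`. -/
def Slice.bead (s : Slice) (ab : A × A) (d : Dir) (p : ℕ) : B :=
  if s.Hits d p then s.gen.bead t ab (d = .up ↔ p = s.left.length) else 1

/-- The bead that is met in the slice following the point `x` of a stack of slices, when the
crossings are labelled by the list `ℓ` of pairs of beads. -/
def bead (L : List Slice) (ℓ : List (A × A)) (x : Pos) : B :=
  match entered L x with
  | some (i, s) => s.bead t (ℓ.getD i (1, 1)) x.2.2 x.2.1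
  | none => 1

lemma bead_of_entered {L : List Slice} {ℓ : List (A × A)} {x : Pos} {i : ℕ} {s : Slice}
    (h : entered L x = some (i, s)) :
    bead t L ℓ x = s.bead t (ℓ.getD i (1, 1)) x.2.2 x.2.1 := by
  simp [bead, h]

lemma step_of_entered {L : List Slice} {x : Pos} {i : ℕ} {s : Slice}
    (h : entered L x = some (i, s)) : step L x = some (exitPos i (s.thru x.2.2 x.2.1)) := by
  simp [step, h]

/-- `Path L x vs y` means that the strand through `x` leads through the points `vs`, of which `x` is
the first one, to `y`. -/
inductive Path (L : List Slice) : Pos → List Pos → Pos → Prop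
  | nil (x : Pos) : Path L x [] x
  | cons {x y z : Pos} {vs : List Pos} (h : step L x = some y) (hp : Path L y vs z) :
      Path L x (x :: vs) z

/-- Move a point up by `n` levels. -/
def Pos.raise (n : ℕ) (x : Pos) : Pos := (n + x.1, x.2)

section Inside

variable {pre X post : List Slice}

lemma entered_raise {x : Pos} {i : ℕ} {s : Slice} (h : entered X x = some (i, s)) :
    entered (pre ++ X ++ post) (x.raise pre.length) = some (pre.length + i, s) := by
  obtain ⟨h1, h2⟩ := entered_eq_some.1 h
  refine entered_eq_some.2 ⟨?_, ?_⟩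
  · obtain ⟨_ | j, p, _ | _⟩ := x <;> simp [enteredIdx] at h1 <;> subst h1 <;> rfl
  · have hi : i < X.length := (List.getElem?_eq_some_iff.1 h2).1
    rw [List.append_assoc, List.getElem?_append_right (by lia), Nat.add_sub_cancel_left,
      List.getElem?_append_left hi, h2]

lemma step_raise {x y : Pos} (h : step X x = some y) :
    step (pre ++ X ++ post) (x.raise pre.length) = some (y.raise pre.length) := by
  simp only [step, Option.map_eq_some_iff] at h
  obtain ⟨⟨i, s⟩, h1, rfl⟩ := h
  rw [step_of_entered (entered_raise h1)]
  congr 1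
  change exitPos _ (s.thru x.2.2 x.2.1) = _
  rcases s.thru x.2.2 x.2.1 with ⟨_ | _, p⟩ <;> rfl

lemma bead_raise {a b c : List (A × A)} (ha : a.length = pre.length) (hb : b.length = X.length)
    {x y : Pos} (h : step X x = some y) :
    bead t (pre ++ X ++ post) (a ++ b ++ c) (x.raise pre.length) = bead t X b x := by
  simp only [step, Option.map_eq_some_iff] at h
  obtain ⟨⟨i, s⟩, h1, rfl⟩ := h
  rw [bead_of_entered t h1, bead_of_entered t (entered_raise h1)]
  have hi : i < X.length := (List.getElem?_eq_some_iff.1 (entered_eq_some.1 h1).2).1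
  have : (a ++ b ++ c).getD (pre.length + i) (1, 1) = b.getD i (1, 1) := by
    rw [List.getD_eq_getElem?_getD, List.getD_eq_getElem?_getD, List.append_assoc,
      List.getElem?_append_right (by lia), ha, Nat.add_sub_cancel_left,
      List.getElem?_append_left (by lia)]
  rw [this]
  rfl

lemma Path.follow_raise {x y : Pos} {vs : List Pos} (h : Path X x vs y) :
    (follow (pre ++ X ++ post))^[vs.length] (x.raise pre.length) = y.raise pre.length ∧
    (∀ j, 0 < j → j ≤ vs.length → ∃ z z', step X z = some z' ∧
      (follow (pre ++ X ++ post))^[j] (x.raise pre.length) = z'.raise pre.length) ∧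
    ∀ a b c : List (A × A), a.length = pre.length → b.length = X.length →
      orbitWord (follow (pre ++ X ++ post)) (bead t (pre ++ X ++ post) (a ++ b ++ c))
        (x.raise pre.length) vs.length = (vs.map (bead t X b)).prod := by
  induction h with
  | nil x => exact ⟨rfl, fun j h h' => absurd h' (by simp; lia), fun _ _ _ _ _ => by simp⟩
  | @cons x y z vs h hp ih =>
    have hf : follow (pre ++ X ++ post) (x.raise pre.length) = y.raise pre.length := by
      rw [follow, step_raise h, Option.getD_some]
    refine ⟨?_, fun j hj hj' => ?_, fun a b c ha hb => ?_⟩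
    · rw [List.length_cons, Function.iterate_succ_apply, hf, ih.1]
    · obtain ⟨j, rfl⟩ := Nat.exists_eq_add_of_lt hj
      rw [Nat.zero_add, Function.iterate_succ_apply, hf]
      rcases Nat.eq_zero_or_pos j with rfl | hj0
      · exact ⟨x, y, h, rfl⟩
      · exact ih.2.1 j hj0 (by simpa using hj')
    · rw [List.length_cons, orbitWord_succ', hf, ih.2.2 a b c ha hb, bead_raise t ha hb h,
        List.map_cons, List.prod_cons]

end Inside

/-- The index in `pre ++ X ++ post` of the `i`-th slice of `pre ++ post`, where `pre` has length `n`
and `X` has length `m`. -/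
def skip (n m i : ℕ) : ℕ := if i < n then i else i + m

/-- The point in a stack `pre ++ X ++ post` that corresponds to a point in `pre ++ post`, where
points at the level between `pre` and `post` are seen as points at which strands leave `X`. -/
def gapOut (n m : ℕ) : Pos → Pos
  | (i, p, .up) => (skip n m i, p, .up)
  | (0, p, .down) => (0, p, .down)
  | (i + 1, p, .down) => (skip n m i + 1, p, .down)

/-- The point in a stack `pre ++ X ++ post` that corresponds to a point in `pre ++ post`, where
points at the level between `pre` and `post` are seen as points at which strands enter `X`. -/
def gapIn (n m : ℕ) (x : Pos) : Pos := (gapOut n m x.reverse).reverse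

/-- The point at which a strand enters a tangle in direction `x.1` and position `x.2`. -/
def entrance (m : ℕ) : Dir × ℕ → Pos
  | (.up, p) => (0, p, .up)
  | (.down, p) => (m, p, .down)

/-- The point at which a strand leaves a tangle in direction `x.1` and position `x.2`. -/
def exit (m : ℕ) : Dir × ℕ → Pos
  | (.up, p) => (m, p, .up)
  | (.down, p) => (0, p, .down)

lemma gapIn_self (n m p : ℕ) (d : Dir) : gapIn n m (n, p, d) = (entrance m (d, p)).raise n := by
  rcases d with _ | _
  · rcases n with _ | n <;> simp [gapIn, gapOut, Pos.reverse, Dir.rev, entrance, Pos.raise, skip]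
  · simp [gapIn, gapOut, Pos.reverse, Dir.rev, entrance, Pos.raise, skip]

lemma gapOut_self (n m p : ℕ) (d : Dir) : gapOut n m (n, p, d) = (exit m (d, p)).raise n := by
  rcases d with _ | _
  · simp [gapOut, exit, Pos.raise, skip]
  · rcases n with _ | n <;> simp [gapOut, exit, Pos.raise, skip]

lemma gapIn_of_lt {n m : ℕ} {x : Pos} (h : x.1 < n) : gapIn n m x = x := by
  obtain ⟨_ | i, p, _ | _⟩ := x <;> simp [gapIn, gapOut, Pos.reverse, Dir.rev, skip] <;>
    intro <;> simp at h <;> lia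

lemma gapOut_of_lt {n m : ℕ} {x : Pos} (h : x.1 < n) : gapOut n m x = x := by
  obtain ⟨_ | i, p, _ | _⟩ := x <;> simp [gapOut, skip] <;>
    intro <;> simp at h <;> lia

lemma gapIn_of_gt {n m : ℕ} {x : Pos} (h : n < x.1) : gapIn n m x = (x.1 + m, x.2) := by
  obtain ⟨_ | i, p, _ | _⟩ := x <;> simp at h <;>
    simp [gapIn, gapOut, Pos.reverse, Dir.rev, skip] <;> (try split_ifs) <;> omega

lemma gapOut_of_gt {n m : ℕ} {x : Pos} (h : n < x.1) : gapOut n m x = (x.1 + m, x.2) := by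
  obtain ⟨_ | i, p, _ | _⟩ := x <;> simp at h <;> simp [gapOut, skip] <;>
    (try split_ifs) <;> omega

lemma gapOut_injective (n m : ℕ) : Function.Injective (gapOut n m) := by
  rintro ⟨_ | i, p, _ | _⟩ ⟨_ | i', p', _ | _⟩ h <;>
    simp only [gapOut, skip, Prod.mk.injEq, reduceCtorEq, and_false, and_true] at h ⊢ <;>
    (try split_ifs at h) <;> omega

lemma gapIn_injective (n m : ℕ) : Function.Injective (gapIn n m) := fun _ _ h =>
  reverse_injective (gapOut_injective n m (reverse_injective h))

lemma enteredIdx_gapOut (n m : ℕ) (x : Pos) :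
    enteredIdx (gapOut n m x) = (enteredIdx x).map (skip n m) := by
  obtain ⟨_ | i, p, _ | _⟩ := x <;> rfl

lemma gapIn_exitPos (n m i : ℕ) (y : Dir × ℕ) :
    gapIn n m (exitPos i y) = exitPos (skip n m i) y := by
  rcases y with ⟨_ | _, p⟩ <;> rfl

section Outside

variable {pre X post : List Slice}

lemma getElem?_skip {α : Type*} (a b c : List α) (i : ℕ) :
    (a ++ b ++ c)[skip a.length b.length i]? = (a ++ c)[i]? := by
  rw [skip]
  split_ifs with h
  · rw [List.append_assoc, List.getElem?_append_left h, List.getElem?_append_left h]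
  · rw [List.getElem?_append_right (by simp; lia), List.getElem?_append_right (by lia)]
    congr 1
    simp
    lia

lemma entered_gapOut (x : Pos) :
    entered (pre ++ X ++ post) (gapOut pre.length X.length x) =
      (entered (pre ++ post) x).map fun y => (skip pre.length X.length y.1, y.2) := by
  rw [entered, entered, enteredIdx_gapOut]
  rcases enteredIdx x with _ | i
  · rfl
  · simp only [Option.map_some, Option.bind_some, getElem?_skip, Option.map_map]
    rfl

lemma gapOut_snd (n m : ℕ) (x : Pos) : (gapOut n m x).2 = x.2 := by
  obtain ⟨_ | i, p, _ | _⟩ := x <;> rfl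

lemma step_gapOut (x : Pos) :
    step (pre ++ X ++ post) (gapOut pre.length X.length x) =
      (step (pre ++ post) x).map (gapIn pre.length X.length) := by
  rw [step, step, entered_gapOut, gapOut_snd, Option.map_map, Option.map_map]
  congr 1
  funext y
  exact (gapIn_exitPos _ _ _ _).symm

lemma bead_gapOut {a b c : List (A × A)} (ha : a.length = pre.length) (hb : b.length = X.length)
    (x : Pos) :
    bead t (pre ++ X ++ post) (a ++ b ++ c) (gapOut pre.length X.length x) =
      bead t (pre ++ post) (a ++ c) x := by
  rw [bead, bead, entered_gapOut, gapOut_snd]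
  rcases entered (pre ++ post) x with _ | ⟨i, s⟩
  · rfl
  · simp only [Option.map_some, List.getD_eq_getElem?_getD]
    rw [← ha, ← hb, getElem?_skip]

end Outside

/-- The directions at the side of a tangle, with bottom `u` and top `v`, where strands directed `d`
enter it. -/
def portWord (u v : List Dir) : Dir → List Dir
  | .up => u
  | .down => v

/-- `X` is a stack of slices without closed components. Its strands lead from the port at which they
enter to the port given by `π`, and the beads met on the way have the product `W`, which depends on
the labels of the crossings. -/
structure IsTangle (X : List Slice) (u v : List Dir) (π : Dir × ℕ → Dir × ℕ)
    (W : List (A × A) → Dir × ℕ → B) : Prop where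
  composable : Composable u X v
  path : ∀ q : Dir × ℕ, (portWord u v q.1)[q.2]? = some q.1 →
    ∃ vs, Path X (entrance X.length q) vs (exit X.length (π q)) ∧
      ∀ ℓ, ℓ.length = X.length → (vs.map (bead t X ℓ)).prod = W ℓ q
  cover : ∀ x, Valid u X x → ∃ vs q, Path X x vs (exit X.length q)

/-- Replace a point at which a strand enters the gap at level `n` by the point at which it leaves
the gap, when the gap is filled by a tangle with matching `π`. -/
def twist (n : ℕ) (π : Dir × ℕ → Dir × ℕ) (x : Pos) : Pos :=
  if x.1 = n then (n, (π (x.2.2, x.2.1)).2, (π (x.2.2, x.2.1)).1) else x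

/-- Following the strands of the diagram that is obtained by filling the gap between `pre` and
`post` by a tangle with matching `π`, where the tangle is passed in no time. -/
def outerFollow (pre post : List Slice) (π : Dir × ℕ → Dir × ℕ) (x : Pos) : Pos :=
  follow (pre ++ post) (twist pre.length π x)

/-- The points of the strands outside of the gap between `pre` and `post`, and the points at which
they enter the gap. -/
def OuterValid (pre post : List Slice) (u v : List Dir) (x : Pos) : Prop :=
  (if x.1 < pre.length then levelWord [] pre x.1
    else if x.1 = pre.length then portWord u v x.2.2
    else levelWord v post (x.1 - pre.length))[x.2.1]? = some x.2.2

/-- The beads met outside of the gap, together with beads `w` on the strands in the gap. -/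
def outerBead (pre post : List Slice) (π : Dir × ℕ → Dir × ℕ) (ℓ : List (A × A))
    (w : Dir × ℕ → B) (x : Pos) : B :=
  (if x.1 = pre.length then w (x.2.2, x.2.1) else 1) *
    bead t (pre ++ post) ℓ (twist pre.length π x)

section Replacement

variable {pre X post : List Slice} {u v : List Dir} {π : Dir × ℕ → Dir × ℕ}
  {W : List (A × A) → Dir × ℕ → B}

lemma valid_raise (hpre : Composable [] pre u) (hX : Composable u X v) {x : Pos}
    (hx : x.1 ≤ X.length) :
    Valid [] (pre ++ X ++ post) (x.raise pre.length) ↔ Valid u X x := by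
  rw [Valid, Valid, Pos.raise, List.append_assoc, levelWord_append_right hpre,
    levelWord_append_left hX hx]

lemma entrance_fst_le (m : ℕ) (q : Dir × ℕ) : (entrance m q).1 ≤ m := by
  rcases q with ⟨_ | _, p⟩ <;> simp [entrance]

lemma valid_entrance (hX : Composable u X v) (q : Dir × ℕ) :
    Valid u X (entrance X.length q) ↔ (portWord u v q.1)[q.2]? = some q.1 := by
  rcases q with ⟨_ | _, p⟩
  · simp [Valid, entrance, portWord, levelWord_zero]
  · simp [Valid, entrance, portWord, hX.levelWord_length]

lemma valid_gapIn (hpre : Composable [] pre u) (hX : Composable u X v) (x : Pos) :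
    Valid [] (pre ++ X ++ post) (gapIn pre.length X.length x) ↔ OuterValid pre post u v x := by
  obtain ⟨i, p, d⟩ := x
  rcases lt_trichotomy i pre.length with h | rfl | h
  · rw [gapIn_of_lt h, Valid, List.append_assoc, levelWord_append_left hpre h.le, OuterValid,
      if_pos h]
  · rw [gapIn_self, valid_raise hpre hX (entrance_fst_le _ _), valid_entrance hX, OuterValid,
      if_neg (lt_irrefl _), if_pos rfl]
  · rw [gapIn_of_gt h, OuterValid, if_neg (by simp; lia), if_neg (by simp; lia), Valid]
    have : i + X.length = (pre ++ X).length + (i - pre.length) := by simp; lia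
    simp only
    rw [this, levelWord_append_right (composable_append.2 ⟨u, hpre, hX⟩)]

variable {t} in
/-- Passing the tangle `X` in no time is a first return map: strands are observed only outside of
the tangle and where they enter it. -/
lemma IsTangle.isFirstReturn (hX : IsTangle t X u v π W) (hpre : Composable [] pre u)
    (hpost : Composable v post []) :
    ∃ n, IsFirstReturn (follow (pre ++ X ++ post)) {x | Valid [] (pre ++ X ++ post) x}
        (outerFollow pre post π) {x | OuterValid pre post u v x} (gapIn pre.length X.length) n ∧
      ∀ a b c : List (A × A), a.length = pre.length → b.length = X.length →
        ∀ x, OuterValid pre post u v x →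
          orbitWord (follow (pre ++ X ++ post)) (bead t (pre ++ X ++ post) (a ++ b ++ c))
            (gapIn pre.length X.length x) (n x) = outerBead t pre post π (a ++ c) (W b) x := by
  have hK : Composable [] (pre ++ X ++ post) [] :=
    composable_append.2 ⟨v, composable_append.2 ⟨u, hpre, hX.composable⟩, hpost⟩
  have hiter (x : Pos) (hx : Valid [] (pre ++ X ++ post) x) (m : ℕ) :
      Valid [] (pre ++ X ++ post) ((follow (pre ++ X ++ post))^[m] x) := by
    induction m with
    | zero => exact hx
    | succ m ih => rw [Function.iterate_succ_apply']; exact hK.valid_follow ih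
  have hout (x : Pos) (hx : Valid [] (pre ++ X ++ post) (gapOut pre.length X.length x)) :
      follow (pre ++ X ++ post) (gapOut pre.length X.length x) =
        gapIn pre.length X.length (follow (pre ++ post) x) := by
    have h := hK.step_follow hx
    rw [step_gapOut, Option.map_eq_some_iff] at h
    obtain ⟨y, h1, h2⟩ := h
    rw [← h2, follow, h1, Option.getD_some]
  have hinner (z z' x : Pos) (hz : step X z = some z') :
      z'.raise pre.length ≠ gapIn pre.length X.length x := by
    obtain ⟨i, s, -, h2, rfl⟩ := step_eq_some.1 hz
    have hi : i < X.length := (List.getElem?_eq_some_iff.1 h2).1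
    obtain ⟨_ | j, p, _ | _⟩ := x <;> rcases s.thru z.2.2 z.2.1 with ⟨_ | _, p'⟩ <;>
      simp [exitPos, Pos.raise, gapIn, gapOut, Pos.reverse, Dir.rev, skip] <;>
      intros <;> split_ifs at * <;> lia
  -- A point at the level of the gap is followed through the tangle, and then by one more step.
  have hret (x : Pos) (hx : OuterValid pre post u v x) : ∃ m,
      (follow (pre ++ X ++ post))^[m] (gapIn pre.length X.length x) =
        gapOut pre.length X.length (twist pre.length π x) ∧
      (∀ j, 0 < j → j ≤ m → ∀ y, (follow (pre ++ X ++ post))^[j]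
        (gapIn pre.length X.length x) ≠ gapIn pre.length X.length y) ∧
      ∀ a b c : List (A × A), a.length = pre.length → b.length = X.length →
        orbitWord (follow (pre ++ X ++ post)) (bead t (pre ++ X ++ post) (a ++ b ++ c))
          (gapIn pre.length X.length x) m =
            if x.1 = pre.length then W b (x.2.2, x.2.1) else 1 := by
    obtain ⟨i, p, d⟩ := x
    by_cases hi : i = pre.length
    · subst hi
      rw [← valid_gapIn hpre hX.composable, gapIn_self,
        valid_raise hpre hX.composable (entrance_fst_le _ _), valid_entrance hX.composable] at hx
      obtain ⟨vs, hp, hw⟩ := hX.path _ hx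
      obtain ⟨h1, h2, h3⟩ := hp.follow_raise t (pre := pre) (post := post)
      refine ⟨vs.length, ?_, fun j hj hj' y => ?_, fun a b c ha hb => ?_⟩
      · rw [gapIn_self, h1, twist, if_pos rfl, gapOut_self]
      · obtain ⟨z, z', hz, hz'⟩ := h2 j hj hj'
        rw [gapIn_self, hz']
        exact hinner z z' y hz
      · rw [gapIn_self, h3 a b c ha hb, hw b hb, if_pos rfl]
    · refine ⟨0, ?_, fun j hj hj' => absurd hj' (by lia), fun a b c ha hb => ?_⟩
      · rw [twist, if_neg hi]
        rcases lt_or_gt_of_ne hi with h | h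
        · rw [gapIn_of_lt h, gapOut_of_lt h]; rfl
        · rw [gapIn_of_gt h, gapOut_of_gt h]; rfl
      · rw [if_neg hi, orbitWord_zero]
  choose! m hm1 hm2 hm3 using hret
  have hvalid (x : Pos) (hx : OuterValid pre post u v x) :
      Valid [] (pre ++ X ++ post) (gapOut pre.length X.length (twist pre.length π x)) := by
    rw [← hm1 x hx]
    exact hiter _ ((valid_gapIn hpre hX.composable x).2 hx) _
  have hreturn (x : Pos) (hx : OuterValid pre post u v x) :
      (follow (pre ++ X ++ post))^[m x + 1] (gapIn pre.length X.length x) =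
        gapIn pre.length X.length (outerFollow pre post π x) := by
    rw [Function.iterate_succ_apply', hm1 x hx, hout _ (hvalid x hx), outerFollow]
  refine ⟨fun x => m x + 1, ⟨hK.valid_subset_periodicPts,
    fun x hx => (valid_gapIn hpre hX.composable x).2 hx, fun x _ y _ h => gapIn_injective _ _ h,
    fun x hx => ?_, fun x _ => Nat.succ_pos _, hreturn,
    fun x hx j hj hj' y _ => hm2 x hx j hj (Nat.lt_succ_iff.1 hj') y, fun x hx => ?_⟩,
    fun a b c ha hb x hx => ?_⟩
  · rw [Set.mem_ofPred_eq, ← valid_gapIn hpre hX.composable, ← hreturn x hx]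
    exact hiter _ ((valid_gapIn hpre hX.composable x).2 hx) _
  · by_cases h : pre.length ≤ x.1 ∧ x.1 ≤ pre.length + X.length
    · obtain ⟨y, rfl⟩ : ∃ y : Pos, y.raise pre.length = x :=
        ⟨(x.1 - pre.length, x.2), by simp [Pos.raise, Nat.add_sub_cancel' h.1]⟩
      have hy : y.1 ≤ X.length := by simpa [Pos.raise] using h.2
      obtain ⟨vs, ⟨d, p⟩, hp⟩ := hX.cover y ((valid_raise hpre hX.composable hy).1 hx)
      have h1 := (hp.follow_raise t (pre := pre) (post := post)).1
      rw [← gapOut_self] at h1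
      have h2 := hiter _ hx vs.length
      rw [h1] at h2
      have h3 := hout _ h2
      refine ⟨vs.length + 1, _, ?_, by rw [Function.iterate_succ_apply', h1, h3]⟩
      rw [Set.mem_ofPred_eq, ← valid_gapIn hpre hX.composable, ← h3]
      exact hK.valid_follow h2
    · obtain ⟨y, rfl⟩ : ∃ y, gapIn pre.length X.length y = x := by
        rcases lt_or_ge x.1 pre.length with h' | h'
        · exact ⟨x, gapIn_of_lt h'⟩
        · refine ⟨(x.1 - X.length, x.2), ?_⟩
          rw [gapIn_of_gt (by simp; lia)]
          simp only
          rw [Nat.sub_add_cancel (by lia)]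
      exact ⟨0, y, (valid_gapIn hpre hX.composable y).1 hx, rfl⟩
  · rw [orbitWord_succ, hm1 x hx, hm3 x hx a b c ha hb, bead_gapOut t ha hb, outerBead]

end Replacement

end Tangles

/-! ### Adding vertical strands to a tangle -/

section Whiskering

variable {k A R B : Type*} [CommRing k] [Ring A] [Algebra k A] [CommRing R] [Algebra k R]
  [Ring B] [Algebra k B] {θ : A ≃ₐ[k] A} {τ : ℤ → A →ₗ[k] R} {t : TraceRing θ τ B}
  (l r : List Dir)

lemma Slice.thru_whisker (s : Slice) (d : Dir) (p : ℕ) :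
    (s.whisker l r).thru d (l.length + p) = ((s.thru d p).1, l.length + (s.thru d p).2) := by
  have hlen : (s.whisker l r).left.length = l.length + s.left.length := by simp [Slice.whisker]
  rcases s.position_cases d p with h | ⟨q, hq, rfl⟩ | ⟨q, rfl⟩
  · rw [thru_of_lt h, thru_of_lt (by lia)]
  · rw [thru_of_hits hq, ← add_assoc, ← hlen, thru_of_hits (s := s.whisker l r) hq, hlen]
    simp only [add_assoc]
    rfl
  · have := (s.whisker l r).thru_of_ge d q
    rw [hlen] at this
    rw [thru_of_ge, ← add_assoc, ← add_assoc]
    refine this.trans ?_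
    simp only [add_assoc]
    rfl

lemma Slice.bead_whisker (s : Slice) (ab : A × A) (d : Dir) (p : ℕ) :
    (s.whisker l r).bead t ab d (l.length + p) = s.bead t ab d p := by
  have hlen : (s.whisker l r).left.length = l.length + s.left.length := by simp [Slice.whisker]
  have h1 : (s.whisker l r).Hits d (l.length + p) ↔ s.Hits d p := by
    rw [Slice.hits_iff, Slice.hits_iff, hlen]
    simp only [Slice.whisker]
    lia
  have h2 : (l.length + p = (s.whisker l r).left.length) ↔ p = s.left.length := by lia
  simp only [Slice.bead, h1, h2]
  rfl

/-- Move a point to the right by `m` positions. -/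
def Pos.shift (m : ℕ) (x : Pos) : Pos := (x.1, m + x.2.1, x.2.2)

lemma entered_whisker {X : List Slice} {x : Pos} {i : ℕ} {s : Slice}
    (h : entered X x = some (i, s)) :
    entered (X.map (Slice.whisker l r)) (x.shift l.length) = some (i, s.whisker l r) := by
  obtain ⟨h1, h2⟩ := entered_eq_some.1 h
  refine entered_eq_some.2 ⟨?_, by simp [h2]⟩
  obtain ⟨_ | j, p, _ | _⟩ := x <;> exact h1

lemma Path.whisker {X : List Slice} {x y : Pos} {vs : List Pos} (h : Path X x vs y) :
    Path (X.map (Slice.whisker l r)) (x.shift l.length) (vs.map (Pos.shift l.length))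
      (y.shift l.length) ∧
    ∀ ℓ : List (A × A), ((vs.map (Pos.shift l.length)).map
      (BiOriented.bead t (X.map (Slice.whisker l r)) ℓ)).prod =
        (vs.map (BiOriented.bead t X ℓ)).prod := by
  induction h with
  | nil x => exact ⟨.nil _, fun _ => rfl⟩
  | @cons x y z vs h hp ih =>
    simp only [step, Option.map_eq_some_iff] at h
    obtain ⟨⟨i, s⟩, h1, rfl⟩ := h
    have h2 := entered_whisker l r h1
    refine ⟨.cons ?_ ih.1, fun ℓ => ?_⟩
    · rw [step_of_entered h2]
      congr 1
      change exitPos i ((s.whisker l r).thru x.2.2 (l.length + x.2.1)) = _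
      rw [Slice.thru_whisker]
      rfl
    · rw [List.map_cons, List.map_cons, List.prod_cons, ih.2, List.map_cons, List.prod_cons,
        bead_of_entered t h1, bead_of_entered t h2]
      congr 1
      exact Slice.bead_whisker l r s _ _ _

/-- A strand that runs through a stack of slices without meeting any pieces, at the position `f i`
at level `i`. -/
lemma exists_path_straight (t : TraceRing θ τ B) {X : List Slice} (f : ℕ → ℕ)
    (hf : ∀ i s, X[i]? = some s → (s.thru .up (f i) = (.up, f (i + 1)) ∧ ¬ s.Hits .up (f i)) ∧
      (s.thru .down (f (i + 1)) = (.down, f i) ∧ ¬ s.Hits .down (f (i + 1)))) (d : Dir) {i : ℕ}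
    (hi : i ≤ X.length) :
    ∃ vs, Path X (i, f i, d) vs
        (exit X.length (d, f (match d with | .up => X.length | .down => 0))) ∧
      ∀ ℓ : List (A × A), (vs.map (bead t X ℓ)).prod = 1 := by
  cases d
  · obtain ⟨n, hn⟩ := Nat.exists_eq_add_of_le hi
    induction n generalizing i with
    | zero =>
      obtain rfl : X.length = i := hn
      exact ⟨[], .nil _, fun _ => rfl⟩
    | succ n ih =>
      obtain ⟨vs, hp, hw⟩ := ih (i := i + 1) (by lia) (by lia)
      have hs : X[i]? = some X[i] := List.getElem?_eq_getElem (by lia)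
      have he : entered X (i, f i, .up) = some (i, X[i]) := entered_eq_some.2 ⟨rfl, hs⟩
      obtain ⟨⟨h1, h2⟩, -⟩ := hf i _ hs
      refine ⟨(i, f i, .up) :: vs, .cons ?_ hp, fun ℓ => ?_⟩
      · rw [step_of_entered he, h1]
        rfl
      · rw [List.map_cons, List.prod_cons, hw, bead_of_entered t he, Slice.bead, if_neg h2,
          one_mul]
  · induction i with
    | zero => exact ⟨[], .nil _, fun _ => rfl⟩
    | succ i ih =>
      obtain ⟨vs, hp, hw⟩ := ih (by lia)
      have hs : X[i]? = some X[i] := List.getElem?_eq_getElem (by lia)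
      have he : entered X (i + 1, f (i + 1), .down) = some (i, X[i]) :=
        entered_eq_some.2 ⟨rfl, hs⟩
      obtain ⟨-, h1, h2⟩ := hf i _ hs
      refine ⟨(i + 1, f (i + 1), .down) :: vs, .cons ?_ hp, fun ℓ => ?_⟩
      · rw [step_of_entered he, h1]
        rfl
      · rw [List.map_cons, List.prod_cons, hw, bead_of_entered t he, Slice.bead, if_neg h2,
          one_mul]

variable {l r}

lemma Composable.whisker {u v : List Dir} {X : List Slice} (h : Composable u X v) :
    Composable (l ++ u ++ r) (X.map (Slice.whisker l r)) (l ++ v ++ r) := by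
  induction X generalizing u with
  | nil => exact congrArg (fun w => l ++ w ++ r) h
  | cons s X ih =>
    refine ⟨?_, ?_⟩
    · rw [← h.1]
      simp [Slice.whisker, Slice.src]
    · convert ih h.2 using 1
      simp [Slice.whisker, Slice.tgt]

lemma Composable.levelWord_whisker {u v : List Dir} {X : List Slice} (h : Composable u X v) {i : ℕ}
    (hi : i ≤ X.length) :
    levelWord (l ++ u ++ r) (X.map (Slice.whisker l r)) i = l ++ levelWord u X i ++ r := by
  induction X generalizing u i with
  | nil =>
    obtain rfl : i = 0 := by simpa using hi
    rfl
  | cons s X ih =>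
    rcases i with _ | i
    · rfl
    · have := ih h.2 (i := i) (by simpa using hi)
      rw [levelWord, ← this, List.map_cons, levelWord]
      congr 1
      simp [Slice.whisker, Slice.tgt]

lemma exists_path_left (t : TraceRing θ τ B) {X : List Slice} {p : ℕ} (hp : p < l.length) (d : Dir)
    {i : ℕ} (hi : i ≤ X.length) :
    ∃ vs, Path (X.map (Slice.whisker l r)) (i, p, d) vs (exit X.length (d, p)) ∧
      ∀ ℓ : List (A × A), (vs.map (bead t (X.map (Slice.whisker l r)) ℓ)).prod = 1 := by
  have := exists_path_straight t (X := X.map (Slice.whisker l r)) (fun _ => p)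
    (fun i s hs => ?_) d (i := i) (by simpa using hi)
  · simpa using this
  · simp only [List.getElem?_map, Option.map_eq_some_iff] at hs
    obtain ⟨s, -, rfl⟩ := hs
    have hlt : p < (s.whisker l r).left.length := by simp [Slice.whisker]; lia
    have hn (d : Dir) : ¬ (s.whisker l r).Hits d p := by rw [Slice.hits_iff]; lia
    exact ⟨⟨Slice.thru_of_lt hlt _, hn _⟩, Slice.thru_of_lt hlt _, hn _⟩

lemma exists_path_right (t : TraceRing θ τ B) {X : List Slice} {u v : List Dir}
    (h : Composable u X v) (q : ℕ) (d : Dir) {i : ℕ} (hi : i ≤ X.length) :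
    ∃ vs, Path (X.map (Slice.whisker l r)) (i, l.length + (levelWord u X i).length + q, d) vs
        (exit X.length (d, l.length + (portWord u v d.rev).length + q)) ∧
      ∀ ℓ : List (A × A), (vs.map (bead t (X.map (Slice.whisker l r)) ℓ)).prod = 1 := by
  have := exists_path_straight t (X := X.map (Slice.whisker l r))
    (fun i => l.length + (levelWord u X i).length + q) (fun i s hs => ?_) d (i := i)
    (by simpa using hi)
  · simp only [List.length_map] at this
    cases d
    · simpa only [h.levelWord_length, Dir.rev, portWord] using this
    · simpa only [levelWord_zero, Dir.rev, portWord] using this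
  · simp only [List.getElem?_map, Option.map_eq_some_iff] at hs
    obtain ⟨s, hs, rfl⟩ := hs
    have hlen (d : Dir) : l.length + (s.inWord d).length + q = (s.whisker l r).left.length +
        ((s.whisker l r).gen.inWord d).length + (s.right.length + q) := by
      rw [Slice.inWord_eq]
      simp [Slice.whisker]
      lia
    have h1 : l.length + (levelWord u X i).length + q = l.length + (s.inWord .up).length + q := by
      rw [(h.levelWord_eq hs).1]; rfl
    have h2 : l.length + (levelWord u X (i + 1)).length + q =
        l.length + (s.inWord .down).length + q := by
      rw [(h.levelWord_eq hs).2]; rfl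
    have hn (d : Dir) : ¬ (s.whisker l r).Hits d (l.length + (s.inWord d).length + q) := by
      rw [Slice.hits_iff, hlen]; lia
    have ht (d : Dir) : (s.whisker l r).thru d (l.length + (s.inWord d).length + q) =
        (d, l.length + (s.inWord d.rev).length + q) := by
      rw [hlen, Slice.thru_of_ge, ← hlen]
    rw [h1, h2]
    exact ⟨⟨ht _, hn _⟩, ht _, hn _⟩

/-- The matching of a tangle with additional vertical strands. -/
def whiskerMatching (l u v : List Dir) (π : Dir × ℕ → Dir × ℕ) (q : Dir × ℕ) : Dir × ℕ :=
  if q.2 < l.length then q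
  else if q.2 < l.length + (portWord u v q.1).length then
    ((π (q.1, q.2 - l.length)).1, l.length + (π (q.1, q.2 - l.length)).2)
  else (q.1, q.2 - (portWord u v q.1).length + (portWord u v q.1.rev).length)

/-- The beads on the strands of a tangle with additional vertical strands. -/
def whiskerBeads (l u v : List Dir) (w : Dir × ℕ → B) (q : Dir × ℕ) : B :=
  if l.length ≤ q.2 ∧ q.2 < l.length + (portWord u v q.1).length then w (q.1, q.2 - l.length)
  else 1

/-- The level at which strands directed `d` enter a stack of `m` slices. -/
def entranceLevel (m : ℕ) : Dir → ℕ
  | .up => 0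
  | .down => m

lemma entranceLevel_le (m : ℕ) (d : Dir) : entranceLevel m d ≤ m := by
  cases d <;> simp [entranceLevel]

lemma entrance_eq (m p : ℕ) (d : Dir) : entrance m (d, p) = (entranceLevel m d, p, d) := by
  cases d <;> rfl

lemma exit_shift (m n : ℕ) (q : Dir × ℕ) : (exit m q).shift n = exit m (q.1, n + q.2) := by
  rcases q with ⟨_ | _, p⟩ <;> rfl

lemma portWord_whisker (u v : List Dir) (d : Dir) :
    portWord (l ++ u ++ r) (l ++ v ++ r) d = l ++ portWord u v d ++ r := by cases d <;> rfl

/-- A position in a word between `l` and `r` is to the left, in the middle or to the right. -/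
lemma position_cases (l : List Dir) (m : List Dir) (p : ℕ) : p < l.length ∨
    (∃ q, q < m.length ∧ p = l.length + q) ∨ ∃ q, p = l.length + m.length + q := by
  rcases lt_or_ge p l.length with h | h
  · exact .inl h
  rcases lt_or_ge p (l.length + m.length) with h' | h'
  · exact .inr (.inl ⟨p - l.length, by lia, by lia⟩)
  · exact .inr (.inr ⟨p - (l.length + m.length), by lia⟩)

lemma IsTangle.whisker {X : List Slice} {u v : List Dir} {π : Dir × ℕ → Dir × ℕ}
    {W : List (A × A) → Dir × ℕ → B} (h : IsTangle t X u v π W) :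
    IsTangle t (X.map (Slice.whisker l r)) (l ++ u ++ r) (l ++ v ++ r) (whiskerMatching l u v π)
      (fun ℓ => whiskerBeads l u v (W ℓ)) := by
  refine ⟨h.composable.whisker, ?_, ?_⟩
  · rintro ⟨d, p⟩ hq
    simp only [portWord_whisker] at hq
    rw [List.length_map]
    rcases position_cases l (portWord u v d) p with hp | ⟨p, hp, rfl⟩ | ⟨p, rfl⟩
    · obtain ⟨vs, h1, h2⟩ := exists_path_left (l := l) (r := r) t (X := X) hp d
        (i := entranceLevel X.length d) (entranceLevel_le _ _)
      refine ⟨vs, ?_, fun ℓ _ => ?_⟩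
      · rwa [entrance_eq, whiskerMatching, if_pos hp]
      · rw [h2, whiskerBeads, if_neg (by simp; lia)]
    · rw [List.append_assoc, List.getElem?_append_right (by lia), Nat.add_sub_cancel_left,
        List.getElem?_append_left hp] at hq
      obtain ⟨vs, h1, h2⟩ := h.path (d, p) hq
      obtain ⟨h3, h4⟩ := h1.whisker l r (t := t)
      refine ⟨vs.map (Pos.shift l.length), ?_, fun ℓ hℓ => ?_⟩
      · rw [exit_shift] at h3
        rw [whiskerMatching, if_neg (by simp), if_pos (by simpa using hp)]
        simp only [Nat.add_sub_cancel_left]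
        convert h3 using 1
        cases d <;> rfl
      · rw [h4, h2 ℓ (by simpa using hℓ), whiskerBeads, if_pos (by simpa using hp)]
        simp
    · obtain ⟨vs, h1, h2⟩ := exists_path_right (l := l) (r := r) t h.composable p d
        (i := entranceLevel X.length d) (entranceLevel_le _ _)
      refine ⟨vs, ?_, fun ℓ _ => ?_⟩
      · rw [entrance_eq, whiskerMatching, if_neg (by simp; lia), if_neg (by simp)]
        have hw : levelWord u X (entranceLevel X.length d) = portWord u v d := by
          cases d
          · exact levelWord_zero _ _
          · exact h.composable.levelWord_length
        have hp : l.length + (portWord u v d).length + p - (portWord u v d).length +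
            (portWord u v d.rev).length = l.length + (portWord u v d.rev).length + p := by lia
        rw [hw] at h1
        simp only [hp]
        exact h1
      · rw [h2, whiskerBeads, if_neg (by simp)]
  · rintro ⟨i, p, d⟩ hx
    have hi : i ≤ X.length := by simpa using hx.le_length
    rw [Valid, h.composable.levelWord_whisker hi] at hx
    rw [List.length_map]
    rcases position_cases l (levelWord u X i) p with hp | ⟨p, hp, rfl⟩ | ⟨p, rfl⟩
    · obtain ⟨vs, h1, -⟩ := exists_path_left (l := l) (r := r) t hp d hi
      exact ⟨vs, _, h1⟩
    · simp only at hx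
      rw [List.append_assoc, List.getElem?_append_right (by lia), Nat.add_sub_cancel_left,
        List.getElem?_append_left hp] at hx
      obtain ⟨vs, q, h1⟩ := h.cover (i, p, d) hx
      have h2 := (h1.whisker l r (t := t)).1
      rw [exit_shift] at h2
      exact ⟨_, _, h2⟩
    · obtain ⟨vs, h1, -⟩ := exists_path_right (l := l) (r := r) t h.composable p d hi
      exact ⟨vs, _, h1⟩

end Whiskering

/-! ### Sums over labels -/

section Labels

variable {k A R : Type*} [CommRing k] [Ring A] [Algebra k A] [AddCommMonoid R]
  {ρ γ : (A ⊗[k] A)ˣ} (D U : A ≃ₐ[k] A) (P : Presentations ρ γ)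

/-- The beads, in the frame, on the strands `/` and `\` of a crossing in a given state. -/
def Gen.label : (g : Gen) → Fin (g.count P) → A × A
  | .cross c a b, n => (frame D a (slashBead U P c a b n), frame D b (backslashBead D P c a b n))
  | .cup _, _ => (1, 1)
  | .cap _, _ => (1, 1)

/-- The sum over all states of a stack of slices. -/
def labelSum : List Slice → (List (A × A) → R) → R
  | [], F => F []
  | s :: L, F => ∑ n, labelSum L fun ℓ => F (s.gen.label D U P n :: ℓ)

lemma labelSum_nil (F : List (A × A) → R) : labelSum D U P [] F = F [] := rfl

lemma labelSum_cross (l r : List Dir) (c : Crossing) (x y : Dir) (L : List Slice)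
    (F : List (A × A) → R) : labelSum D U P (⟨l, .cross c x y, r⟩ :: L) F =
      ∑ n, labelSum D U P L fun ℓ => F ((Gen.cross c x y).label D U P n :: ℓ) := rfl

lemma labelSum_cap (l r : List Dir) (o : Dir) (L : List Slice) (F : List (A × A) → R) :
    labelSum D U P (⟨l, .cap o, r⟩ :: L) F = labelSum D U P L fun ℓ => F ((1, 1) :: ℓ) :=
  Fin.sum_univ_one _

lemma labelSum_cup (l r : List Dir) (o : Dir) (L : List Slice) (F : List (A × A) → R) :
    labelSum D U P (⟨l, .cup o, r⟩ :: L) F = labelSum D U P L fun ℓ => F ((1, 1) :: ℓ) :=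
  Fin.sum_univ_one _

lemma labelSum_append (L M : List Slice) (F : List (A × A) → R) :
    labelSum D U P (L ++ M) F =
      labelSum D U P L fun a => labelSum D U P M fun b => F (a ++ b) := by
  induction L generalizing F with
  | nil => rfl
  | cons s L ih => simp only [List.cons_append, labelSum, ih]

lemma labelSum_congr {L : List Slice} {F F' : List (A × A) → R}
    (h : ∀ ℓ, ℓ.length = L.length → F ℓ = F' ℓ) : labelSum D U P L F = labelSum D U P L F' := by
  induction L generalizing F F' with
  | nil => exact h [] rfl
  | cons s L ih =>
    exact Finset.sum_congr rfl fun n _ => ih fun ℓ hℓ => h _ (by simp [hℓ])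

lemma labelSum_sum {ι : Type*} (T : Finset ι) (L : List Slice) (F : ι → List (A × A) → R) :
    labelSum D U P L (fun ℓ => ∑ i ∈ T, F i ℓ) = ∑ i ∈ T, labelSum D U P L (F i) := by
  induction L generalizing F with
  | nil => rfl
  | cons s L ih =>
    simp only [labelSum, ih]
    exact Finset.sum_comm

lemma labelSum_comm (P' : Presentations ρ γ) (L M : List Slice)
    (F : List (A × A) → List (A × A) → R) :
    labelSum D U P L (fun a => labelSum D U P' M fun b => F a b) =
      labelSum D U P' M fun b => labelSum D U P L fun a => F a b := by
  induction L generalizing F with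
  | nil => rfl
  | cons s L ih => simp only [labelSum, ih, labelSum_sum]

lemma labelSum_whisker (l r : List Dir) (L : List Slice) (F : List (A × A) → R) :
    labelSum D U P (L.map (Slice.whisker l r)) F = labelSum D U P L F := by
  induction L generalizing F with
  | nil => rfl
  | cons s L ih =>
    simp only [List.map_cons, labelSum, ih]
    rfl

end Labels

/-! ### Replacing a tangle by an equivalent one -/

section Replacement

variable {k A R B : Type*} [CommRing k] [Ring A] [Algebra k A] [CommRing R] [Algebra k R]
  [Ring B] [Algebra k B] {θ : A ≃ₐ[k] A} {τ : ℤ → A →ₗ[k] R} (t : TraceRing θ τ B)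
  {ρ γ : (A ⊗[k] A)ˣ} (D U : A ≃ₐ[k] A) (P P' : Presentations ρ γ)

variable (k) in
/-- The function `G` is linear in its argument `w q`. -/
def LinearIn {Q : Type*} [DecidableEq Q] (G : (Q → B) → R) (q : Q) : Prop :=
  ∀ w, ∃ φ : B →ₗ[k] R, ∀ x, G (Function.update w q x) = φ x

/-- Two tangles with the same boundary match it in the same way, and every function that is linear
in the beads on each strand has the same sum over the states of both tangles, formed with the
presentations `P` and `P'`. -/
def TangleEquiv (X Y : List Slice) : Prop :=
  ∃ (u v : List Dir) (π : Dir × ℕ → Dir × ℕ) (W W' : List (A × A) → Dir × ℕ → B),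
    IsTangle t X u v π W ∧ IsTangle t Y u v π W' ∧
    ∀ G : (Dir × ℕ → B) → R,
      (∀ q : Dir × ℕ, (portWord u v q.1)[q.2]? = some q.1 → LinearIn k G q) →
      labelSum D U P X (fun ℓ => G (W ℓ)) = labelSum D U P' Y fun ℓ => G (W' ℓ)

variable {t D U P P'}

lemma TangleEquiv.whisker {X Y : List Slice} (h : TangleEquiv t D U P P' X Y)
    (l r : List Dir) :
    TangleEquiv t D U P P' (X.map (Slice.whisker l r)) (Y.map (Slice.whisker l r)) := by
  obtain ⟨u, v, π, W, W', h1, h2, h3⟩ := h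
  refine ⟨_, _, _, _, _, h1.whisker, h2.whisker, fun G hG => ?_⟩
  rw [labelSum_whisker, labelSum_whisker]
  refine h3 (fun w => G (whiskerBeads l u v w)) fun q hq w => ?_
  have hlt := (List.getElem?_eq_some_iff.1 hq).1
  obtain ⟨φ, hφ⟩ := hG (q.1, l.length + q.2) (by
    simp only [portWord_whisker]
    rwa [List.append_assoc, List.getElem?_append_right (by lia), Nat.add_sub_cancel_left,
      List.getElem?_append_left hlt]) (whiskerBeads l u v w)
  refine ⟨φ, fun x => ?_⟩
  rw [← hφ]
  change G (whiskerBeads l u v (Function.update w q x)) = _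
  congr 1
  funext q'
  by_cases hq' : q' = (q.1, l.length + q.2)
  · subst hq'
    rw [Function.update_self, whiskerBeads, if_pos (by simpa using hlt)]
    simp
  · rw [Function.update_of_ne hq', whiskerBeads, whiskerBeads]
    split_ifs with hc
    · rw [Function.update_of_ne]
      rintro rfl
      refine hq' (Prod.ext rfl ?_)
      simp only
      lia
    · rfl

lemma Composable.ends_unique {u u' v v' : List Dir} {X : List Slice} (hX : X ≠ [])
    (h : Composable u X v) (h' : Composable u' X v') : u = u' ∧ v = v' := by
  have key {u v v' : List Dir} {X : List Slice} (h : Composable u X v) (h' : Composable u X v') :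
      v = v' := by
    induction X generalizing u with
    | nil => exact h.symm.trans h'
    | cons s X ih => exact ih h.2 h'.2
  rcases X with _ | ⟨s, X⟩
  · exact absurd rfl hX
  · exact ⟨h.1.symm.trans h'.1, key h.2 h'.2⟩

/-- Outside of a tangle, the product over the loops is a function of the beads on its strands that
is linear in each of them. -/
lemma IsTangle.loopProd_eq {pre X post : List Slice} {u v : List Dir} {π : Dir × ℕ → Dir × ℕ}
    {W : List (A × A) → Dir × ℕ → B} (hX : IsTangle t X u v π W) (hpre : Composable [] pre u)
    (hpost : Composable v post []) {S₀ S : Finset Pos}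
    (hS₀ : IsTransversal (outerFollow pre post π) {x | OuterValid pre post u v x} S₀)
    (hS : IsTransversal (follow (pre ++ X ++ post)) {x | Valid [] (pre ++ X ++ post) x} S)
    {a b c : List (A × A)} (ha : a.length = pre.length) (hb : b.length = X.length) :
    loopProd t.trace (follow (pre ++ X ++ post)) (bead t (pre ++ X ++ post) (a ++ b ++ c)) S =
      loopProd t.trace (outerFollow pre post π) (outerBead t pre post π (a ++ c) (W b)) S₀ := by
  obtain ⟨n, hn, hw⟩ := hX.isFirstReturn hpre hpost
  rw [loopProd_eq_of_isTransversal t.trace_mul_comm hn.periodic _ hS (hn.isTransversal hS₀)]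
  exact hn.loopProd_image (hw a b c ha hb) _ hS₀

lemma linearIn_outer {pre post : List Slice} {u v : List Dir} {π : Dir × ℕ → Dir × ℕ}
    (hper : {x | OuterValid pre post u v x} ⊆ Function.periodicPts (outerFollow pre post π))
    {S₀ : Finset Pos}
    (hS₀ : IsTransversal (outerFollow pre post π) {x | OuterValid pre post u v x} S₀)
    (ℓ : List (A × A)) (q : Dir × ℕ) (hq : (portWord u v q.1)[q.2]? = some q.1) :
    LinearIn k (fun w => loopProd t.trace (outerFollow pre post π)
      (outerBead t pre post π ℓ w) S₀) q := by
  intro w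
  have hmem : ((pre.length, q.2, q.1) : Pos) ∈ {x | OuterValid pre post u v x} := by
    simpa [OuterValid] using hq
  obtain ⟨φ, hφ⟩ := loopProd_update t.trace_mul_comm hper hS₀ hmem (outerBead t pre post π ℓ w)
  refine ⟨φ ∘ₗ LinearMap.mulRight k
    (bead t (pre ++ post) ℓ (twist pre.length π (pre.length, q.2, q.1))), fun x => ?_⟩
  rw [LinearMap.comp_apply, ← hφ]
  change loopProd t.trace _ (outerBead t pre post π ℓ (Function.update w q x)) S₀ = _
  congr 1
  funext y
  by_cases hy : y = (pre.length, q.2, q.1)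
  · subst hy
    simp [outerBead]
  · rw [Function.update_of_ne hy, outerBead, outerBead]
    congr 1
    split_ifs with h
    · rw [Function.update_of_ne]
      rintro rfl
      exact hy (by rw [← h])
    · rfl

/-- The sum over the states of a tangle, for fixed labels outside of it, of the products over the
loops does not change when the tangle is replaced by an equivalent one. -/
theorem TangleEquiv.labelSum_inner {pre X Y post : List Slice} (h : TangleEquiv t D U P P' X Y)
    (hne : X ≠ []) (hK : Composable [] (pre ++ X ++ post) []) {S S' : Finset Pos}
    (hS : IsTransversal (follow (pre ++ X ++ post)) {x | Valid [] (pre ++ X ++ post) x} S)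
    (hS' : IsTransversal (follow (pre ++ Y ++ post)) {x | Valid [] (pre ++ Y ++ post) x} S')
    {a : List (A × A)} (ha : a.length = pre.length) (c : List (A × A)) :
    labelSum D U P X (fun b => loopProd t.trace (follow (pre ++ X ++ post))
        (bead t (pre ++ X ++ post) (a ++ b ++ c)) S) =
      labelSum D U P' Y fun b => loopProd t.trace (follow (pre ++ Y ++ post))
        (bead t (pre ++ Y ++ post) (a ++ b ++ c)) S' := by
  obtain ⟨u, v, π, W, W', hX, hY, hG⟩ := h
  obtain ⟨v', hK', hpost⟩ := composable_append.1 hK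
  obtain ⟨u', hpre, hX'⟩ := composable_append.1 hK'
  obtain ⟨rfl, rfl⟩ := Composable.ends_unique hne hX.composable hX'
  obtain ⟨n, hn, -⟩ := hX.isFirstReturn hpre hpost
  have hfin : {x | OuterValid pre post u v x}.Finite :=
    Set.Finite.of_injOn (f := gapIn pre.length X.length) (t := {x | Valid [] (pre ++ X ++ post) x})
      (fun x hx => hn.mapsTo x hx) (gapIn_injective _ _).injOn (finite_valid _ _)
  obtain ⟨S₀, hS₀, -⟩ := exists_isTransversal hfin hn.periodic_return hn.invariant (fun _ => True)
    fun _ _ => ⟨0, trivial⟩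
  rw [labelSum_congr D U P fun b hb => hX.loopProd_eq hpre hpost hS₀ hS ha hb,
    labelSum_congr D U P' fun b hb => hY.loopProd_eq hpre hpost hS₀ hS' ha hb]
  exact hG _ (linearIn_outer hn.periodic_return hS₀ _)

/-- The sum over all states of the products over the loops does not change when a tangle is replaced
by an equivalent one. -/
theorem TangleEquiv.labelSum_eq {pre X Y post : List Slice} (h : TangleEquiv t D U P P X Y)
    (hne : X ≠ []) (hK : Composable [] (pre ++ X ++ post) []) {S S' : Finset Pos}
    (hS : IsTransversal (follow (pre ++ X ++ post)) {x | Valid [] (pre ++ X ++ post) x} S)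
    (hS' : IsTransversal (follow (pre ++ Y ++ post)) {x | Valid [] (pre ++ Y ++ post) x} S') :
    labelSum D U P (pre ++ X ++ post) (fun ℓ => loopProd t.trace (follow (pre ++ X ++ post))
        (bead t (pre ++ X ++ post) ℓ) S) =
      labelSum D U P (pre ++ Y ++ post) fun ℓ => loopProd t.trace (follow (pre ++ Y ++ post))
        (bead t (pre ++ Y ++ post) ℓ) S' := by
  simp only [labelSum_append]
  refine labelSum_congr _ _ _ fun a ha => ?_
  rw [labelSum_comm, labelSum_comm _ _ _ _ Y]
  exact labelSum_congr _ _ _ fun c _ => h.labelSum_inner hne hK hS hS' ha c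

end Replacement

/-! ### Tangles given by explicit stacks of slices -/

section Explicit

variable {k A R B : Type*} [CommRing k] [Ring A] [Algebra k A] [CommRing R] [Algebra k R]
  [Ring B] [Algebra k B] {θ : A ≃ₐ[k] A} {τ : ℤ → A →ₗ[k] R} (t : TraceRing θ τ B)

/-- A passage of a strand through a piece: the index of the slice, the piece, and whether the strand
`/` of a crossing is followed. -/
abbrev Visit := ℕ × Gen × Bool

/-- The bead met on a passage. -/
def visitBead (ℓ : List (A × A)) (v : Visit) : B := v.2.1.bead t (ℓ.getD v.1 (1, 1)) (v.2.2 = true)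

/-- The product of the beads met on a sequence of passages. -/
def visitWord (ℓ : List (A × A)) (w : List Visit) : B := (w.map (visitBead t ℓ)).prod

/-- The point reached from `x` after at most `n` slices. -/
def run (X : List Slice) : ℕ → Pos → Pos
  | 0, x => x
  | n + 1, x =>
    match entered X x with
    | some (i, s) => run X n (exitPos i (s.thru x.2.2 x.2.1))
    | none => x

/-- The passages on the way from `x` through at most `n` slices. -/
def visits (X : List Slice) : ℕ → Pos → List Visit
  | 0, _ => []
  | n + 1, x =>
    match entered X x with
    | some (i, s) =>
      if s.Hits x.2.2 x.2.1 then
        (i, s.gen, decide (x.2.2 = .up ↔ x.2.1 = s.left.length)) ::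
          visits X n (exitPos i (s.thru x.2.2 x.2.1))
      else visits X n (exitPos i (s.thru x.2.2 x.2.1))
    | none => []

lemma Gen.bead_congr (g : Gen) (ab : A × A) {p q : Prop} [Decidable p] [Decidable q] (h : p ↔ q) :
    g.bead t ab p = g.bead t ab q := by
  obtain rfl := propext h
  congr

lemma exists_path_run (X : List Slice) (n : ℕ) (x : Pos) : ∃ vs, Path X x vs (run X n x) ∧
    ∀ ℓ : List (A × A), (vs.map (bead t X ℓ)).prod = visitWord t ℓ (visits X n x) := by
  induction n generalizing x with
  | zero => exact ⟨[], .nil x, fun _ => rfl⟩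
  | succ n ih =>
    rcases h : entered X x with _ | ⟨i, s⟩
    · simp only [run, visits, h]
      exact ⟨[], .nil x, fun _ => rfl⟩
    · obtain ⟨vs, h1, h2⟩ := ih (exitPos i (s.thru x.2.2 x.2.1))
      simp only [run, visits, h]
      refine ⟨x :: vs, .cons (step_of_entered h) h1, fun ℓ => ?_⟩
      rw [List.map_cons, List.prod_cons, h2, bead_of_entered t h, Slice.bead]
      split_ifs
      · rw [visitWord, visitWord, List.map_cons, List.prod_cons]
        congr 1
        exact Gen.bead_congr t _ _ (by simp)
      · rw [one_mul]

lemma Path.valid {X : List Slice} {u v : List Dir} (hX : Composable u X v) {x y : Pos}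
    {vs : List Pos} (h : Path X x vs y) (hx : Valid u X x) : Valid u X y := by
  induction h with
  | nil => exact hx
  | cons h _ ih => exact ih (hX.valid_step hx h)

lemma exists_exit {X : List Slice} {u : List Dir} {x : Pos} (hx : Valid u X x)
    (h : entered X x = none) : ∃ q, x = exit X.length q := by
  obtain ⟨i, p, d⟩ := x
  rcases hx.step_cases with ⟨y, hy⟩ | ⟨rfl, rfl⟩ | ⟨rfl, rfl⟩
  · rw [step, h] at hy
    cases hy
  · exact ⟨(.down, p), rfl⟩
  · exact ⟨(.up, p), rfl⟩

variable {t}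

/-- For an explicit stack of slices the properties of a tangle can be checked by following its
strands for sufficiently many steps. The lists `up` and `down` contain, for the positions at the
bottom and at the top, where a strand entering there leaves and which passages it makes. -/
lemma isTangle_of_run {X : List Slice} {u v : List Dir} {π : Dir × ℕ → Dir × ℕ}
    {w : Dir × ℕ → List Visit} (n : ℕ) (up down : List ((Dir × ℕ) × List Visit))
    (hX : Composable u X v)
    (hend : ((List.range (X.length + 1)).all fun i => (List.range (levelWord u X i).length).all
      fun p => [Dir.up, Dir.down].all fun d => (entered X (run X n (i, p, d))).isNone) = true)
    (hup : (List.range u.length).map (fun p => (run X n (0, p, .up), visits X n (0, p, .up))) =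
      up.map fun y => (exit X.length y.1, y.2))
    (hdown : (List.range v.length).map
      (fun p => (run X n (X.length, p, .down), visits X n (X.length, p, .down))) =
        down.map fun y => (exit X.length y.1, y.2))
    (hw : ∀ d p, (portWord u v d)[p]? = some d →
      (match d with | .up => up | .down => down)[p]? = some (π (d, p), w (d, p))) :
    IsTangle t X u v π fun ℓ q => visitWord t ℓ (w q) := by
  have hrun (q : Dir × ℕ) (hq : (portWord u v q.1)[q.2]? = some q.1) :
      run X n (entrance X.length q) = exit X.length (π q) ∧
        visits X n (entrance X.length q) = w q := by
    have h1 := hw q.1 q.2 hq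
    have h2 := (List.getElem?_eq_some_iff.1 hq).1
    rcases q with ⟨_ | _, p⟩
    · have h3 := congrArg (fun L => L[p]?) hup
      have h2 : p < u.length := h2
      simp only [List.getElem?_map, h1, List.getElem?_range h2, Option.map_some, Option.some.injEq,
        Prod.mk.injEq] at h3
      exact h3
    · have h3 := congrArg (fun L => L[p]?) hdown
      have h2 : p < v.length := h2
      simp only [List.getElem?_map, h1, List.getElem?_range h2, Option.map_some, Option.some.injEq,
        Prod.mk.injEq] at h3
      exact h3
  refine ⟨hX, fun q hq => ?_, fun x hx => ?_⟩
  · obtain ⟨vs, h1, h2⟩ := exists_path_run t X n (entrance X.length q)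
    rw [(hrun q hq).1] at h1
    exact ⟨vs, h1, fun ℓ _ => by rw [h2, (hrun q hq).2]⟩
  · obtain ⟨vs, h1, -⟩ := exists_path_run t X n x
    simp only [List.all_eq_true, List.mem_range, Option.isNone_iff_eq_none] at hend
    obtain ⟨q, hq⟩ := exists_exit (h1.valid hX hx) (hend x.1 (Nat.lt_succ_of_le hx.le_length) x.2.1
      (List.getElem?_eq_some_iff.1 hx).1 x.2.2 (by rcases x.2.2 with _ | _ <;> simp))
    exact ⟨vs, q, hq ▸ h1⟩

lemma isTangle_nil (u : List Dir) : IsTangle t [] u u id fun _ _ => 1 := by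
  refine ⟨rfl, fun q _ => ⟨[], ?_, fun _ _ => rfl⟩, fun x hx => ?_⟩
  · rcases q with ⟨_ | _, p⟩ <;> exact .nil _
  · obtain ⟨_ | i, p, d⟩ := x
    · exact ⟨[], (d, p), by cases d <;> exact .nil _⟩
    · simp [Valid, levelWord] at hx

end Explicit

section LocalTangles

variable {k A R B : Type*} [CommRing k] [Ring A] [Algebra k A] [CommRing R] [Algebra k R]
  [Ring B] [Algebra k B] {θ : A ≃ₐ[k] A} {τ : ℤ → A →ₗ[k] R} {t : TraceRing θ τ B}

/-- The port at which a strand directed `d` enters a tangle, if its lower end is at the bottom in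
position `p` and its upper end is at the top in position `p'`. -/
def port (p p' : ℕ) : Dir → Dir × ℕ
  | .up => (.up, p)
  | .down => (.down, p')

/-- The list `w` in the order in which it is met on a strand directed `d`. -/
def ordered (d : Dir) (w : List Visit) : List Visit :=
  match d with
  | .up => w
  | .down => w.reverse

lemma isTangle_zigzagRight (o : Dir) : IsTangle t
    [⟨[o], .cup o.rev, []⟩, ⟨[], .cap o, [o]⟩] [o] [o] id fun ℓ q => visitWord t ℓ
      (Function.update (fun _ => []) (port 0 0 o)
        (ordered o [(1, .cap o, o = .up), (0, .cup o.rev, o = .down)]) q) := by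
  refine isTangle_of_run 4 [((.up, 0), [(1, .cap o, true), (0, .cup o.rev, false)])]
    [((.down, 0), [(0, .cup o.rev, true), (1, .cap o, false)])]
    ⟨rfl, by cases o <;> rfl, by cases o <;> rfl⟩ rfl rfl rfl ?_
  cases o <;> rintro (_ | _) (_ | p) h <;> first | (cases h; done) | rfl

lemma isTangle_zigzagLeft (o : Dir) : IsTangle t
    [⟨[], .cup o, [o]⟩, ⟨[o], .cap o.rev, []⟩] [o] [o] id fun ℓ q => visitWord t ℓ
      (Function.update (fun _ => []) (port 0 0 o)
        (ordered o [(1, .cap o.rev, o = .down), (0, .cup o, o = .up)]) q) := by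
  refine isTangle_of_run 4 [((.up, 0), [(1, .cap o.rev, false), (0, .cup o, true)])]
    [((.down, 0), [(0, .cup o, false), (1, .cap o.rev, true)])]
    ⟨rfl, by cases o <;> rfl, by cases o <;> rfl⟩ rfl rfl rfl ?_
  cases o <;> rintro (_ | _) (_ | p) h <;> first | (cases h; done) | rfl

lemma isTangle_cross (c : Crossing) (x y : Dir) : IsTangle t
    [⟨[], .cross c x y, []⟩] [x, y] [y, x] (fun q => (q.1, 1 - q.2)) fun ℓ q => visitWord t ℓ
      (Function.update (Function.update (fun _ => [])
        (port 0 1 x) [(0, .cross c x y, true)]) (port 1 0 y) [(0, .cross c x y, false)] q) := by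
  refine isTangle_of_run 1
    [((.up, 1), [(0, .cross c x y, true)]), ((.up, 0), [(0, .cross c x y, false)])]
    [((.down, 1), [(0, .cross c x y, false)]), ((.down, 0), [(0, .cross c x y, true)])]
    ⟨rfl, rfl⟩ rfl rfl rfl ?_
  cases x <;> cases y <;> rintro (_ | _) (_ | _ | p) h <;> first | (cases h; done) | rfl

lemma isTangle_typeTwo (c c' : Crossing) (x y : Dir) : IsTangle t
    [⟨[], .cross c x y, []⟩, ⟨[], .cross c' y x, []⟩] [x, y] [x, y] id fun ℓ q => visitWord t ℓ
      (Function.update (Function.update (fun _ => [])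
        (port 0 0 x) (ordered x [(0, .cross c x y, true), (1, .cross c' y x, false)]))
        (port 1 1 y) (ordered y [(0, .cross c x y, false), (1, .cross c' y x, true)]) q) := by
  refine isTangle_of_run 2
    [((.up, 0), [(0, .cross c x y, true), (1, .cross c' y x, false)]),
      ((.up, 1), [(0, .cross c x y, false), (1, .cross c' y x, true)])]
    [((.down, 0), [(1, .cross c' y x, false), (0, .cross c x y, true)]),
      ((.down, 1), [(1, .cross c' y x, true), (0, .cross c x y, false)])]
    ⟨rfl, rfl, rfl⟩ rfl rfl rfl ?_
  cases x <;> cases y <;> rintro (_ | _) (_ | _ | p) h <;> first | (cases h; done) | rfl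

lemma isTangle_typeThree_left (c12 c13 c23 : Crossing) (x y z : Dir) : IsTangle t
    [⟨[], .cross c12 x y, [z]⟩, ⟨[y], .cross c13 x z, []⟩, ⟨[], .cross c23 y z, [x]⟩]
    [x, y, z] [z, y, x] (fun q => (q.1, 2 - q.2)) fun ℓ q => visitWord t ℓ
      (Function.update (Function.update (Function.update (fun _ => [])
        (port 0 2 x) (ordered x [(0, .cross c12 x y, true), (1, .cross c13 x z, true)]))
        (port 1 1 y) (ordered y [(0, .cross c12 x y, false), (2, .cross c23 y z, true)]))
        (port 2 0 z) (ordered z [(1, .cross c13 x z, false), (2, .cross c23 y z, false)]) q) := by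
  refine isTangle_of_run 3
    [((.up, 2), [(0, .cross c12 x y, true), (1, .cross c13 x z, true)]),
      ((.up, 1), [(0, .cross c12 x y, false), (2, .cross c23 y z, true)]),
      ((.up, 0), [(1, .cross c13 x z, false), (2, .cross c23 y z, false)])]
    [((.down, 2), [(2, .cross c23 y z, false), (1, .cross c13 x z, false)]),
      ((.down, 1), [(2, .cross c23 y z, true), (0, .cross c12 x y, false)]),
      ((.down, 0), [(1, .cross c13 x z, true), (0, .cross c12 x y, true)])]
    ⟨rfl, rfl, rfl, rfl⟩ rfl rfl rfl ?_
  cases x <;> cases y <;> cases z <;> rintro (_ | _) (_ | _ | _ | p) h <;>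
    first | (cases h; done) | rfl

lemma isTangle_typeThree_right (c12 c13 c23 : Crossing) (x y z : Dir) : IsTangle t
    [⟨[x], .cross c23 y z, []⟩, ⟨[], .cross c13 x z, [y]⟩, ⟨[z], .cross c12 x y, []⟩]
    [x, y, z] [z, y, x] (fun q => (q.1, 2 - q.2)) fun ℓ q => visitWord t ℓ
      (Function.update (Function.update (Function.update (fun _ => [])
        (port 0 2 x) (ordered x [(1, .cross c13 x z, true), (2, .cross c12 x y, true)]))
        (port 1 1 y) (ordered y [(0, .cross c23 y z, true), (2, .cross c12 x y, false)]))
        (port 2 0 z) (ordered z [(0, .cross c23 y z, false), (1, .cross c13 x z, false)]) q) := by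
  refine isTangle_of_run 3
    [((.up, 2), [(1, .cross c13 x z, true), (2, .cross c12 x y, true)]),
      ((.up, 1), [(0, .cross c23 y z, true), (2, .cross c12 x y, false)]),
      ((.up, 0), [(0, .cross c23 y z, false), (1, .cross c13 x z, false)])]
    [((.down, 2), [(1, .cross c13 x z, false), (0, .cross c23 y z, false)]),
      ((.down, 1), [(2, .cross c12 x y, false), (0, .cross c23 y z, true)]),
      ((.down, 0), [(2, .cross c12 x y, true), (1, .cross c13 x z, true)])]
    ⟨rfl, rfl, rfl, rfl⟩ rfl rfl rfl ?_
  cases x <;> cases y <;> cases z <;> rintro (_ | _) (_ | _ | _ | p) h <;>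
    first | (cases h; done) | rfl

/-- The port at which the strand of a maximum with left leg directed `x` enters a tangle, if its
legs end at the bottom in positions `0` and `2`. -/
def capPort : Dir → Dir × ℕ
  | .up => (.up, 0)
  | .down => (.up, 2)

/-- The port at which the strand of a minimum with left leg directed `x` enters a tangle, if its
legs end at the top in positions `0` and `2`. -/
def cupPort : Dir → Dir × ℕ
  | .up => (.down, 2)
  | .down => (.down, 0)

/-- The matching of a tangle that consists of a maximum with legs at `0` and `2` and of a strand
leading from bottom to top. -/
def capMatching : Dir × ℕ → Dir × ℕ
  | (.up, 1) => (.up, 0)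
  | (.up, p) => (.down, 2 - p)
  | (.down, _) => (.down, 1)

/-- The matching of a tangle that consists of a minimum with legs at `0` and `2` and of a strand
leading from bottom to top. -/
def cupMatching : Dir × ℕ → Dir × ℕ
  | (.down, 1) => (.down, 0)
  | (.down, p) => (.up, 2 - p)
  | (.up, _) => (.up, 1)

lemma isTangle_capSlide_left (c : Crossing) (x y : Dir) : IsTangle t
    [⟨[], .cross c x y, [x.rev]⟩, ⟨[y], .cap x, []⟩] [x, y, x.rev] [y] capMatching
      fun ℓ q => visitWord t ℓ (Function.update (Function.update (fun _ => [])
        (capPort x) (ordered x [(0, .cross c x y, true), (1, .cap x, x = .up)]))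
        (port 1 0 y) [(0, .cross c x y, false)] q) := by
  refine isTangle_of_run 4
    [((.down, 2), [(0, .cross c x y, true), (1, .cap x, true)]),
      ((.up, 0), [(0, .cross c x y, false)]),
      ((.down, 0), [(1, .cap x, false), (0, .cross c x y, true)])]
    [((.down, 1), [(0, .cross c x y, false)])] ⟨rfl, rfl, rfl⟩ rfl rfl rfl ?_
  cases x <;> cases y <;> rintro (_ | _) (_ | _ | _ | p) h <;> first | (cases h; done) | rfl

lemma isTangle_capSlide_right (c : Crossing) (x y : Dir) : IsTangle t
    [⟨[x], .cross c y x.rev, []⟩, ⟨[], .cap x, [y]⟩] [x, y, x.rev] [y] capMatching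
      fun ℓ q => visitWord t ℓ (Function.update (Function.update (fun _ => [])
        (capPort x) (ordered x [(1, .cap x, x = .up), (0, .cross c y x.rev, false)]))
        (port 1 0 y) [(0, .cross c y x.rev, true)] q) := by
  refine isTangle_of_run 4
    [((.down, 2), [(1, .cap x, true), (0, .cross c y x.rev, false)]),
      ((.up, 0), [(0, .cross c y x.rev, true)]),
      ((.down, 0), [(0, .cross c y x.rev, false), (1, .cap x, false)])]
    [((.down, 1), [(0, .cross c y x.rev, true)])] ⟨rfl, rfl, rfl⟩ rfl rfl rfl ?_
  cases x <;> cases y <;> rintro (_ | _) (_ | _ | _ | p) h <;> first | (cases h; done) | rfl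

lemma isTangle_cupSlide_left (c : Crossing) (x y : Dir) : IsTangle t
    [⟨[y], .cup x, []⟩, ⟨[], .cross c y x, [x.rev]⟩] [y] [x, y, x.rev] cupMatching
      fun ℓ q => visitWord t ℓ (Function.update (Function.update (fun _ => [])
        (cupPort x) (ordered x [(0, .cup x, x = .up), (1, .cross c y x, false)]))
        (port 0 1 y) [(1, .cross c y x, true)] q) := by
  refine isTangle_of_run 4 [((.up, 1), [(1, .cross c y x, true)])]
    [((.up, 2), [(1, .cross c y x, false), (0, .cup x, false)]),
      ((.down, 0), [(1, .cross c y x, true)]),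
      ((.up, 0), [(0, .cup x, true), (1, .cross c y x, false)])] ⟨rfl, rfl, rfl⟩ rfl rfl rfl ?_
  cases x <;> cases y <;> rintro (_ | _) (_ | _ | _ | p) h <;> first | (cases h; done) | rfl

lemma isTangle_cupSlide_right (c : Crossing) (x y : Dir) : IsTangle t
    [⟨[], .cup x, [y]⟩, ⟨[x], .cross c x.rev y, []⟩] [y] [x, y, x.rev] cupMatching
      fun ℓ q => visitWord t ℓ (Function.update (Function.update (fun _ => [])
        (cupPort x) (ordered x [(1, .cross c x.rev y, true), (0, .cup x, x = .up)]))
        (port 0 1 y) [(1, .cross c x.rev y, false)] q) := by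
  refine isTangle_of_run 4 [((.up, 1), [(1, .cross c x.rev y, false)])]
    [((.up, 2), [(0, .cup x, false), (1, .cross c x.rev y, true)]),
      ((.down, 0), [(1, .cross c x.rev y, false)]),
      ((.up, 0), [(1, .cross c x.rev y, true), (0, .cup x, true)])] ⟨rfl, rfl, rfl⟩ rfl rfl rfl ?_
  cases x <;> cases y <;> rintro (_ | _) (_ | _ | _ | p) h <;> first | (cases h; done) | rfl

end LocalTangles

/-! ### Exchanging two distant pieces -/

section Exchange

variable {k A R B : Type*} [CommRing k] [Ring A] [Algebra k A] [CommRing R] [Algebra k R]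
  [Ring B] [Algebra k B] {θ : A ≃ₐ[k] A} {τ : ℤ → A →ₗ[k] R} (t : TraceRing θ τ B)

/-- A strand directed `d` that enters a slice in position `p` passes beside the piece and leaves in
position `p'`. -/
def Slice.Straight (s : Slice) (d : Dir) (p p' : ℕ) : Prop := s.thru d p = (d, p') ∧ ¬ s.Hits d p

lemma Slice.straight_left {s : Slice} {p : ℕ} (h : p < s.left.length) (d : Dir) :
    s.Straight d p p :=
  ⟨thru_of_lt h d, by rw [Slice.hits_iff]; lia⟩

lemma Slice.straight_right (s : Slice) (d : Dir) (q : ℕ) :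
    s.Straight d (s.left.length + (s.gen.inWord d).length + q)
      (s.left.length + (s.gen.inWord d.rev).length + q) :=
  ⟨thru_of_ge s d q, by rw [Slice.hits_iff]; lia⟩

lemma Slice.bead_of_not_hits {s : Slice} {d : Dir} {p : ℕ} (h : ¬ s.Hits d p) (ab : A × A) :
    s.bead t ab d p = 1 := if_neg h

lemma Slice.bead_of_hits {s : Slice} {d : Dir} {q : ℕ} (h : q < (s.gen.inWord d).length)
    (ab : A × A) : s.bead t ab d (s.left.length + q) = s.gen.bead t ab (d = .up ↔ q = 0) := by
  rw [Slice.bead, if_pos (by rw [Slice.hits_iff]; lia)]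
  exact Gen.bead_congr t _ _ (by simp)

section TwoSlices

variable {s₀ s₁ : Slice}

/-- A strand that leaves the upper one of two slices passes straight through the lower one if it is
directed down. -/
def LeavesUpper (s₀ : Slice) (y : Dir × ℕ) (p' : ℕ) : Prop :=
  match y with
  | (.up, p) => p = p'
  | (.down, p) => s₀.Straight .down p p'

/-- A strand that leaves the lower one of two slices passes straight through the upper one if it is
directed up. -/
def LeavesLower (s₁ : Slice) (y : Dir × ℕ) (p' : ℕ) : Prop :=
  match y with
  | (.up, p) => s₁.Straight .up p p'
  | (.down, p) => p = p'

lemma LeavesUpper.exists_path {y : Dir × ℕ} {p' : ℕ} (h : LeavesUpper s₀ y p') :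
    ∃ vs, Path [s₀, s₁] (exitPos 1 y) vs (exit 2 (y.1, p')) ∧
      ∀ ℓ : List (A × A), (vs.map (bead t [s₀, s₁] ℓ)).prod = 1 := by
  rcases y with ⟨_ | _, p⟩
  · obtain rfl : p = p' := h
    exact ⟨[], .nil _, fun _ => rfl⟩
  · obtain ⟨h1, h2⟩ : s₀.Straight .down p p' := h
    have he : entered [s₀, s₁] (1, p, .down) = some (0, s₀) := rfl
    refine ⟨[(1, p, .down)], .cons ((step_of_entered he).trans ?_) (.nil _), fun ℓ => ?_⟩
    · rw [h1]
      rfl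
    · rw [List.map_singleton, List.prod_singleton, bead_of_entered t he,
        Slice.bead_of_not_hits t h2]

lemma LeavesLower.exists_path {y : Dir × ℕ} {p' : ℕ} (h : LeavesLower s₁ y p') :
    ∃ vs, Path [s₀, s₁] (exitPos 0 y) vs (exit 2 (y.1, p')) ∧
      ∀ ℓ : List (A × A), (vs.map (bead t [s₀, s₁] ℓ)).prod = 1 := by
  rcases y with ⟨_ | _, p⟩
  · obtain ⟨h1, h2⟩ : s₁.Straight .up p p' := h
    have he : entered [s₀, s₁] (1, p, .up) = some (1, s₁) := rfl
    refine ⟨[(1, p, .up)], .cons ((step_of_entered he).trans ?_) (.nil _), fun ℓ => ?_⟩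
    · rw [h1]
      rfl
    · rw [List.map_singleton, List.prod_singleton, bead_of_entered t he,
        Slice.bead_of_not_hits t h2]
  · obtain rfl : p = p' := h
    exact ⟨[], .nil _, fun _ => rfl⟩

/-- A strand that enters a stack of two slices passes straight through the upper one before it
enters the lower one in position `p₀`, if it is directed down. -/
def EntersLower (s₁ : Slice) (x : Dir × ℕ) (p₀ : ℕ) : Prop :=
  match x with
  | (.up, p) => p = p₀
  | (.down, p) => s₁.Straight .down p p₀

/-- A strand that enters a stack of two slices passes straight through the lower one before it
enters the upper one in position `p₁`, if it is directed up. -/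
def EntersUpper (s₀ : Slice) (x : Dir × ℕ) (p₁ : ℕ) : Prop :=
  match x with
  | (.up, p) => s₀.Straight .up p p₁
  | (.down, p) => p = p₁

lemma exists_path_lower {x : Dir × ℕ} {p₀ p' : ℕ} (hin : EntersLower s₁ x p₀)
    (hout : LeavesLower s₁ (s₀.thru x.1 p₀) p') :
    ∃ vs, Path [s₀, s₁] (entrance 2 x) vs (exit 2 ((s₀.thru x.1 p₀).1, p')) ∧
      ∀ ℓ : List (A × A),
        (vs.map (bead t [s₀, s₁] ℓ)).prod = s₀.bead t (ℓ.getD 0 (1, 1)) x.1 p₀ := by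
  obtain ⟨vs, h1, h2⟩ := hout.exists_path t (s₀ := s₀)
  rcases x with ⟨_ | _, p⟩
  · obtain rfl : p = p₀ := hin
    have he : entered [s₀, s₁] (0, p, .up) = some (0, s₀) := rfl
    refine ⟨(0, p, .up) :: vs, .cons (step_of_entered he) h1, fun ℓ => ?_⟩
    rw [List.map_cons, List.prod_cons, h2, bead_of_entered t he, mul_one]
  · obtain ⟨h3, h4⟩ : s₁.Straight .down p p₀ := hin
    have he : entered [s₀, s₁] (2, p, .down) = some (1, s₁) := rfl
    have he' : entered [s₀, s₁] (1, p₀, .down) = some (0, s₀) := rfl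
    refine ⟨(2, p, .down) :: (1, p₀, .down) :: vs,
      .cons ((step_of_entered he).trans ?_) (.cons (step_of_entered he') h1), fun ℓ => ?_⟩
    · rw [h3]
      rfl
    · rw [List.map_cons, List.prod_cons, List.map_cons, List.prod_cons, h2, bead_of_entered t he,
        bead_of_entered t he', Slice.bead_of_not_hits t h4, mul_one, one_mul]

lemma exists_path_upper {x : Dir × ℕ} {p₁ p' : ℕ} (hin : EntersUpper s₀ x p₁)
    (hout : LeavesUpper s₀ (s₁.thru x.1 p₁) p') :
    ∃ vs, Path [s₀, s₁] (entrance 2 x) vs (exit 2 ((s₁.thru x.1 p₁).1, p')) ∧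
      ∀ ℓ : List (A × A),
        (vs.map (bead t [s₀, s₁] ℓ)).prod = s₁.bead t (ℓ.getD 1 (1, 1)) x.1 p₁ := by
  obtain ⟨vs, h1, h2⟩ := hout.exists_path t (s₁ := s₁)
  rcases x with ⟨_ | _, p⟩
  · obtain ⟨h3, h4⟩ : s₀.Straight .up p p₁ := hin
    have he : entered [s₀, s₁] (0, p, .up) = some (0, s₀) := rfl
    have he' : entered [s₀, s₁] (1, p₁, .up) = some (1, s₁) := rfl
    refine ⟨(0, p, .up) :: (1, p₁, .up) :: vs,
      .cons ((step_of_entered he).trans ?_) (.cons (step_of_entered he') h1), fun ℓ => ?_⟩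
    · rw [h3]
      rfl
    · rw [List.map_cons, List.prod_cons, List.map_cons, List.prod_cons, h2, bead_of_entered t he,
        bead_of_entered t he', Slice.bead_of_not_hits t h4, mul_one, one_mul]
  · obtain rfl : p = p₁ := hin
    have he : entered [s₀, s₁] (2, p, .down) = some (1, s₁) := rfl
    refine ⟨(2, p, .down) :: vs, .cons (step_of_entered he) h1, fun ℓ => ?_⟩
    rw [List.map_cons, List.prod_cons, h2, bead_of_entered t he, mul_one]

variable {t}

/-- Two slices form a tangle if every strand meets a piece at most in one of them. -/
lemma isTangle_two {u v : List Dir} {π : Dir × ℕ → Dir × ℕ} {W : List (A × A) → Dir × ℕ → B}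
    (hX : Composable u [s₀, s₁] v)
    (hport : ∀ x : Dir × ℕ, (portWord u v x.1)[x.2]? = some x.1 →
      (∃ p₀ p', EntersLower s₁ x p₀ ∧ LeavesLower s₁ (s₀.thru x.1 p₀) p' ∧
        π x = ((s₀.thru x.1 p₀).1, p') ∧ ∀ ℓ, W ℓ x = s₀.bead t (ℓ.getD 0 (1, 1)) x.1 p₀) ∨
      (∃ p₁ p', EntersUpper s₀ x p₁ ∧ LeavesUpper s₀ (s₁.thru x.1 p₁) p' ∧
        π x = ((s₁.thru x.1 p₁).1, p') ∧ ∀ ℓ, W ℓ x = s₁.bead t (ℓ.getD 1 (1, 1)) x.1 p₁))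
    (hup : ∀ p < s₁.src.length, ∃ p', LeavesUpper s₀ (s₁.thru .up p) p')
    (hdown : ∀ p < s₀.tgt.length, ∃ p', LeavesLower s₁ (s₀.thru .down p) p') :
    IsTangle t [s₀, s₁] u v π W := by
  have hpath (x : Dir × ℕ) (hx : (portWord u v x.1)[x.2]? = some x.1) :
      ∃ vs, Path [s₀, s₁] (entrance 2 x) vs (exit 2 (π x)) ∧
        ∀ ℓ, (vs.map (bead t [s₀, s₁] ℓ)).prod = W ℓ x := by
    rcases hport x hx with ⟨p₀, p', h1, h2, h3, h4⟩ | ⟨p₀, p', h1, h2, h3, h4⟩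
    · obtain ⟨vs, h5, h6⟩ := exists_path_lower t h1 h2
      exact ⟨vs, h3 ▸ h5, fun ℓ => (h6 ℓ).trans (h4 ℓ).symm⟩
    · obtain ⟨vs, h5, h6⟩ := exists_path_upper t h1 h2
      exact ⟨vs, h3 ▸ h5, fun ℓ => (h6 ℓ).trans (h4 ℓ).symm⟩
  refine ⟨hX, fun x hx => ?_, ?_⟩
  · obtain ⟨vs, h1, h2⟩ := hpath x hx
    exact ⟨vs, h1, fun ℓ _ => h2 ℓ⟩
  · rintro ⟨i, p, d⟩ hx
    have hi : i ≤ 2 := hx.le_length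
    have hlt := (List.getElem?_eq_some_iff.1 hx).1
    interval_cases i
    · cases d
      · obtain ⟨vs, h1, -⟩ := hpath (.up, p) hx
        exact ⟨vs, _, h1⟩
      · exact ⟨[], (.down, p), .nil _⟩
    · cases d
      · obtain ⟨p', h⟩ := hup p (by rw [hX.2.1]; exact hlt)
        obtain ⟨vs, h1, -⟩ := h.exists_path t (s₁ := s₁)
        exact ⟨_, _, .cons (step_of_entered (L := [s₀, s₁]) (i := 1) (s := s₁) rfl) h1⟩
      · obtain ⟨p', h⟩ := hdown p hlt
        obtain ⟨vs, h1, -⟩ := h.exists_path t (s₀ := s₀)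
        exact ⟨_, _, .cons (step_of_entered (L := [s₀, s₁]) (i := 0) (s := s₀) rfl) h1⟩
    · have hv : levelWord u [s₀, s₁] 2 = v := hX.levelWord_length
      cases d
      · exact ⟨[], (.up, p), .nil _⟩
      · rw [Valid, hv] at hx
        obtain ⟨vs, h1, -⟩ := hpath (.down, p) hx
        exact ⟨vs, _, h1⟩

end TwoSlices

variable (g h : Gen) (m : List Dir)

/-- The position of the first leg of the right one of two pieces `g` and `h` with strands `m` in
between, on the side where strands directed `d` enter. -/
def rightOffset (d : Dir) : ℕ := (g.inWord d).length + m.length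

/-- The matching of two pieces `g` and `h` with strands `m` in between. -/
def exchangeMatching (x : Dir × ℕ) : Dir × ℕ :=
  if x.2 < (g.inWord x.1).length then (g.turn x.1, 1 - x.2)
  else if x.2 < rightOffset g m x.1 then
    (x.1, x.2 - (g.inWord x.1).length + (g.inWord x.1.rev).length)
  else (h.turn x.1, rightOffset g m (h.turn x.1).rev + (1 - (x.2 - rightOffset g m x.1)))

/-- The beads on two pieces `g` and `h`, labelled by `a` and `b`, with strands `m` in between. -/
def exchangeBeads (a b : A × A) (x : Dir × ℕ) : B :=
  if x.2 < (g.inWord x.1).length then g.bead t a (x.1 = .up ↔ x.2 = 0)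
  else if x.2 < rightOffset g m x.1 then 1
  else h.bead t b (x.1 = .up ↔ x.2 - rightOffset g m x.1 = 0)

variable {t g h m}

/-- The positions to the left of or in the middle of a slice, in a form fit for the exchange of two
pieces. -/
lemma exchange_cases {d : Dir} {p : ℕ} (hp : p < rightOffset g m d + (h.inWord d).length) :
    p < (g.inWord d).length ∨ (∃ q < m.length, p = (g.inWord d).length + q) ∨
      ∃ q < (h.inWord d).length, p = rightOffset g m d + q := by
  rw [rightOffset] at *
  rcases lt_or_ge p (g.inWord d).length with h1 | h1
  · exact .inl h1
  rcases lt_or_ge p ((g.inWord d).length + m.length) with h2 | h2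
  · exact .inr (.inl ⟨p - (g.inWord d).length, by lia, by lia⟩)
  · exact .inr (.inr ⟨p - ((g.inWord d).length + m.length), by lia, by lia⟩)

lemma exchangeMatching_left {d : Dir} {q : ℕ} (hq : q < (g.inWord d).length) :
    exchangeMatching g h m (d, q) = (g.turn d, 1 - q) := if_pos hq

lemma exchangeMatching_mid {d : Dir} {q : ℕ} (hq : q < m.length) :
    exchangeMatching g h m (d, (g.inWord d).length + q) = (d, (g.inWord d.rev).length + q) := by
  rw [exchangeMatching, if_neg (by simp), if_pos (by simp only [rightOffset]; lia)]
  simp only [Nat.add_sub_cancel_left, Prod.mk.injEq, true_and]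
  lia

lemma exchangeMatching_right {d : Dir} {q : ℕ} :
    exchangeMatching g h m (d, rightOffset g m d + q) =
      (h.turn d, rightOffset g m (h.turn d).rev + (1 - q)) := by
  rw [exchangeMatching, if_neg (by simp only [rightOffset]; lia), if_neg (by simp)]
  simp

lemma exchangeBeads_left {d : Dir} {q : ℕ} (hq : q < (g.inWord d).length) (a b : A × A) :
    exchangeBeads t g h m a b (d, q) = g.bead t a (d = .up ↔ q = 0) := if_pos hq

lemma exchangeBeads_mid {d : Dir} {q : ℕ} (hq : q < m.length) (a b : A × A) :
    exchangeBeads t g h m a b (d, (g.inWord d).length + q) = 1 := by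
  rw [exchangeBeads, if_neg (by simp), if_pos (by simp only [rightOffset]; lia)]

lemma exchangeBeads_right {d : Dir} {q : ℕ} (a b : A × A) :
    exchangeBeads t g h m a b (d, rightOffset g m d + q) = h.bead t b (d = .up ↔ q = 0) := by
  rw [exchangeBeads, if_neg (by simp only [rightOffset]; lia), if_neg (by simp)]
  exact Gen.bead_congr t _ _ (by simp)

lemma length_portWord_exchange (d : Dir) :
    (portWord (g.dom ++ m ++ h.dom) (g.cod ++ m ++ h.cod) d).length =
      rightOffset g m d + (h.inWord d).length := by
  cases d <;> simp [portWord, rightOffset, Gen.inWord, add_assoc]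

/-- A strand beside a piece at the left end of a slice. -/
lemma straight_of_left_nil (r : List Dir) (d : Dir) (q : ℕ) :
    (⟨[], g, r⟩ : Slice).Straight d ((g.inWord d).length + q) ((g.inWord d.rev).length + q) := by
  have := Slice.straight_right ⟨[], g, r⟩ d q
  simpa using this

lemma thru_of_left_nil (r : List Dir) {d : Dir} {q : ℕ} (hq : q < (g.inWord d).length) :
    (⟨[], g, r⟩ : Slice).thru d q = (g.turn d, 1 - q) := by
  have := Slice.thru_of_hits (s := ⟨[], g, r⟩) hq
  simpa using this

lemma bead_of_left_nil (r : List Dir) {d : Dir} {q : ℕ} (hq : q < (g.inWord d).length)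
    (ab : A × A) : (⟨[], g, r⟩ : Slice).bead t ab d q = g.bead t ab (d = .up ↔ q = 0) := by
  have := Slice.bead_of_hits t (s := ⟨[], g, r⟩) hq ab
  simpa using this

lemma rightOffset_add (d : Dir) (q : ℕ) :
    rightOffset g m d + q = (g.inWord d).length + (m.length + q) := by
  rw [rightOffset, add_assoc]

/-- The slice of the right piece `h`, at the level of the side of `g` where strands directed `d`
enter. -/
lemma thru_right_piece {d d' : Dir} {q : ℕ} (hq : q < (h.inWord d).length) :
    (⟨g.inWord d' ++ m, h, []⟩ : Slice).thru d (rightOffset g m d' + q) =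
      (h.turn d, rightOffset g m d' + (1 - q)) := by
  have := Slice.thru_of_hits (s := ⟨g.inWord d' ++ m, h, []⟩) hq
  simpa [rightOffset] using this

lemma bead_right_piece {d d' : Dir} {q : ℕ} (hq : q < (h.inWord d).length) (ab : A × A) :
    (⟨g.inWord d' ++ m, h, []⟩ : Slice).bead t ab d (rightOffset g m d' + q) =
      h.bead t ab (d = .up ↔ q = 0) := by
  have := Slice.bead_of_hits t (s := ⟨g.inWord d' ++ m, h, []⟩) hq ab
  simpa [rightOffset] using this

lemma straight_right_piece {d d' : Dir} {p : ℕ} (hp : p < rightOffset g m d') :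
    (⟨g.inWord d' ++ m, h, []⟩ : Slice).Straight d p p :=
  Slice.straight_left (by simpa [rightOffset] using hp) d

lemma isTangle_exchange_left : IsTangle t [⟨[], g, m ++ h.dom⟩, ⟨g.cod ++ m, h, []⟩]
    (g.dom ++ m ++ h.dom) (g.cod ++ m ++ h.cod) (exchangeMatching g h m)
    fun ℓ => exchangeBeads t g h m (ℓ.getD 0 (1, 1)) (ℓ.getD 1 (1, 1)) := by
  have hr {d : Dir} {p : ℕ} (hp : p < rightOffset g m .down) :
      (⟨g.cod ++ m, h, []⟩ : Slice).Straight d p p := straight_right_piece hp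
  refine isTangle_two ⟨by simp [Slice.src], by simp [Slice.src, Slice.tgt],
    by simp [Slice.tgt, Composable]⟩
    ?_ ?_ ?_
  · rintro ⟨d, p⟩ hx
    replace hx := (List.getElem?_eq_some_iff.1 hx).1
    rw [length_portWord_exchange] at hx
    dsimp only at hx
    rcases exchange_cases hx with hq | ⟨q, hq, rfl⟩ | ⟨q, hq, rfl⟩
    · refine .inl ⟨p, 1 - p, ?_, ?_, ?_, fun ℓ => ?_⟩
      · cases d
        · rfl
        · exact hr (by simp only [rightOffset]; lia)
      · have h1 := (Gen.length_inWord_turn hq).1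
        simp only [thru_of_left_nil _ hq]
        cases hd : g.turn d
        · rw [hd] at h1
          exact hr (by simp only [rightOffset]; exact lt_of_lt_of_le h1 (Nat.le_add_right _ _))
        · rfl
      · rw [exchangeMatching_left hq, thru_of_left_nil _ hq]
      · rw [exchangeBeads_left hq, bead_of_left_nil _ hq]
    · have hs := straight_of_left_nil (g := g) (m ++ h.dom) d q
      refine .inl ⟨(g.inWord d).length + q, (g.inWord d.rev).length + q, ?_, ?_, ?_, fun ℓ => ?_⟩
      · cases d
        · rfl
        · exact hr (by simp only [rightOffset]; lia)
      · rw [hs.1]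
        cases d
        · exact hr (by simp only [rightOffset, Dir.rev]; lia)
        · rfl
      · rw [exchangeMatching_mid hq, hs.1]
      · rw [exchangeBeads_mid hq, Slice.bead_of_not_hits t hs.2]
    · refine .inr ⟨rightOffset g m .down + q, rightOffset g m (h.turn d).rev + (1 - q),
        ?_, ?_, ?_, fun ℓ => ?_⟩
      · cases d
        · rw [rightOffset_add, rightOffset_add]
          exact straight_of_left_nil _ _ _
        · rfl
      · rw [show g.cod = g.inWord .down from rfl, thru_right_piece hq]
        cases h.turn d
        · rfl
        · rw [rightOffset_add, rightOffset_add]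
          exact straight_of_left_nil _ _ _
      · rw [exchangeMatching_right, show g.cod = g.inWord .down from rfl, thru_right_piece hq]
      · rw [exchangeBeads_right, show g.cod = g.inWord .down from rfl, bead_right_piece hq]
  · intro p hp
    replace hp : p < rightOffset g m .down + (h.inWord .up).length := by
      simpa [Slice.src, rightOffset, Gen.inWord, add_assoc] using hp
    rcases lt_or_ge p (rightOffset g m .down) with hlt | hge
    · refine ⟨p, ?_⟩
      rw [(hr hlt).1]
      rfl
    · obtain ⟨q, rfl⟩ := Nat.exists_eq_add_of_le hge
      rw [show g.cod = g.inWord .down from rfl, thru_right_piece (by lia)]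
      cases h.turn .up
      · exact ⟨_, rfl⟩
      · rw [rightOffset_add]
        exact ⟨_, straight_of_left_nil _ _ _⟩
  · intro p hp
    rcases lt_or_ge p (g.inWord .down).length with hlt | hge
    · rw [thru_of_left_nil _ hlt]
      have h1 := (Gen.length_inWord_turn hlt).1
      cases hd : g.turn .down
      · rw [hd] at h1
        exact ⟨_, hr (by simp only [rightOffset]; exact lt_of_lt_of_le h1 (Nat.le_add_right _ _))⟩
      · exact ⟨_, rfl⟩
    · obtain ⟨q, rfl⟩ := Nat.exists_eq_add_of_le hge
      rw [(straight_of_left_nil _ _ _).1]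
      exact ⟨_, rfl⟩

lemma isTangle_exchange_right : IsTangle t [⟨g.dom ++ m, h, []⟩, ⟨[], g, m ++ h.cod⟩]
    (g.dom ++ m ++ h.dom) (g.cod ++ m ++ h.cod) (exchangeMatching g h m)
    fun ℓ => exchangeBeads t g h m (ℓ.getD 1 (1, 1)) (ℓ.getD 0 (1, 1)) := by
  have hr {d : Dir} {p : ℕ} (hp : p < rightOffset g m .up) :
      (⟨g.dom ++ m, h, []⟩ : Slice).Straight d p p := straight_right_piece hp
  refine isTangle_two ⟨by simp [Slice.src], by simp [Slice.src, Slice.tgt],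
    by simp [Slice.tgt, Composable]⟩
    ?_ ?_ ?_
  · rintro ⟨d, p⟩ hx
    replace hx := (List.getElem?_eq_some_iff.1 hx).1
    rw [length_portWord_exchange] at hx
    dsimp only at hx
    rcases exchange_cases hx with hq | ⟨q, hq, rfl⟩ | ⟨q, hq, rfl⟩
    · refine .inr ⟨p, 1 - p, ?_, ?_, ?_, fun ℓ => ?_⟩
      · cases d
        · exact hr (by simp only [rightOffset]; lia)
        · rfl
      · have h1 := (Gen.length_inWord_turn hq).1
        simp only [thru_of_left_nil _ hq]
        cases hd : g.turn d
        · rfl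
        · rw [hd] at h1
          exact hr (by simp only [rightOffset]; exact lt_of_lt_of_le h1 (Nat.le_add_right _ _))
      · rw [exchangeMatching_left hq, thru_of_left_nil _ hq]
      · rw [exchangeBeads_left hq, bead_of_left_nil _ hq]
    · have hs := straight_of_left_nil (g := g) (m ++ h.cod) d q
      refine .inr ⟨(g.inWord d).length + q, (g.inWord d.rev).length + q, ?_, ?_, ?_, fun ℓ => ?_⟩
      · cases d
        · exact hr (by simp only [rightOffset]; lia)
        · rfl
      · rw [hs.1]
        cases d
        · rfl
        · exact hr (by simp only [rightOffset, Dir.rev]; lia)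
      · rw [exchangeMatching_mid hq, hs.1]
      · rw [exchangeBeads_mid hq, Slice.bead_of_not_hits t hs.2]
    · refine .inl ⟨rightOffset g m .up + q, rightOffset g m (h.turn d).rev + (1 - q),
        ?_, ?_, ?_, fun ℓ => ?_⟩
      · cases d
        · rfl
        · rw [rightOffset_add, rightOffset_add]
          exact straight_of_left_nil _ _ _
      · rw [show g.dom = g.inWord .up from rfl, thru_right_piece hq]
        cases h.turn d
        · rw [rightOffset_add, rightOffset_add]
          exact straight_of_left_nil _ _ _
        · rfl
      · rw [exchangeMatching_right, show g.dom = g.inWord .up from rfl, thru_right_piece hq]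
      · rw [exchangeBeads_right, show g.dom = g.inWord .up from rfl, bead_right_piece hq]
  · intro p hp
    rcases lt_or_ge p (g.inWord .up).length with hlt | hge
    · rw [thru_of_left_nil _ hlt]
      have h1 := (Gen.length_inWord_turn hlt).1
      cases hd : g.turn .up
      · exact ⟨_, rfl⟩
      · rw [hd] at h1
        exact ⟨_, hr (by simp only [rightOffset]; exact lt_of_lt_of_le h1 (Nat.le_add_right _ _))⟩
    · obtain ⟨q, rfl⟩ := Nat.exists_eq_add_of_le hge
      rw [(straight_of_left_nil _ _ _).1]
      exact ⟨_, rfl⟩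
  · intro p hp
    replace hp : p < rightOffset g m .up + (h.inWord .down).length := by
      simpa [Slice.tgt, rightOffset, Gen.inWord, add_assoc] using hp
    rcases lt_or_ge p (rightOffset g m .up) with hlt | hge
    · refine ⟨p, ?_⟩
      rw [(hr hlt).1]
      rfl
    · obtain ⟨q, rfl⟩ := Nat.exists_eq_add_of_le hge
      rw [show g.dom = g.inWord .up from rfl, thru_right_piece (by lia)]
      cases h.turn .down
      · rw [rightOffset_add]
        exact ⟨_, straight_of_left_nil _ _ _⟩
      · exact ⟨_, rfl⟩

end Exchange

/-! ### Invariance under the local moves -/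

section MultiLinear

variable {k A R B Q : Type*} [CommRing k] [Ring A] [Algebra k A] [CommRing R] [Algebra k R]
  [Ring B] [Algebra k B] [DecidableEq Q] {G : (Q → B) → R}

/-- A function that is linear in two of its arguments factors through their tensor product. -/
lemma LinearIn.exists_tmul {q₁ q₂ : Q} (h₁ : LinearIn k G q₁) (h₂ : LinearIn k G q₂)
    (hne : q₁ ≠ q₂) (w : Q → B) (f₁ f₂ : A →ₗ[k] B) : ∃ Φ : A ⊗[k] A →ₗ[k] R, ∀ a b,
      G (Function.update (Function.update w q₁ (f₁ a)) q₂ (f₂ b)) = Φ (a ⊗ₜ b) := by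
  choose φ₁ hφ₁ using h₁
  choose φ₂ hφ₂ using h₂
  have h1 (a b : A) : G (Function.update (Function.update w q₁ (f₁ a)) q₂ (f₂ b)) =
      φ₁ (Function.update w q₂ (f₂ b)) (f₁ a) := by
    rw [Function.update_comm hne, hφ₁]
  have h2 (a b : A) : G (Function.update (Function.update w q₁ (f₁ a)) q₂ (f₂ b)) =
      φ₂ (Function.update w q₁ (f₁ a)) (f₂ b) := hφ₂ _ _
  refine ⟨TensorProduct.lift (LinearMap.mk₂ k
    (fun a b => G (Function.update (Function.update w q₁ (f₁ a)) q₂ (f₂ b)))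
    (fun a a' b => ?_) (fun c a b => ?_) (fun a b b' => ?_) fun c a b => ?_), fun a b => rfl⟩
  · rw [h1, h1, h1, map_add, map_add]
  · rw [h1, h1, map_smul, map_smul]
  · rw [h2, h2, h2, map_add, map_add]
  · rw [h2, h2, map_smul, map_smul]

/-- A function that is linear in three of its arguments factors through their tensor product. -/
lemma LinearIn.exists_tmul₃ {q₁ q₂ q₃ : Q} (h₁ : LinearIn k G q₁) (h₂ : LinearIn k G q₂)
    (h₃ : LinearIn k G q₃) (h₁₂ : q₁ ≠ q₂) (h₁₃ : q₁ ≠ q₃) (h₂₃ : q₂ ≠ q₃) (w : Q → B)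
    (f₁ f₂ f₃ : A →ₗ[k] B) : ∃ Φ : A ⊗[k] (A ⊗[k] A) →ₗ[k] R, ∀ a b c,
      G (Function.update (Function.update (Function.update w q₁ (f₁ a)) q₂ (f₂ b)) q₃ (f₃ c)) =
        Φ (a ⊗ₜ (b ⊗ₜ c)) := by
  choose Ψ hΨ using fun a => h₂.exists_tmul h₃ h₂₃ (Function.update w q₁ (f₁ a)) f₂ f₃
  choose φ hφ using h₁
  have h1 (a b c : A) : Ψ a (b ⊗ₜ c) =
      φ (Function.update (Function.update w q₂ (f₂ b)) q₃ (f₃ c)) (f₁ a) := by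
    rw [← hΨ, ← hφ, Function.update_comm h₁₂, Function.update_comm h₁₃]
  refine ⟨TensorProduct.lift ⟨⟨Ψ, fun a a' => ?_⟩, fun c a => ?_⟩, fun a b c => hΨ a b c⟩
  · refine TensorProduct.ext' fun b c => ?_
    rw [LinearMap.add_apply]
    rw [h1, h1, h1, map_add, map_add]
  · refine TensorProduct.ext' fun b c' => ?_
    rw [RingHom.id_apply, LinearMap.smul_apply]
    rw [h1, h1, map_smul, map_smul]

end MultiLinear

section LocalMoves

variable {k A R B : Type*} [CommRing k] [Ring A] [Algebra k A] [CommRing R] [Algebra k R]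
  [Ring B] [Algebra k B] {ρ γ : (A ⊗[k] A)ˣ} {D U : A ≃ₐ[k] A} {P : Presentations ρ γ}

lemma sum_label (h : IsBiOrientedQuantumAlgebra ρ γ D U) (c : Crossing) (x y : Dir) {M : Type*}
    [AddCommGroup M] [Module k M] (Φ : A ⊗[k] A →ₗ[k] M) :
    ∑ n, Φ (((Gen.cross c x y).label D U P n).1 ⊗ₜ ((Gen.cross c x y).label D U P n).2) =
      Φ (crossingTensor (U * D) (crossingElement ρ γ) c x y) := by
  rw [← map_sum]
  exact congrArg Φ (sum_frame_bead P h c x y)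

lemma sum_label₂ (h : IsBiOrientedQuantumAlgebra ρ γ D U) (c : Crossing) (x y : Dir)
    (c' : Crossing) (x' y' : Dir) {M : Type*} [AddCommGroup M] [Module k M]
    (Φ : A ⊗[k] A →ₗ[k] A ⊗[k] A →ₗ[k] M) :
    ∑ n, ∑ m,
      Φ (((Gen.cross c x y).label D U P n).1 ⊗ₜ ((Gen.cross c x y).label D U P n).2)
        (((Gen.cross c' x' y').label D U P m).1 ⊗ₜ ((Gen.cross c' x' y').label D U P m).2) =
      Φ (crossingTensor (U * D) (crossingElement ρ γ) c x y)
        (crossingTensor (U * D) (crossingElement ρ γ) c' x' y') := by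
  rw [← LinearMap.flip_apply, ← sum_label h c x y (P := P)]
  exact Finset.sum_congr rfl fun n _ => sum_label h c' x' y' _

lemma sum_label₃ (h : IsBiOrientedQuantumAlgebra ρ γ D U) (c : Crossing) (x y : Dir)
    (c' : Crossing) (x' y' : Dir) (c'' : Crossing) (x'' y'' : Dir) {M : Type*} [AddCommGroup M]
    [Module k M] (Φ : A ⊗[k] A →ₗ[k] A ⊗[k] A →ₗ[k] A ⊗[k] A →ₗ[k] M) :
    ∑ n, ∑ m, ∑ l,
      Φ (((Gen.cross c x y).label D U P n).1 ⊗ₜ ((Gen.cross c x y).label D U P n).2)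
        (((Gen.cross c' x' y').label D U P m).1 ⊗ₜ ((Gen.cross c' x' y').label D U P m).2)
        (((Gen.cross c'' x'' y'').label D U P l).1 ⊗ₜ
          ((Gen.cross c'' x'' y'').label D U P l).2) =
      Φ (crossingTensor (U * D) (crossingElement ρ γ) c x y)
        (crossingTensor (U * D) (crossingElement ρ γ) c' x' y')
        (crossingTensor (U * D) (crossingElement ρ γ) c'' x'' y'') := by
  exact (Finset.sum_congr rfl fun n _ => sum_label₂ h c' x' y' c'' x'' y'' (Φ _)).trans
    (sum_label h c x y ((Φ.flip _).flip _))

section Words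

variable {θ : A ≃ₐ[k] A} {τ : ℤ → A →ₗ[k] R} (t : TraceRing θ τ B)

lemma visitWord_update {Q : Type*} [DecidableEq Q] (ℓ : List (A × A)) (w : Q → List Visit) (q : Q)
    (L : List Visit) : (fun q' => visitWord t ℓ (Function.update w q L q')) =
      Function.update (fun q' => visitWord t ℓ (w q')) q (visitWord t ℓ L) :=
  Function.comp_update (visitWord t ℓ) w q L

/-- The bead on the strand `/` or on the strand `\` of a crossing. -/
def leg (b : Bool) (ab : A × A) : A := if b then ab.1 else ab.2

lemma visitWord_cross (ℓ : List (A × A)) (i : ℕ) (c : Crossing) (x y : Dir) (b : Bool) :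
    visitWord t ℓ [(i, .cross c x y, b)] = t.incl (leg b (ℓ.getD i (1, 1))) := by
  cases b <;> simp [visitWord, visitBead, Gen.bead, leg]

lemma visitWord_ordered (ℓ : List (A × A)) (i j : ℕ) (c c' : Crossing) (x y x' y' d : Dir)
    (b b' : Bool) : visitWord t ℓ (ordered d [(i, .cross c x y, b), (j, .cross c' x' y', b')]) =
      t.incl (dirMul k A d (leg b (ℓ.getD i (1, 1))) (leg b' (ℓ.getD j (1, 1)))) := by
  cases d <;> cases b <;> cases b' <;>
    simp [visitWord, visitBead, ordered, Gen.bead, leg, map_mul]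

end Words

variable {τ : ℤ → A →ₗ[k] R} {t : TraceRing (U * D) τ B}

lemma Crossing.flip_flip (c : Crossing) : c.flip.flip = c := by cases c <;> rfl

lemma port_mem {u v : List Dir} {p p' : ℕ} {x : Dir} (hu : u[p]? = some x) (hv : v[p']? = some x) :
    (portWord u v (port p p' x).1)[(port p p' x).2]? = some (port p p' x).1 := by
  cases x <;> assumption

lemma port_ne {p p' r r' : ℕ} (h : p ≠ r) (h' : p' ≠ r') (x y : Dir) :
    port p p' x ≠ port r r' y := by
  cases x <;> cases y <;> simp [port, h, h']

lemma tangleEquiv_typeTwo (h : IsBiOrientedQuantumAlgebra ρ γ D U) (c : Crossing) (x y : Dir) :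
    TangleEquiv t D U P P [⟨[], .cross c x y, []⟩, ⟨[], .cross c.flip y x, []⟩] [] := by
  refine ⟨_, _, _, _, _, isTangle_typeTwo c c.flip x y, isTangle_nil _, fun G hG => ?_⟩
  obtain ⟨Φ, hΦ⟩ := LinearIn.exists_tmul (hG _ (port_mem (p := 0) (p' := 0) rfl rfl))
    (hG _ (port_mem (p := 1) (p' := 1) rfl rfl)) (port_ne (by simp) (by simp) x y)
    (fun _ => 1) t.incl.toLinearMap t.incl.toLinearMap
  simp only [visitWord_update, visitWord_ordered, labelSum]
  calc
    _ = ∑ n, ∑ m, Φ (dirMul₂ x y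
          (((Gen.cross c x y).label D U P n).1 ⊗ₜ ((Gen.cross c x y).label D U P n).2)
          (TensorProduct.comm k A A (((Gen.cross c.flip y x).label D U P m).1 ⊗ₜ
            ((Gen.cross c.flip y x).label D U P m).2))) :=
      Finset.sum_congr rfl fun n _ => Finset.sum_congr rfl fun m _ => hΦ _ _
    _ = Φ (dirMul₂ x y (crossingTensor (U * D) (crossingElement ρ γ) c x y)
          (TensorProduct.comm k A A
            (crossingTensor (U * D) (crossingElement ρ γ) c.flip y x))) :=
      sum_label₂ h c x y c.flip y x
        (((dirMul₂ x y).compl₂ (TensorProduct.comm k A A).toLinearMap).compr₂ Φ)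
    _ = G fun _ => 1 := by
      rw [h.isCrossingFamily.typeTwo, Algebra.TensorProduct.one_def, ← hΦ]
      simp

lemma tangleEquiv_typeThree (h : IsBiOrientedQuantumAlgebra ρ γ D U) {c12 c13 c23 : Crossing}
    (hc : TypeThreeAllowed c12 c13 c23) (x y z : Dir) : TangleEquiv t D U P P
    [⟨[], .cross c12 x y, [z]⟩, ⟨[y], .cross c13 x z, []⟩, ⟨[], .cross c23 y z, [x]⟩]
    [⟨[x], .cross c23 y z, []⟩, ⟨[], .cross c13 x z, [y]⟩, ⟨[z], .cross c12 x y, []⟩] := by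
  refine ⟨_, _, _, _, _, isTangle_typeThree_left c12 c13 c23 x y z,
    isTangle_typeThree_right c12 c13 c23 x y z, fun G hG => ?_⟩
  obtain ⟨Φ, hΦ⟩ := LinearIn.exists_tmul₃ (hG _ (port_mem (p := 0) (p' := 2) rfl rfl))
    (hG _ (port_mem (p := 1) (p' := 1) rfl rfl)) (hG _ (port_mem (p := 2) (p' := 0) rfl rfl))
    (port_ne (by simp) (by simp) x y) (port_ne (by simp) (by simp) x z)
    (port_ne (by simp) (by simp) y z) (fun _ => 1) t.incl.toLinearMap t.incl.toLinearMap
    t.incl.toLinearMap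
  simp only [visitWord_update, visitWord_ordered, labelSum]
  let g12 (n) := (Gen.cross c12 x y).label D U P n
  let g13 (n) := (Gen.cross c13 x z).label D U P n
  let g23 (n) := (Gen.cross c23 y z).label D U P n
  calc
    _ = ∑ n, ∑ m, ∑ l, Φ (dirMul₃ x y z (dirMul₃ x y z (leg12 ((g12 n).1 ⊗ₜ (g12 n).2))
          (leg13 ((g13 m).1 ⊗ₜ (g13 m).2))) (leg23 ((g23 l).1 ⊗ₜ (g23 l).2))) := by
      refine Finset.sum_congr rfl fun n _ => Finset.sum_congr rfl fun m _ =>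
        Finset.sum_congr rfl fun l _ => (hΦ _ _ _).trans ?_
      simp only [leg12_tmul, leg13_tmul, leg23_tmul, dirMul₃_tmul, dirMul₂_tmul, dirMul_one,
        one_dirMul]
      rfl
    _ = Φ (dirMul₃ x y z (dirMul₃ x y z
          (leg12 (crossingTensor (U * D) (crossingElement ρ γ) c12 x y))
          (leg13 (crossingTensor (U * D) (crossingElement ρ γ) c13 x z)))
          (leg23 (crossingTensor (U * D) (crossingElement ρ γ) c23 y z))) :=
      sum_label₃ h c12 x y c13 x z c23 y z (((dirMul₃ x y z).compl₁₂ leg12.toLinearMap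
        leg13.toLinearMap).compr₂ (((dirMul₃ x y z).compl₂ leg23.toLinearMap).compr₂ Φ))
    _ = Φ (dirMul₃ x y z (dirMul₃ x y z
          (leg23 (crossingTensor (U * D) (crossingElement ρ γ) c23 y z))
          (leg13 (crossingTensor (U * D) (crossingElement ρ γ) c13 x z)))
          (leg12 (crossingTensor (U * D) (crossingElement ρ γ) c12 x y))) := by
      rw [h.isCrossingFamily.typeThree hc]
    _ = ∑ l, ∑ m, ∑ n, Φ (dirMul₃ x y z (dirMul₃ x y z (leg23 ((g23 l).1 ⊗ₜ (g23 l).2))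
          (leg13 ((g13 m).1 ⊗ₜ (g13 m).2))) (leg12 ((g12 n).1 ⊗ₜ (g12 n).2))) :=
      (sum_label₃ h c23 y z c13 x z c12 x y (((dirMul₃ x y z).compl₁₂ leg23.toLinearMap
        leg13.toLinearMap).compr₂ (((dirMul₃ x y z).compl₂ leg12.toLinearMap).compr₂ Φ))).symm
    _ = _ := by
      refine Finset.sum_congr rfl fun l _ => Finset.sum_congr rfl fun m _ =>
        Finset.sum_congr rfl fun n _ => ((hΦ _ _ _).trans ?_).symm
      simp only [leg12_tmul, leg13_tmul, leg23_tmul, dirMul₃_tmul, dirMul₂_tmul, dirMul_one,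
        one_dirMul]
      rfl

/-- The change of a bead that is moved from one end to the other end of a maximum with left leg
directed `x`. -/
def slideBead (θ : A ≃ₐ[k] A) : Dir → A →ₐ[k] A
  | .up => AlgHom.id k A
  | .down => θ

lemma IsCrossingFamily.slide {θ : A ≃ₐ[k] A} {N : Crossing → (A ⊗[k] A)ˣ}
    (h : IsCrossingFamily θ N) (c : Crossing) (x y : Dir) :
    Algebra.TensorProduct.map (slideBead θ x) (AlgHom.id k A)
      (TensorProduct.comm k A A (crossingTensor θ N c.flip y x.rev)) =
        crossingTensor θ N c x y := by
  cases x
  · rw [slideBead, map_id_id]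
    exact h.slide_up c y
  · exact h.slide_down c y

variable (t) in
/-- The bead of a maximum with left leg directed `x`. -/
def capBead : Dir → B
  | .up => 1
  | .down => t.turn

variable (t) in
/-- The bead of a minimum with left leg directed `x`. -/
def cupBead : Dir → B
  | .up => (t.turn⁻¹ : Bˣ)
  | .down => 1

lemma visitWord_cross_cap (ℓ : List (A × A)) (i j : ℕ) (c : Crossing) (a b x : Dir) (s s' : Bool) :
    visitWord t ℓ (ordered x [(i, .cross c a b, s), (j, .cap x, s')]) =
      capBead t x * t.incl (leg s (ℓ.getD i (1, 1))) := by
  cases x <;> cases s <;> simp [visitWord, visitBead, ordered, Gen.bead, leg, capBead]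

lemma visitWord_cap_cross (ℓ : List (A × A)) (i j : ℕ) (c : Crossing) (a b x : Dir) (s s' : Bool) :
    visitWord t ℓ (ordered x [(j, .cap x, s'), (i, .cross c a b, s)]) =
      capBead t x * t.incl (slideBead (U * D) x (leg s (ℓ.getD i (1, 1)))) := by
  cases x <;> cases s <;>
    simp [visitWord, visitBead, ordered, Gen.bead, leg, capBead, slideBead, t.incl_mul_turn]

lemma visitWord_cup_cross (ℓ : List (A × A)) (i j : ℕ) (c : Crossing) (a b x : Dir) (s s' : Bool) :
    visitWord t ℓ (ordered x [(j, .cup x, s'), (i, .cross c a b, s)]) =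
      t.incl (slideBead (U * D) x.rev (leg s (ℓ.getD i (1, 1)))) * cupBead t x := by
  cases x <;> cases s <;>
    simp [visitWord, visitBead, ordered, Gen.bead, leg, cupBead, slideBead, Dir.rev,
      t.turn_inv_mul_incl]

lemma visitWord_cross_cup (ℓ : List (A × A)) (i j : ℕ) (c : Crossing) (a b x : Dir) (s s' : Bool) :
    visitWord t ℓ (ordered x [(i, .cross c a b, s), (j, .cup x, s')]) =
      t.incl (leg s (ℓ.getD i (1, 1))) * cupBead t x := by
  cases x <;> cases s <;> simp [visitWord, visitBead, ordered, Gen.bead, leg, cupBead]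

lemma tangleEquiv_capSlide (h : IsBiOrientedQuantumAlgebra ρ γ D U) (c : Crossing) (x y : Dir) :
    TangleEquiv t D U P P [⟨[], .cross c x y, [x.rev]⟩, ⟨[y], .cap x, []⟩]
      [⟨[x], .cross c.flip y x.rev, []⟩, ⟨[], .cap x, [y]⟩] := by
  refine ⟨_, _, _, _, _, isTangle_capSlide_left c x y, isTangle_capSlide_right c.flip x y,
    fun G hG => ?_⟩
  obtain ⟨Φ, hΦ⟩ := LinearIn.exists_tmul (hG (capPort x) (by cases x <;> rfl))
    (hG _ (port_mem (p := 1) (p' := 0) rfl rfl)) (by cases x <;> cases y <;> simp [capPort, port])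
    (fun _ => 1) (LinearMap.mulLeft k (capBead t x) ∘ₗ t.incl.toLinearMap) t.incl.toLinearMap
  simp only [visitWord_update, visitWord_cross, visitWord_cross_cap, visitWord_cap_cross,
    labelSum_cap, labelSum_cross, labelSum_nil]
  calc
    _ = ∑ n, Φ (((Gen.cross c x y).label D U P n).1 ⊗ₜ ((Gen.cross c x y).label D U P n).2) :=
      Finset.sum_congr rfl fun n _ => hΦ _ _
    _ = Φ (Algebra.TensorProduct.map (slideBead (U * D) x) (AlgHom.id k A)
          (TensorProduct.comm k A A
            (crossingTensor (U * D) (crossingElement ρ γ) c.flip y x.rev))) := by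
      rw [sum_label h, h.isCrossingFamily.slide]
    _ = ∑ n, Φ (Algebra.TensorProduct.map (slideBead (U * D) x) (AlgHom.id k A)
          (TensorProduct.comm k A A (((Gen.cross c.flip y x.rev).label D U P n).1 ⊗ₜ
            ((Gen.cross c.flip y x.rev).label D U P n).2))) :=
      (sum_label h c.flip y x.rev (Φ ∘ₗ (Algebra.TensorProduct.map (slideBead (U * D) x)
        (AlgHom.id k A)).toLinearMap ∘ₗ (TensorProduct.comm k A A).toLinearMap)).symm
    _ = _ := Finset.sum_congr rfl fun n _ => (hΦ _ _).symm

lemma tangleEquiv_cupSlide (h : IsBiOrientedQuantumAlgebra ρ γ D U) (c : Crossing) (x y : Dir) :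
    TangleEquiv t D U P P [⟨[y], .cup x, []⟩, ⟨[], .cross c y x, [x.rev]⟩]
      [⟨[], .cup x, [y]⟩, ⟨[x], .cross c.flip x.rev y, []⟩] := by
  refine ⟨_, _, _, _, _, isTangle_cupSlide_left c x y, isTangle_cupSlide_right c.flip x y,
    fun G hG => ?_⟩
  obtain ⟨Φ, hΦ⟩ := LinearIn.exists_tmul (hG (cupPort x) (by cases x <;> rfl))
    (hG _ (port_mem (p := 0) (p' := 1) rfl rfl)) (by cases x <;> cases y <;> simp [cupPort, port])
    (fun _ => 1) (LinearMap.mulRight k (cupBead t x) ∘ₗ t.incl.toLinearMap) t.incl.toLinearMap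
  simp only [visitWord_update, visitWord_cross, visitWord_cup_cross, visitWord_cross_cup,
    labelSum_cup, labelSum_cross, labelSum_nil]
  have hs : Algebra.TensorProduct.map (slideBead (U * D) x.rev) (AlgHom.id k A)
      (TensorProduct.comm k A A (crossingTensor (U * D) (crossingElement ρ γ) c y x)) =
        crossingTensor (U * D) (crossingElement ρ γ) c.flip x.rev y := by
    have h1 := h.isCrossingFamily.slide c.flip x.rev y
    rwa [Dir.rev_rev, Crossing.flip_flip] at h1
  calc
    _ = ∑ n, Φ (Algebra.TensorProduct.map (slideBead (U * D) x.rev) (AlgHom.id k A)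
          (TensorProduct.comm k A A (((Gen.cross c y x).label D U P n).1 ⊗ₜ
            ((Gen.cross c y x).label D U P n).2))) :=
      Finset.sum_congr rfl fun n _ => hΦ _ _
    _ = Φ (Algebra.TensorProduct.map (slideBead (U * D) x.rev) (AlgHom.id k A)
          (TensorProduct.comm k A A (crossingTensor (U * D) (crossingElement ρ γ) c y x))) :=
      sum_label h c y x (Φ ∘ₗ (Algebra.TensorProduct.map (slideBead (U * D) x.rev)
        (AlgHom.id k A)).toLinearMap ∘ₗ (TensorProduct.comm k A A).toLinearMap)
    _ = ∑ n, Φ (((Gen.cross c.flip x.rev y).label D U P n).1 ⊗ₜ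
          ((Gen.cross c.flip x.rev y).label D U P n).2) := by
      rw [hs, sum_label h]
    _ = _ := Finset.sum_congr rfl fun n _ => (hΦ _ _).symm

lemma tangleEquiv_zigzagRight (o : Dir) :
    TangleEquiv t D U P P [⟨[o], .cup o.rev, []⟩, ⟨[], .cap o, [o]⟩] [] := by
  refine ⟨_, _, _, _, _, isTangle_zigzagRight o, isTangle_nil _, fun G hG => ?_⟩
  have hw (ℓ : List (A × A)) :
      visitWord t ℓ (ordered o [(1, .cap o, o = .up), (0, .cup o.rev, o = .down)]) = 1 := by
    cases o <;> simp [visitWord, visitBead, ordered, Gen.bead, Dir.rev]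
  simp only [visitWord_update, hw, labelSum_cup, labelSum_cap, labelSum_nil]
  exact congrArg G (Function.update_eq_self (f := fun _ => 1) _)

lemma tangleEquiv_zigzagLeft (o : Dir) :
    TangleEquiv t D U P P [⟨[], .cup o, [o]⟩, ⟨[o], .cap o.rev, []⟩] [] := by
  refine ⟨_, _, _, _, _, isTangle_zigzagLeft o, isTangle_nil _, fun G hG => ?_⟩
  have hw (ℓ : List (A × A)) :
      visitWord t ℓ (ordered o [(1, .cap o.rev, o = .down), (0, .cup o, o = .up)]) = 1 := by
    cases o <;> simp [visitWord, visitBead, ordered, Gen.bead, Dir.rev]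
  simp only [visitWord_update, hw, labelSum_cup, labelSum_cap, labelSum_nil]
  exact congrArg G (Function.update_eq_self (f := fun _ => 1) _)

lemma tangleEquiv_exchange (m : List Dir) (g h : Gen) :
    TangleEquiv t D U P P [⟨[], g, m ++ h.dom⟩, ⟨g.cod ++ m, h, []⟩]
      [⟨g.dom ++ m, h, []⟩, ⟨[], g, m ++ h.cod⟩] :=
  ⟨_, _, _, _, _, isTangle_exchange_left, isTangle_exchange_right,
    fun _ _ => Finset.sum_comm⟩

variable (P) in
/-- The sum over the summands at a crossing does not depend on the presentation. -/
lemma tangleEquiv_presentation (h : IsBiOrientedQuantumAlgebra ρ γ D U) (P' : Presentations ρ γ)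
    (c : Crossing) (x y : Dir) :
    TangleEquiv t D U P P' [⟨[], .cross c x y, []⟩] [⟨[], .cross c x y, []⟩] := by
  refine ⟨_, _, _, _, _, isTangle_cross c x y, isTangle_cross c x y, fun G hG => ?_⟩
  obtain ⟨Φ, hΦ⟩ := LinearIn.exists_tmul (hG _ (port_mem (p := 0) (p' := 1) rfl rfl))
    (hG _ (port_mem (p := 1) (p' := 0) rfl rfl)) (port_ne (by simp) (by simp) x y)
    (fun _ => 1) t.incl.toLinearMap t.incl.toLinearMap
  simp only [visitWord_update, visitWord_cross, labelSum_cross, labelSum_nil]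
  have key (P : Presentations ρ γ) := (Finset.sum_congr rfl fun n _ =>
    hΦ ((Gen.cross c x y).label D U P n).1 ((Gen.cross c x y).label D U P n).2).trans
      (sum_label h c x y Φ)
  exact (key P).trans (key P').symm

lemma LocalMove.tangleEquiv (h : IsBiOrientedQuantumAlgebra ρ γ D U) {X Y : List Slice}
    (hm : LocalMove X Y) : TangleEquiv t D U P P X Y := by
  cases hm with
  | exchange m g h => exact tangleEquiv_exchange m g h
  | zigzagRight o => exact tangleEquiv_zigzagRight o
  | zigzagLeft o => exact tangleEquiv_zigzagLeft o
  | capSlide c x y => exact tangleEquiv_capSlide h c x y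
  | cupSlide c x y => exact tangleEquiv_cupSlide h c x y
  | typeTwo c x y => exact tangleEquiv_typeTwo h c x y
  | typeThree c12 c13 c23 x y z hc => exact tangleEquiv_typeThree h hc x y z

lemma LocalMove.ne_nil {X Y : List Slice} (hm : LocalMove X Y) : X ≠ [] := by
  cases hm <;> simp

end LocalMoves

/-! ### The state sum as a sum over labels -/

section Link

variable {k A R B : Type*} [CommRing k] [Ring A] [Algebra k A] [CommRing R] [Algebra k R]
  [Ring B] [Algebra k B] {ρ γ : (A ⊗[k] A)ˣ} {D U : A ≃ₐ[k] A} {τ : ℤ → A →ₗ[k] R}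
  {t : TraceRing (U * D) τ B}

lemma Move.labelSum_eq (h : IsBiOrientedQuantumAlgebra ρ γ D U) (P : Presentations ρ γ)
    {K K' : Diagram} (hm : Move K K') {S S' : Finset Pos}
    (hS : IsTransversal (follow K.slices) {x | Valid [] K.slices x} S)
    (hS' : IsTransversal (follow K'.slices) {x | Valid [] K'.slices x} S') :
    labelSum D U P K.slices (fun ℓ => loopProd t.trace (follow K.slices)
        (bead t K.slices ℓ) S) =
      labelSum D U P K'.slices fun ℓ => loopProd t.trace (follow K'.slices)
        (bead t K'.slices ℓ) S' := by
  obtain ⟨l, r, pre, X, Y, post, hXY, hK, hK'⟩ := hm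
  have hc := K.closed
  rw [hK] at hS hc ⊢
  rw [hK'] at hS' ⊢
  exact ((hXY.tangleEquiv h).whisker l r).labelSum_eq (by simpa using hXY.ne_nil) hc hS hS'

lemma labelSum_presentation (h : IsBiOrientedQuantumAlgebra ρ γ D U) (P P' : Presentations ρ γ)
    {L : List Slice} (hL : Composable [] L []) {S : Finset Pos}
    (hS : IsTransversal (follow L) {x | Valid [] L x} S) :
    labelSum D U P L (fun ℓ => loopProd t.trace (follow L) (bead t L ℓ) S) =
      labelSum D U P' L fun ℓ => loopProd t.trace (follow L) (bead t L ℓ) S := by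
  -- The presentations are changed at one slice after the other.
  have key (post pre : List Slice) (hK : L = pre ++ post) :
      labelSum D U P' pre (fun a => labelSum D U P post fun b =>
        loopProd t.trace (follow L) (bead t L (a ++ b)) S) =
      labelSum D U P' pre fun a => labelSum D U P' post fun b =>
        loopProd t.trace (follow L) (bead t L (a ++ b)) S := by
    induction post generalizing pre with
    | nil => rfl
    | cons s post ih =>
      have h1 (a : List (A × A)) (ha : a.length = pre.length) (c : List (A × A)) :
          labelSum D U P [s] (fun b =>
            loopProd t.trace (follow L) (bead t L (a ++ b ++ c)) S) =
          labelSum D U P' [s] fun b =>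
            loopProd t.trace (follow L) (bead t L (a ++ b ++ c)) S := by
        obtain ⟨l, _ | _ | ⟨x, y, z⟩, r⟩ := s
        · simp only [labelSum_cup, labelSum_nil]
        · simp only [labelSum_cap, labelSum_nil]
        · have h2 := (tangleEquiv_presentation (t := t) P h P' x y z).whisker l r
          have h3 : L = pre ++ [⟨[], .cross x y z, []⟩].map (Slice.whisker l r) ++ post := by
            simpa [Slice.whisker] using hK
          have hL' := hL
          have hS' := hS
          rw [h3] at hL' hS' ⊢
          have h4 := h2.labelSum_inner (by simp) hL' hS' hS' ha c
          simpa [Slice.whisker] using h4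
      have h5 := ih (pre ++ [s]) (by simpa using hK)
      simp only [labelSum_append, List.append_assoc] at h5
      have h6 (a : List (A × A)) (ha : a.length = pre.length) :
          labelSum D U P (s :: post) (fun b =>
              loopProd t.trace (follow L) (bead t L (a ++ b)) S) =
            labelSum D U P' [s] fun b => labelSum D U P post fun c =>
              loopProd t.trace (follow L) (bead t L (a ++ (b ++ c))) S := by
        rw [show s :: post = [s] ++ post from rfl, labelSum_append, labelSum_comm D U P P [s] post,
          labelSum_comm D U P' P [s] post]
        refine labelSum_congr D U P fun c _ => ?_
        simpa only [List.append_assoc] using h1 a ha c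
      rw [labelSum_congr D U P' h6, h5]
      refine labelSum_congr D U P' fun a _ => ?_
      rw [show s :: post = [s] ++ post from rfl, labelSum_append]
  exact key L [] rfl

/-- A state corresponds to a choice of labels. -/
lemma labelSum_eq_sum {M : Type*} [AddCommMonoid M] (P : Presentations ρ γ) (L : List Slice)
    (F : List (A × A) → M) : labelSum D U P L F =
      ∑ σ : ∀ i : Fin L.length, Fin (L[i].gen.count P),
        F (List.ofFn fun i => L[i].gen.label D U P (σ i)) := by
  induction L generalizing F with
  | nil =>
    have : IsEmpty (Fin ([] : List Slice).length) := Fin.isEmpty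
    rw [labelSum, Fintype.sum_unique]
    rfl
  | cons s L ih =>
    simp only [labelSum, ih]
    rw [← Fintype.sum_prod_type']
    refine Fintype.sum_equiv (Fin.consEquiv
      fun i : Fin (L.length + 1) => Fin ((s :: L)[i].gen.count P)) _ _ fun x => ?_
    congr 1
    rw [List.ofFn_succ]
    rfl

end Link

section Diagrams

variable (K : Diagram)

lemma dir_eq_some {e : ℕ × ℕ} {d : Dir} : K.dir e = some d ↔ Valid [] K.slices (e.1, e.2, d) := by
  rw [Valid, Diagram.dir]
  rcases h : K.slices[e.1]? with _ | s
  · have h1 : K.slices.length ≤ e.1 := by simpa using h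
    have h2 : levelWord [] K.slices e.1 = [] := by
      rcases h1.eq_or_lt with h1 | h1
      · rw [← h1]
        exact K.closed.levelWord_length
      · exact levelWord_of_gt h1
    simp [h2]
  · rw [(K.closed.levelWord_eq h).1]
    rfl

/-- An edge, together with its direction. -/
def Diagram.pos (e : ℕ × ℕ) : Pos := (e.1, e.2, (K.dir e).getD .up)

variable {K}

lemma pos_eq {e : ℕ × ℕ} {d : Dir} (h : K.dir e = some d) : K.pos e = (e.1, e.2, d) := by
  rw [Diagram.pos, h]
  rfl

lemma entered_pos {e : ℕ × ℕ} {d : Dir} (h : K.dir e = some d) :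
    ∃ i : Fin K.slices.length, K.enters e = some (i, d) ∧
      entered K.slices (e.1, e.2, d) = some (i.1, K.slices[i]) := by
  have hv := (dir_eq_some K).1 h
  obtain ⟨i, s, h1, h2, -⟩ := step_eq_some.1 (K.closed.step_follow hv)
  obtain ⟨hi, rfl⟩ := List.getElem?_eq_some_iff.1 h2
  refine ⟨⟨i, hi⟩, ?_, entered_eq_some.2 ⟨h1, h2⟩⟩
  rw [Diagram.enters, h]
  obtain ⟨_ | j, p⟩ := e <;> cases d <;> simp [enteredIdx] at h1 <;> subst h1 <;> simp [hi]

lemma ascend_eq (s : Slice) (i p : ℕ) :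
    s.ascend i p = ((exitPos i (s.thru .up p)).1, (s.thru .up p).2) := by
  rw [Slice.ascend, Slice.thru]
  split_ifs with h
  · rcases h' : s.gen with _ | _ | _
    · rfl
    · rfl
    · rfl
  all_goals rfl

lemma descend_eq (s : Slice) (i p : ℕ) :
    s.descend i p = ((exitPos i (s.thru .down p)).1, (s.thru .down p).2) := by
  rw [Slice.descend, Slice.thru]
  split_ifs with h
  · rcases h' : s.gen with _ | _ | _
    · rfl
    · rfl
    · rfl
  all_goals rfl

lemma follow_pos {e : ℕ × ℕ} {d : Dir} (h : K.dir e = some d) :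
    follow K.slices (K.pos e) = K.pos (K.next e) ∧ (K.dir (K.next e)).isSome := by
  obtain ⟨i, h1, h2⟩ := entered_pos h
  have hv := K.closed.valid_follow ((dir_eq_some K).1 h)
  have h3 : ((follow K.slices (e.1, e.2, d)).1, (follow K.slices (e.1, e.2, d)).2.1) =
      K.next e := by
    rw [follow, step_of_entered h2, Option.getD_some, Diagram.next, h1]
    cases d
    · exact (ascend_eq _ _ _).symm
    · exact (descend_eq _ _ _).symm
  have h4 : K.dir (K.next e) = some (follow K.slices (e.1, e.2, d)).2.2 := by
    rw [← h3, dir_eq_some]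
    exact hv
  refine ⟨?_, by simp [h4]⟩
  rw [pos_eq h, pos_eq h4, ← h3]

lemma isFirstReturn_pos (K : Diagram) : IsFirstReturn (follow K.slices)
    {x | Valid [] K.slices x} K.next {e | (K.dir e).isSome} K.pos fun _ => 1 := by
  refine ⟨K.closed.valid_subset_periodicPts, fun e he => ?_, fun e _ e' _ h => ?_, fun e he => ?_,
    fun _ _ => Nat.one_pos, fun e he => ?_, fun _ _ j hj hj' => absurd hj' (by lia), ?_⟩
  · obtain ⟨d, hd⟩ := Option.isSome_iff_exists.1 he
    rw [pos_eq hd]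
    exact (dir_eq_some K).1 hd
  · simp only [Diagram.pos, Prod.mk.injEq] at h
    exact Prod.ext h.1 h.2.1
  · obtain ⟨d, hd⟩ := Option.isSome_iff_exists.1 he
    exact (follow_pos hd).2
  · obtain ⟨d, hd⟩ := Option.isSome_iff_exists.1 he
    exact (follow_pos hd).1
  · rintro ⟨i, p, d⟩ hx
    have hd : K.dir (i, p) = some d := (dir_eq_some K).2 hx
    exact ⟨0, (i, p), by simp [hd], (pos_eq hd).symm⟩

lemma mem_tour {e b : ℕ × ℕ} (hb : (K.dir b).isSome) :
    e ∈ K.tour b ↔ ∃ m, K.next^[m] b = e := by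
  have hpos := Function.minimalPeriod_pos_of_mem_periodicPts
    ((isFirstReturn_pos K).periodic_return hb)
  simp only [Diagram.tour, List.mem_map, List.mem_range]
  constructor
  · rintro ⟨m, -, hm⟩
    exact ⟨m, hm⟩
  · rintro ⟨m, hm⟩
    exact ⟨m % _, Nat.mod_lt _ hpos, by rw [Function.iterate_mod_minimalPeriod_eq, hm]⟩

lemma BasePoints.isTransversal (b : BasePoints K) :
    IsTransversal K.next {e | (K.dir e).isSome} b.edges := by
  have hb (e : ℕ × ℕ) (he : e ∈ b.edges) : (K.dir e).isSome := by simp [b.up e he]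
  refine ⟨hb, fun e he => ?_⟩
  obtain ⟨c, ⟨hc, hc'⟩, huniq⟩ := b.existsUnique e he
  exact ⟨c, ⟨hc, (mem_tour (hb c hc)).1 hc'⟩,
    fun c' hc' => huniq c' ⟨hc'.1, (mem_tour (hb c' hc'.1)).2 hc'.2⟩⟩

lemma dir_iterate {e : ℕ × ℕ} (he : (K.dir e).isSome) (m : ℕ) : (K.dir (K.next^[m] e)).isSome :=
  (isFirstReturn_pos K).iterate_mem he m

/-- Every component has an edge directed up, since a strand cannot descend forever. -/
lemma nonempty_basePoints (K : Diagram) : Nonempty (BasePoints K) := by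
  have hret := isFirstReturn_pos K
  have hfin : {e | (K.dir e).isSome}.Finite :=
    Set.Finite.of_injOn (f := K.pos) (t := {x | Valid [] K.slices x})
      (fun e he => hret.mapsTo e he) (fun e he e' he' h => hret.injOn e he e' he' h)
      (finite_valid _ _)
  have hup (e : ℕ × ℕ) (he : (K.dir e).isSome) : ∃ m, K.dir (K.next^[m] e) = some .up := by
    by_contra! hne
    have hdown (m : ℕ) : K.dir (K.next^[m] e) = some .down := by
      obtain ⟨d, hd⟩ := Option.isSome_iff_exists.1 (dir_iterate he m)
      cases d
      · exact absurd hd (hne m)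
      · exact hd
    have hlevel (m : ℕ) : (K.next^[m] e).1 + m = e.1 := by
      induction m with
      | zero => rfl
      | succ m ih =>
        have h1 := (follow_pos (hdown m)).1
        rw [← Function.iterate_succ_apply' K.next, pos_eq (hdown m), pos_eq (hdown (m + 1))] at h1
        obtain ⟨i, -, h2⟩ := entered_pos (hdown m)
        rw [follow, step_of_entered h2, Option.getD_some] at h1
        have h3 := (entered_eq_some.1 h2).1
        rw [← ih]
        revert h1 h3
        generalize K.next^[m] e = x
        generalize K.next^[m + 1] e = y
        obtain ⟨_ | j, p⟩ := x
        · simp [enteredIdx]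
        · generalize Slice.thru _ _ _ = z
          rcases z with ⟨_ | _, q⟩
          · simp [exitPos]
          · simp only [exitPos, enteredIdx, Prod.mk.injEq, Option.some.injEq]
            lia
    have := hlevel (e.1 + 1)
    lia
  obtain ⟨S, hS, hS'⟩ := exists_isTransversal hfin hret.periodic_return hret.invariant
    (fun e => K.dir e = some .up) hup
  refine ⟨⟨S, hS', fun e he => ?_⟩⟩
  have hb (b : ℕ × ℕ) (hb : b ∈ S) : (K.dir b).isSome := by simp [hS' b hb]
  obtain ⟨c, ⟨hc, hc'⟩, huniq⟩ := hS.existsUnique e he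
  exact ⟨c, ⟨hc, (mem_tour (hb c hc)).2 hc'⟩,
    fun c' hc' => huniq c' ⟨hc'.1, (mem_tour (hb c' hc'.1)).1 hc'.2⟩⟩

end Diagrams

/-! ### The words of the loops -/

section LoopWords

variable {k A R B : Type*} [CommRing k] [Ring A] [Algebra k A] [CommRing R] [Algebra k R]
  [Ring B] [Algebra k B] {ρ γ : (A ⊗[k] A)ˣ} {D U : A ≃ₐ[k] A} {τ : ℤ → A →ₗ[k] R}
  (t : TraceRing (U * D) τ B) (P : Presentations ρ γ)

/-- The number of half turns between the upward direction and a given one. -/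
def Dir.offset : Dir → ℤ
  | .up => 0
  | .down => 1

/-- In the frame, carrying a bead through a slice is multiplication by the bead met there, up to a
power of `turn` that counts the half turns of the strand. -/
lemma Slice.exists_carry (hDU : ∀ x, D (U x) = U (D x)) (s : Slice) (n : Fin (s.gen.count P))
    {d : Dir} {p : ℕ} (h : (s.inWord d)[p]? = some d) (w : A) :
    ∃ m : ℤ, t.incl (frame D d w) * s.bead t (s.gen.label D U P n) d p =
        (t.turn ^ m : Bˣ) * t.incl (frame D (s.thru d p).1 (if s.Hits d p then
          s.gen.carry D U P n (d = .up ↔ p = s.left.length) w else w)) ∧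
      s.halfTurns d p = 2 * m + d.offset - (s.thru d p).1.offset := by
  by_cases hp : s.Hits d p
  · obtain ⟨h1, h2⟩ := (s.hits_iff d p).1 hp
    obtain ⟨q, rfl⟩ := Nat.exists_eq_add_of_le h1
    have hq : q < (s.gen.inWord d).length := by lia
    rw [Slice.getElem_inWord_gen hq] at h
    rw [Slice.thru_of_hits hq, if_pos hp, Slice.bead, if_pos hp, Slice.halfTurns, if_pos hp]
    obtain ⟨l, g, r⟩ := s
    simp only at *
    rcases g with o | o | ⟨c, a, b⟩
    · cases d
      · simp [Gen.inWord, Gen.dom] at hq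
      cases o
      · refine ⟨-1, ?_, rfl⟩
        simp [Gen.bead, Gen.turn, Gen.carry, frame, t.turn_inv_mul_incl, ← hDU]
      · refine ⟨0, ?_, rfl⟩
        simp [Gen.bead, Gen.turn, Gen.carry, frame]
    · cases d
      · cases o
        · refine ⟨0, ?_, rfl⟩
          simp [Gen.bead, Gen.turn, Gen.carry, frame]
        · refine ⟨1, ?_, rfl⟩
          simp [Gen.bead, Gen.turn, Gen.carry, frame, t.incl_mul_turn, hDU]
      · simp [Gen.inWord, Gen.cod] at hq
    · refine ⟨0, ?_, by simp [Gen.turn]⟩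
      simp only [Gen.bead, Gen.turn, Gen.carry, Gen.label, zpow_zero, Units.val_one, one_mul,
        map_mul]
      congr 2
      have hq2 : q < 2 := by cases d <;> exact hq
      interval_cases q <;> cases d <;> simp [Gen.inWord, Gen.dom, Gen.cod] at h <;> subst h <;>
        simp
  · refine ⟨0, ?_, ?_⟩
    · simp [Slice.bead, hp, Slice.thru]
    · simp [Slice.halfTurns, hp, Slice.thru]

variable {K : Diagram} (σ : State P K)

/-- The labels of a state, in the frame. -/
def State.labels : List (A × A) := List.ofFn fun i => K.slices[i].gen.label D U P (σ i)

/-- The counterclockwise rotation of the strand following the edge `e`, in half turns. -/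
def Diagram.halfTurnsAt (K : Diagram) (e : ℕ × ℕ) : ℤ :=
  match K.enters e with
  | some (i, d) => K.slices[i].halfTurns d e.2
  | none => 0

variable {P}

lemma exists_carry (hDU : ∀ x, D (U x) = U (D x)) {e : ℕ × ℕ} {d d' : Dir}
    (h : K.dir e = some d) (h' : K.dir (K.next e) = some d') (w : A) :
    ∃ m : ℤ, t.incl (frame D d w) * bead t K.slices (State.labels (D := D) (U := U) P σ) (K.pos e) =
        (t.turn ^ m : Bˣ) * t.incl (frame D d' (K.carry D U P σ w e)) ∧
      K.halfTurnsAt e = 2 * m + d.offset - d'.offset := by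
  obtain ⟨i, h1, h2⟩ := entered_pos h
  have hv : (K.slices[i].inWord d)[e.2]? = some d := by
    obtain ⟨h3, h4⟩ := entered_eq_some.1 h2
    have h5 := K.closed.levelWord_entered h3 h4
    rw [← h5]
    exact (dir_eq_some K).1 h
  have hd' : (K.slices[i].thru d e.2).1 = d' := by
    have h3 := (follow_pos h).1
    rw [pos_eq h', pos_eq h, follow, step_of_entered h2, Option.getD_some] at h3
    have h4 := congrArg (fun x : Pos => x.2.2) h3
    revert h4
    simp only
    generalize K.slices[i].thru d e.2 = z
    obtain ⟨_ | _, q⟩ := z <;> exact id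
  obtain ⟨m, h3, h4⟩ := Slice.exists_carry t P hDU K.slices[i] (σ i) hv w
  rw [hd'] at h3 h4
  refine ⟨m, ?_, ?_⟩
  · rw [pos_eq h, bead_of_entered t h2]
    simp only [State.labels, Diagram.carry, h1]
    rw [← h3]
    congr 2
    simp
  · simpa only [Diagram.halfTurnsAt, h1] using h4

/-- In the frame, following a strand from an upward edge produces a power of `turn` times the bead
carried along, where the exponent is half the number of half turns, rounded up while the strand
points down. -/
lemma exists_orbitWord (hDU : ∀ x, D (U x) = U (D x)) {b : ℕ × ℕ} (hb : K.dir b = some .up)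
    (j : ℕ) {d : Dir} (hd : K.dir (K.next^[j] b) = some d) :
    ∃ n : ℤ, orbitWord K.next (fun e => bead t K.slices (State.labels (D := D) (U := U) P σ)
        (K.pos e)) b j = (t.turn ^ n : Bˣ) * t.incl (frame D d
          (((List.range j).map fun i => K.next^[i] b).foldl (K.carry D U P σ) 1)) ∧
      (((List.range j).map fun i => K.next^[i] b).map K.halfTurnsAt).sum = 2 * n - d.offset := by
  induction j generalizing d with
  | zero =>
    obtain rfl : Dir.up = d := by simpa [hb] using hd
    exact ⟨0, by simp, rfl⟩
  | succ j ih =>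
    obtain ⟨c, hc⟩ := Option.isSome_iff_exists.1 (dir_iterate (K := K) (e := b) (by simp [hb]) j)
    obtain ⟨n, h1, h2⟩ := ih hc
    rw [Function.iterate_succ_apply'] at hd
    obtain ⟨m, h3, h4⟩ := exists_carry t σ hDU hc hd
      (((List.range j).map fun i => K.next^[i] b).foldl (K.carry D U P σ) 1)
    refine ⟨n + m, ?_, ?_⟩
    · rw [orbitWord_succ, h1, mul_assoc, h3, ← mul_assoc, zpow_add, Units.val_mul]
      simp [List.range_succ]
    · rw [List.range_succ, List.map_append, List.map_append, List.sum_append, h2]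
      simp only [List.map_cons, List.map_nil, List.sum_singleton, h4]
      ring

/-- In the frame, a loop with rotation number `d` carries `turn ^ d` times its bead. -/
lemma trace_loopWord (hDU : ∀ x, D (U x) = U (D x)) {b : ℕ × ℕ} (hb : K.dir b = some .up) :
    t.trace (loopWord K.next (fun e => bead t K.slices (State.labels (D := D) (U := U) P σ)
      (K.pos e)) b) = τ (K.rotation b) (K.loopBead D U P σ b) := by
  obtain ⟨n, h1, h2⟩ := exists_orbitWord t σ hDU hb (Function.minimalPeriod K.next b) (d := .up)
    (by rw [Function.iterate_minimalPeriod, hb])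
  have h3 : K.rotation b = n := by
    have h4 : K.rotation b = ((K.tour b).map K.halfTurnsAt).sum / 2 := rfl
    rw [h4, Diagram.tour, h2, Dir.offset, sub_zero]
    exact Int.mul_ediv_cancel_left n two_ne_zero
  rw [loopWord, h1, h3, t.trace_turn_zpow]
  rfl

lemma stateSum_eq_labelSum (hDU : ∀ x, D (U x) = U (D x)) (P : Presentations ρ γ)
    (b : BasePoints K) : stateSum D U P τ K b =
      labelSum D U P K.slices fun ℓ => loopProd t.trace (follow K.slices)
        (bead t K.slices ℓ) (b.edges.image K.pos) := by
  rw [labelSum_eq_sum, stateSum]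
  refine Finset.sum_congr rfl fun σ _ => ?_
  rw [(isFirstReturn_pos K).loopProd_image (fun e _ => by simp [orbitWord]; rfl) t.trace
    b.isTransversal, loopProd]
  exact Finset.prod_congr rfl fun e he => (trace_loopWord t σ hDU (b.up e he)).symm

end LoopWords

/-! ### Invariance of the state sum -/

section Invariance

universe v

variable {k R : Type*} {A : Type v} [CommRing k] [Ring A] [Algebra k A] [CommRing R]
  [Algebra k R] {ρ γ : (A ⊗[k] A)ˣ} {D U : A ≃ₐ[k] A} {τ : ℤ → A →ₗ[k] R}

lemma nonempty_presentation (x : A ⊗[k] A) : Nonempty (Presentation x) := by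
  obtain ⟨S, hS⟩ := TensorProduct.exists_finset x
  refine ⟨⟨S.card, fun i => (S.equivFin.symm i).1.1, fun i => (S.equivFin.symm i).1.2, ?_⟩⟩
  rw [hS, ← Finset.sum_coe_sort S]
  exact Fintype.sum_equiv S.equivFin.symm _ _ fun _ => rfl

lemma stateSum_eq_of_move (h : IsBiOrientedQuantumAlgebra ρ γ D U) (hτ : IsLoopTrace D U τ)
    {K K' : Diagram} (hm : Move K K') (P : Presentations ρ γ) (b : BasePoints K)
    (b' : BasePoints K') : stateSum D U P τ K b = stateSum D U P τ K' b' := by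
  obtain ⟨B, _, _, ⟨t⟩⟩ := exists_traceRing (U * D) τ hτ.cyclic hτ.shift
  rw [stateSum_eq_labelSum t h.real.comm, stateSum_eq_labelSum t h.real.comm]
  exact hm.labelSum_eq h P ((isFirstReturn_pos K).isTransversal b.isTransversal)
    ((isFirstReturn_pos K').isTransversal b'.isTransversal)

lemma stateSum_eq_stateSum (h : IsBiOrientedQuantumAlgebra ρ γ D U) (hτ : IsLoopTrace D U τ)
    {K : Diagram} (P P' : Presentations ρ γ) (b b' : BasePoints K) :
    stateSum D U P τ K b = stateSum D U P' τ K b' := by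
  obtain ⟨B, _, _, ⟨t⟩⟩ := exists_traceRing (U * D) τ hτ.cyclic hτ.shift
  have hb := (isFirstReturn_pos K).isTransversal b.isTransversal
  have hb' := (isFirstReturn_pos K).isTransversal b'.isTransversal
  rw [stateSum_eq_labelSum t h.real.comm, stateSum_eq_labelSum t h.real.comm,
    labelSum_presentation h P P' K.closed hb]
  exact labelSum_congr D U P' fun ℓ _ => loopProd_eq_of_isTransversal t.trace_mul_comm
    K.closed.valid_subset_periodicPts _ hb hb'

/-- The state sum of a loop trace is an invariant of framed virtual links. -/
theorem existsUnique_stateSum (h : IsBiOrientedQuantumAlgebra ρ γ D U) (hτ : IsLoopTrace D U τ) :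
    ∃! Z : FramedVirtualLink → R, ∀ (K : Diagram) (P : Presentations ρ γ) (B : BasePoints K),
      stateSum D U P τ K B = Z (FramedVirtualLink.mk K) := by
  let P : Presentations ρ γ := fun c => (nonempty_presentation _).some
  let b (K : Diagram) : BasePoints K := (nonempty_basePoints K).some
  refine ⟨Quot.lift (fun K => stateSum D U P τ K (b K))
    fun K K' hm => stateSum_eq_of_move h hτ hm P _ _,
    fun K P' b' => stateSum_eq_stateSum h hτ _ _ _ _, fun Z hZ => funext fun x => ?_⟩
  obtain ⟨K, rfl⟩ := Quot.exists_rep x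
  exact (hZ K P (b K)).symm

lemma isLoopTrace_universalTrace (D U : A ≃ₐ[k] A) : IsLoopTrace D U (universalTrace D U) where
  cyclic d x y := by
    refine congrArg (SymmetricAlgebra.ι k (LoopModule D U)) ((Submodule.Quotient.eq _).2 ?_)
    exact Submodule.subset_span (.inl ⟨d, x, y, rfl⟩)
  shift d x := by
    refine congrArg (SymmetricAlgebra.ι k (LoopModule D U)) ((Submodule.Quotient.eq _).2 ?_)
    exact Submodule.subset_span (.inr ⟨d, x, rfl⟩)

end Invariance

end BiOriented

end

open scoped TensorProduct in
open BiOriented in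
theorem mainTheorem7 {k A : Type*} [CommRing k] [Ring A] [Algebra k A]
    (ρ γ : (A ⊗[k] A)ˣ) (D U : A ≃ₐ[k] A) (h : IsBiOrientedQuantumAlgebra ρ γ D U) :
    (∃! W : FramedVirtualLink → SymmetricAlgebra k (LoopModule D U),
      ∀ (K : Diagram) (P : Presentations ρ γ) (B : BasePoints K),
        stateSum D U P (universalTrace D U) K B = W (FramedVirtualLink.mk K)) ∧
    ∀ (R : Type*) [CommRing R] [Algebra k R] (τ : ℤ → A →ₗ[k] R), IsLoopTrace D U τ →
      ∃! Z : FramedVirtualLink → R,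
        ∀ (K : Diagram) (P : Presentations ρ γ) (B : BasePoints K),
          stateSum D U P τ K B = Z (FramedVirtualLink.mk K) := by
  exact ⟨existsUnique_stateSum h (isLoopTrace_universalTrace D U),
    fun _ _ _ _ hτ => existsUnique_stateSum h hτ⟩
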